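/- Let $d\ge 1$, $T>0$ and $\alpha>\max\{0,d-2\}$, and let $f=B_\alpha$ be the Bessel kernel of order $\alpha$ on $\mathbb{R}^d$, $B_\alpha(x)=c_\alpha\int_0^\infty \tau^{(\alpha-d)/2-1}e^{-\tau-|x|^2/(4\tau)}\,d\tau$ with $c_\alpha=\big((4\pi)^{d/2}\Gamma(\alpha/2)\big)^{-1}$, so that convolution with $B_\alpha$ is $(1-\Delta)^{-\alpha/2}$. *The process and its RKHS.* Let $F=\{F(\varphi);\varphi\in\mathcal D((0,T)\times\mathbb{R}^d)\}$ be a zero-mean Gaussian process on a probability space $\Omega$, indexed by the real test functions, with covariance $E(F(\varphi)F(\psi))=\int_0^T\!\int\!\int\varphi(t,x)f(x-y)\psi(t,y)\,dy\,dx\,dt$. For measurable $\varphi$ with $\|\varphi\|_+^2=\int_0^T\!\int\!\int|\varphi(t,x)|f(x-y)|\varphi(t,y)|\,dy\,dx\,dt<\infty$, let $M(\varphi)$ be the $L_2(\Omega)$-limit of $F(\varphi_n)$, where $\varphi_n\in\mathcal D((0,T)\times\mathbb{R}^d)$ and $\|\varphi_n-\varphi\|_+\to0$. Let $u(t,x)=M\big(G(t-\cdot,x-\cdot)\big)$,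 $(t,x)\in[0,T]\times\mathbb{R}^d$, with $G(t,x)=(4\pi t)^{-d/2}e^{-|x|^2/(4t)}$ for $t>0$ and $G=0$ for $t\le0$, be the process solution of the stochastic heat equation $u_t-\Delta u=\dot F$, $u(0,\cdot)=0$. Let $H^u$ be the closed linear span of $\{u(t,x)\}$ in $L_2(\Omega)$, and let $\mathcal H^u=\{h_Y:\ h_Y(t,x)=E(Yu(t,x)),\ Y\in H^u\}$, a set of functions on $[0,T]\times\mathbb{R}^d$, with norm $\|h_Y\|_{\mathcal H^u}=\|Y\|_{L_2(\Omega)}$ for $Y\in H^u$. *The parabolic space.* For $\gamma\in\mathbb{R}$ let $H_2^\gamma(\mathbb{R}^d)$ be the space of tempered distributions $\varphi$ whose Fourier transform (with the normalization $(2\pi)^{-d/2}$) is a function with $\|\varphi\|_{\gamma,2}^2=\int|\mathcal F\varphi(\xi)|^2(1+|\xi|^2)^\gamma d\xi<\infty$. The space $\mathcal H^{\gamma}_{2,0}(T)$ consists of all functions $v$ on $[0,T]$ whose values are real tempered distributions on $\mathbb{R}^d$ lying in $H_2^\beta(\mathbb{R}^d)$ for some $\beta\in\mathbb{R}$ independent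 of $t$, such that $v(0)=0$, $v_{xx}\in L_2((0,T),H_2^{\gamma-2}(\mathbb{R}^d))$, and there is $g\in L_2((0,T),H_2^{\gamma-2}(\mathbb{R}^d))$ with $$(v(t),\psi)=\int_0^t(v(s),\Delta\psi)\,ds+\int_0^t(g(s),\psi)\,ds\qquad\text{for all }t\in[0,T],\ \psi\in\mathcal D(\mathbb{R}^d).$$ Its norm is $\|v\|_{\mathcal H^\gamma_{2,0}(T)}=\|v_{xx}\|_{L_2((0,T),H_2^{\gamma-2})}+\|g\|_{L_2((0,T),H_2^{\gamma-2})}$, where $\|v_{xx}\|^2=\sum_{i,j}\|v_{x_ix_j}\|^2$ and $g$ is determined by $v$ for almost every $t$. *Claim.* Then $$\mathcal H^u=\mathcal H_{2,0}^{\alpha/2+2}(T),$$ with equivalent norms, where a function $h\in\mathcal H^u$ is identified with the distribution-valued function $t\mapsto h(t,\cdot)$. That is: for every $h\in\mathcal H^u$ the function $t\mapsto h(t,\cdot)$ belongs to $\mathcal H_{2,0}^{\alpha/2+2}(T)$; every element of $\mathcal H_{2,0}^{\alpha/2+2}(T)$ arises so from exactly one $h\in\mathcal H^u$; and there are constants $c,C>0$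 depending only on $d,\alpha,T$ such that $c\|h\|_{\mathcal H^u}\le\|h\|_{\mathcal H_{2,0}^{\alpha/2+2}(T)}\le C\|h\|_{\mathcal H^u}$ for all $h\in\mathcal H^u$. -/

import Mathlib

open MeasureTheory ProbabilityTheory Set Filter Topology
open scoped ENNReal SchwartzMap Distributions LineDeriv Laplacian FourierTransform

noncomputable section

namespace HeatRKHS

/-- The Euclidean space `ℝᵈ`. -/
abbrev Space (d : ℕ) : Type := EuclideanSpace ℝ (Fin d)

/-- The closed time interval `[0, T]`; as a subtype it carries Lebesgue measure. -/
abbrev Time (T : ℝ) : Type := Icc (0 : ℝ) T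

instance (T : ℝ) : MeasureSpace (Time T) := Measure.Subtype.measureSpace

/-! ### The noise -/

/-- The Bessel kernel of order `α` on `ℝᵈ`,
`B_α(x) = c_α ∫_0^∞ τ^((α-d)/2-1) exp(-τ-|x|²/(4τ)) dτ`, with the constant
`c_α = 1 / ((4π)^(d/2) Γ(α/2))` for which convolution with `B_α` is `(1-Δ)^(-α/2)`. -/
def besselKernel (d : ℕ) (α : ℝ) (x : Space d) : ℝ :=
  ((4 * Real.pi) ^ ((d : ℝ) / 2) * Real.Gamma (α / 2))⁻¹ *
    ∫ τ in Ioi (0 : ℝ), τ ^ ((α - d) / 2 - 1) * Real.exp (-τ - ‖x‖ ^ 2 / (4 * τ))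

/-- The open slab `(0, T) × ℝᵈ`. -/
def slab (d : ℕ) (T : ℝ) : TopologicalSpace.Opens (ℝ × Space d) :=
  ⟨Ioo 0 T ×ˢ univ, isOpen_Ioo.prod isOpen_univ⟩

/-- Real test functions: `𝒟((0, T) × ℝᵈ)`. -/
abbrev Test (d : ℕ) (T : ℝ) : Type := 𝓓(slab d T, ℝ)

/-- The bilinear form `J_f(φ, ψ) = ∫_0^T ∫ ∫ φ(t,x) f(x-y) ψ(t,y) dy dx dt`. -/
def covForm {d : ℕ} (T : ℝ) (f : Space d → ℝ) (φ ψ : ℝ × Space d → ℝ) : ℝ :=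
  ∫ t in Ioo (0 : ℝ) T, ∫ x, ∫ y, φ (t, x) * f (x - y) * ψ (t, y)

/-- `F` is a zero-mean Gaussian process, indexed by test functions, with covariance `J_f`. -/
structure IsNoise {d : ℕ} (T : ℝ) (f : Space d → ℝ) {Ω : Type*} [MeasurableSpace Ω]
    (P : Measure Ω) (F : Test d T → Ω → ℝ) : Prop where
  gaussian : IsGaussianProcess F P
  mean_zero : ∀ φ, ∫ ω, F φ ω ∂P = 0
  covariance : ∀ φ ψ, ∫ ω, F φ ω * F ψ ω ∂P = covForm T f φ ψ

/-- `‖φ‖₊² = ∫_0^T ∫ ∫ |φ(t,x)| f(x-y) |φ(t,y)| dy dx dt`, for a nonnegative kernel `f`. -/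
def plusNormSq {d : ℕ} (T : ℝ) (f : Space d → ℝ) (φ : ℝ × Space d → ℝ) : ℝ≥0∞ :=
  ∫⁻ t in Ioo (0 : ℝ) T, ∫⁻ x, ∫⁻ y,
    ‖φ (t, x)‖ₑ * ENNReal.ofReal (f (x - y)) * ‖φ (t, y)‖ₑ

section Solution

variable {d : ℕ} {T : ℝ} {f : Space d → ℝ} {Ω : Type*} [MeasurableSpace Ω]
  {P : Measure Ω} {F : Test d T → Ω → ℝ}

/-- The noise variable `F(φ)` as an element of `L²(Ω)`. -/
def IsNoise.toL2 (hF : IsNoise T f P F) (φ : Test d T) : Lp ℝ 2 P :=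
  (hF.gaussian.hasGaussianLaw_eval φ).memLp_two.toLp (F φ)

/-- The stochastic integral `M(φ) = ∫∫ φ dM`: the limit in `L²(Ω)` of `F(ψ)` as test functions `ψ`
approach the integrand `φ` in the norm `‖·‖₊`. -/
def IsNoise.stochInt (hF : IsNoise T f P F) (φ : ℝ × Space d → ℝ) : Lp ℝ 2 P :=
  limUnder (comap (fun ψ : Test d T => plusNormSq T f (fun z => φ z - ψ z)) (𝓝 0)) hF.toL2

/-- The fundamental solution of the heat equation, extended by `0` to `t ≤ 0`. -/
def heatKernel (t : ℝ) (x : Space d) : ℝ :=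
  if 0 < t then (4 * Real.pi * t) ^ (-(d : ℝ) / 2) * Real.exp (-‖x‖ ^ 2 / (4 * t)) else 0

/-- The process solution `u(t,x) = ∫∫ G(t-s, x-y) M(ds, dy)` of the stochastic heat equation
`u_t - Δu = Ḟ`, `u(0, ·) = 0`. -/
def IsNoise.solution (hF : IsNoise T f P F) (t : Time T) (x : Space d) : Lp ℝ 2 P :=
  hF.stochInt (fun z => heatKernel ((t : ℝ) - z.1) (x - z.2))

/-- The Gaussian space of a process `u`: the closed linear span of its variables in `L²(Ω)`. -/
def gaussianSpace (u : Time T → Space d → Lp ℝ 2 P) : Submodule ℝ (Lp ℝ 2 P) :=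
  (Submodule.span ℝ (range fun z : Time T × Space d => u z.1 z.2)).topologicalClosure

/-- The function `h_Y(t,x) = E(Y u(t,x))`. -/
def rkhsFun (u : Time T → Space d → Lp ℝ 2 P) (Y : Lp ℝ 2 P) (t : Time T) (x : Space d) : ℝ :=
  ∫ ω, Y ω * u t x ω ∂P

/-- The reproducing kernel Hilbert space of `u`: the functions `h_Y` with `Y` in the Gaussian
space of `u`. -/
def rkhs (u : Time T → Space d → Lp ℝ 2 P) : Set (Time T → Space d → ℝ) :=
  rkhsFun u '' (gaussianSpace u : Set (Lp ℝ 2 P))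

/-- The norm of the reproducing kernel Hilbert space: `‖h_Y‖ = ‖Y‖_{L²(Ω)}` for the (unique) `Y` in
the Gaussian space that gives `h = h_Y`. -/
def rkhsNorm (u : Time T → Space d → Lp ℝ 2 P) (h : Time T → Space d → ℝ) : ℝ :=
  ⨅ Y : {Y : Lp ℝ 2 P // Y ∈ gaussianSpace u ∧ rkhsFun u Y = h}, ‖(Y : Lp ℝ 2 P)‖

theorem eq_of_rkhsFun_eq (u : Time T → Space d → Lp ℝ 2 P) {Y Z : Lp ℝ 2 P}
    (hY : Y ∈ gaussianSpace u) (hZ : Z ∈ gaussianSpace u) (h : rkhsFun u Y = rkhsFun u Z) :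
    Y = Z := by
  have key : ∀ (V : Lp ℝ 2 P) t x, rkhsFun u V t x = inner ℝ (u t x) V := by
    intro V t x
    rw [L2.inner_def]
    simp [rkhsFun]
  have h0 : ∀ W ∈ gaussianSpace u, inner ℝ W (Y - Z) = 0 := by
    have hle : gaussianSpace u ≤ (Submodule.span ℝ {Y - Z})ᗮ := by
      refine Submodule.topologicalClosure_minimal _ (Submodule.span_le.2 ?_)
        (Submodule.isClosed_orthogonal _)
      rintro _ ⟨⟨t, x⟩, rfl⟩
      refine Submodule.mem_orthogonal_singleton_iff_inner_left.2 ?_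
      have := congrFun (congrFun h t) x
      rw [key, key] at this
      simp [inner_sub_right, this]
    exact fun W hW => Submodule.mem_orthogonal_singleton_iff_inner_left.1 (hle hW)
  exact sub_eq_zero.1 (inner_self_eq_zero.1 (h0 _ (sub_mem hY hZ)))

theorem rkhsNorm_rkhsFun (u : Time T → Space d → Lp ℝ 2 P) {Y : Lp ℝ 2 P}
    (hY : Y ∈ gaussianSpace u) : rkhsNorm u (rkhsFun u Y) = ‖Y‖ := by
  have : Nonempty {Z : Lp ℝ 2 P // Z ∈ gaussianSpace u ∧ rkhsFun u Z = rkhsFun u Y} :=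
    ⟨⟨Y, hY, rfl⟩⟩
  have hc : ∀ Z : {Z : Lp ℝ 2 P // Z ∈ gaussianSpace u ∧ rkhsFun u Z = rkhsFun u Y},
      ‖(Z : Lp ℝ 2 P)‖ = ‖Y‖ := fun Z => by rw [eq_of_rkhsFun_eq u Z.2.1 hY Z.2.2]
  simp [rkhsNorm, hc]

end Solution

/-! ### Sobolev spaces and the parabolic space -/

section Parabolic

variable {d : ℕ} {T : ℝ}

/-- The tempered distribution `φ` has Fourier transform the function `k`. -/
def HasFourierFun (φ : 𝓢'(Space d, ℂ)) (k : Space d → ℂ) : Prop :=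
  ∀ ψ : 𝓢(Space d, ℂ), (𝓕 φ) ψ = ∫ ξ, k ξ * ψ ξ

/-- The norm of `L₂((0,T), H₂^γ(ℝᵈ))`, with value `∞` off this space: the square root of
`∫_0^T ∫ |ĝ(t,ξ)|² (1+|2πξ|²)^γ dξ dt` for a jointly measurable version of `ĝ`. Here
`ĝ(ξ) = ∫ exp(-2πi ξ·x) g(x) dx`; the factor `2π` in the weight makes this the same number as
`∫_0^T ∫ |ℱg(t,ξ)|² (1+|ξ|²)^γ dξ dt` for `ℱg(ξ) = (2π)^(-d/2) ∫ exp(-i ξ·x) g(x) dx`. -/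
def l2SobolevNorm (γ : ℝ) (g : Time T → 𝓢'(Space d, ℂ)) : ℝ≥0∞ :=
  ⨅ (k : Time T × Space d → ℂ) (_ : Measurable k)
    (_ : ∀ᵐ t : Time T, HasFourierFun (g t) (fun ξ => k (t, ξ))),
    (∫⁻ t : Time T, ∫⁻ ξ : Space d,
      ‖k (t, ξ)‖ₑ ^ 2 * ENNReal.ofReal ((1 + (2 * Real.pi * ‖ξ‖) ^ 2) ^ γ)) ^ (1 / 2 : ℝ)

/-- The second distributional space derivative `v_{x_i x_j}`. -/
def secondDeriv (v : Time T → 𝓢'(Space d, ℂ)) (i j : Fin d) (t : Time T) : 𝓢'(Space d, ℂ) :=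
  ∂_{EuclideanSpace.basisFun (Fin d) ℝ i} (∂_{EuclideanSpace.basisFun (Fin d) ℝ j} (v t))

/-- The norm of the Hessian `v_xx` in `L₂((0,T), H₂^γ(ℝᵈ))`. -/
def hessianNorm (γ : ℝ) (v : Time T → 𝓢'(Space d, ℂ)) : ℝ≥0∞ :=
  (∑ i, ∑ j, l2SobolevNorm γ (secondDeriv v i j) ^ 2) ^ (1 / 2 : ℝ)

/-- `v` solves `dv = (Δv + g) dt` in the integrated sense: for every test function `ψ` on `ℝᵈ` and
every `t`, `(v(t), ψ) = ∫_0^t (v(s), Δψ) ds + ∫_0^t (g(s), ψ) ds`. -/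
def SolvesHeat (v g : Time T → 𝓢'(Space d, ℂ)) : Prop :=
  ∀ (t : Time T) (ψ : 𝓢(Space d, ℂ)), HasCompactSupport ψ →
    v t ψ = (∫ s in Iic t, v s (Δ ψ)) + ∫ s in Iic t, g s ψ

/-- A real distribution: it takes real values on real-valued functions. -/
def IsRealDistribution (φ : 𝓢'(Space d, ℂ)) : Prop :=
  ∀ ψ : 𝓢(Space d, ℂ), (∀ x, (ψ x).im = 0) → (φ ψ).im = 0

/-- Membership in the parabolic space `ℋ^γ_{2,0}(T)`. -/
structure MemParabolic (γ : ℝ) (v : Time T → 𝓢'(Space d, ℂ)) : Prop where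
  sobolev : ∃ β : ℝ, ∀ t, TemperedDistribution.MemSobolev β 2 (v t)
  real : ∀ t, IsRealDistribution (v t)
  initial : ∀ t : Time T, (t : ℝ) = 0 → v t = 0
  hessian : hessianNorm (γ - 2) v < ∞
  source : ∃ g : Time T → 𝓢'(Space d, ℂ), l2SobolevNorm (γ - 2) g < ∞ ∧ SolvesHeat v g

/-- The norm `‖v_xx‖ + ‖g‖` of `ℋ^γ_{2,0}(T)`, both terms in `L₂((0,T), H₂^(γ-2)(ℝᵈ))`; the
infimum ranges over the sources `g` of `v`, which agree for almost every time. -/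
def parabolicNorm (γ : ℝ) (v : Time T → 𝓢'(Space d, ℂ)) : ℝ≥0∞ :=
  hessianNorm (γ - 2) v +
    ⨅ (g : Time T → 𝓢'(Space d, ℂ)) (_ : SolvesHeat v g), l2SobolevNorm (γ - 2) g

/-- The function `h` on `[0,T] × ℝᵈ` and the distribution-valued function `v` are the same object:
for every `t`, `v(t)` is integration against `h(t, ·)`. -/
def Represents (h : Time T → Space d → ℝ) (v : Time T → 𝓢'(Space d, ℂ)) : Prop :=
  ∀ (t : Time T) (ψ : 𝓢(Space d, ℂ)),
    Integrable (fun x => (h t x : ℂ) * ψ x) ∧ v t ψ = ∫ x, (h t x : ℂ) * ψ x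

end Parabolic

end HeatRKHS

end

open HeatRKHS

noncomputable section

namespace HeatRKHS

/-! ### Families with the same Gram matrix -/

section Gram

variable {Z H K : Type*} [NormedAddCommGroup H] [InnerProductSpace ℝ H]
  [NormedAddCommGroup K] [InnerProductSpace ℝ K]

/-! The whole argument takes place on the Fourier side. Write `l` for the symbol of `-Δ`. The
covariance of `u(t,x)` and `u(t',x')` is the real `L²` inner product, over time and frequency, of
the functions `1_{s ≤ t} e^{-l(t-s)} (1+l)^{-α/4} e^{-2πi ξ·x}` (`heatFreq`) at the two points; this
is `IsNoise.inner_solution`. It comes from writing the Bessel kernel as a Gamma mixture of heat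
kernels: each pairing of heat kernels against `B_α` is explicit by the semigroup property, and the
Laplace transform of the Gamma density supplies the symbol `(1+l)^{-α/2}`. Families with equal Gram
matrices have isometric closed spans, so the Gaussian space can be replaced by the closed span of
the `heatFreq` functions.

Pairing `heatFreq` at `(t,x)` with `y` in `L²` applies Duhamel's formula to the source `(1+l)^{-α/4}
y`, inverts the Fourier transform at `x` and takes the real part (`inner_heatFreqL2_eq`). The
`H^{α/2}` norm of that source is the `L²` norm of `y`. Hence the reproducing kernel Hilbert space
consists of the fields `heatField k` of all sources `k` of finite norm, orthogonal projection
showing that no source is lost.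

The parabolic space is the same set: a distribution solving `dv = (Δv + g) dt` with zero initial
value obeys a scalar linear equation at almost every frequency, hence is given by Duhamel's formula
(`hasFourierFun_duhamel_of_solvesHeat`), and maximal regularity bounds `v_xx` by `g` with constant
1. The condition `α > d - 2` makes `(1+l)^{-1-α/2}` integrable, which gives finite variance of
`u(t,x)` and continuity in `x` of the fields; continuity then turns equality of distributions into
equality of functions. -/

theorem inner_linearCombination_eq {u : Z → H} {e : Z → K}
    (hue : ∀ z z', inner ℝ (u z) (u z') = inner ℝ (e z) (e z')) (a b : Z →₀ ℝ) :
    inner ℝ (Finsupp.linearCombination ℝ u a) (Finsupp.linearCombination ℝ u b) =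
      inner ℝ (Finsupp.linearCombination ℝ e a) (Finsupp.linearCombination ℝ e b) := by
  simp only [Finsupp.linearCombination_apply, Finsupp.sum, sum_inner, inner_sum, inner_smul_left,
    inner_smul_right, hue]

/-- If two families have the same Gram matrix, then the elements of the closed span of the first
family are carried isometrically to elements of the closed span of the second one. -/
theorem exists_inner_eq_of_gram_eq [CompleteSpace K] {u : Z → H} {e : Z → K}
    (hue : ∀ z z', inner ℝ (u z) (u z') = inner ℝ (e z) (e z')) {Y : H}
    (hY : Y ∈ (Submodule.span ℝ (range u)).topologicalClosure) :
    ∃ y ∈ (Submodule.span ℝ (range e)).topologicalClosure,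
      ‖y‖ = ‖Y‖ ∧ ∀ z, inner ℝ (u z) Y = inner ℝ (e z) y := by
  rw [← SetLike.mem_coe, Submodule.topologicalClosure_coe, mem_closure_iff_seq_limit] at hY
  obtain ⟨x, hx, hxY⟩ := hY
  have hx' : ∀ n, ∃ c, Finsupp.linearCombination ℝ u c = x n := fun n => by
    simpa [← Finsupp.range_linearCombination] using hx n
  -- Coefficients are not unique. Choosing them along one convergent sequence avoids showing that a
  -- map between the spans is well defined.
  choose c hc using hx'
  set L := Finsupp.linearCombination ℝ e
  have hnorm : ∀ a, ‖L a‖ = ‖Finsupp.linearCombination ℝ u a‖ := fun a => by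
    rw [@norm_eq_sqrt_real_inner _ _ _ (L a), @norm_eq_sqrt_real_inner _ _ _
      (Finsupp.linearCombination ℝ u a), inner_linearCombination_eq hue]
  have hcau : CauchySeq fun n => L (c n) := by
    have h := hxY.cauchySeq
    rw [Metric.cauchySeq_iff] at h ⊢
    intro ε hε
    obtain ⟨N, hN⟩ := h ε hε
    refine ⟨N, fun m hm n hn => ?_⟩
    have := hN m hm n hn
    rwa [dist_eq_norm, ← hc, ← hc, ← map_sub, ← hnorm, map_sub, ← dist_eq_norm] at this
  obtain ⟨y, hy⟩ := cauchySeq_tendsto_of_complete hcau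
  refine ⟨y, ?_, ?_, fun z => ?_⟩
  · rw [← SetLike.mem_coe, Submodule.topologicalClosure_coe]
    refine mem_closure_of_tendsto hy (Eventually.of_forall fun n => ?_)
    rw [SetLike.mem_coe, ← Finsupp.range_linearCombination]
    exact ⟨c n, rfl⟩
  · refine tendsto_nhds_unique hy.norm ?_
    simpa only [hnorm, hc] using hxY.norm
  · have h1 : Tendsto (fun n => inner ℝ (u z) (x n)) atTop (𝓝 (inner ℝ (u z) Y)) :=
      tendsto_const_nhds.inner hxY
    have h2 : Tendsto (fun n => inner ℝ (e z) (L (c n))) atTop (𝓝 (inner ℝ (e z) y)) :=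
      tendsto_const_nhds.inner hy
    refine tendsto_nhds_unique h1 (h2.congr fun n => ?_)
    have := inner_linearCombination_eq hue (Finsupp.single z 1) (c n)
    simpa [hc] using this.symm

end Gram

/-! ### Integration over the time interval -/

section TimeIntegral

variable {T : ℝ}

/-- Passes from the subtype `Time T` to the open interval used in `covForm`; the endpoints are null.
-/
theorem integral_time {E : Type*} [NormedAddCommGroup E] [NormedSpace ℝ E] (f : ℝ → E) :
    ∫ t : Time T, f t = ∫ t in Ioo 0 T, f t := by
  rw [restrict_Ioo_eq_restrict_Icc]
  exact integral_subtype_comap measurableSet_Icc f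

theorem lintegral_time (f : ℝ → ℝ≥0∞) :
    ∫⁻ t : Time T, f t = ∫⁻ t in Ioo 0 T, f t := by
  rw [restrict_Ioo_eq_restrict_Icc]
  exact lintegral_subtype_comap measurableSet_Icc f

instance isFiniteMeasure_time : IsFiniteMeasure (volume : Measure (Time T)) := by
  refine ⟨?_⟩
  have := lintegral_time (T := T) (fun _ => 1)
  simp only [lintegral_one] at this
  rw [this]
  simp

/-- Here the starting time varies and `t` is fixed; in `integral_exp_growth` the final time varies
and `r` is fixed. Keeping the factor `l` on the left avoids a division, so `l = 0` is included. -/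
theorem integral_exp_decay {r t l : ℝ} :
    ∫ s in r..t, l * Real.exp (-(l * (t - s))) = 1 - Real.exp (-(l * (t - r))) := by
  have hd : ∀ s ∈ uIcc r t, HasDerivAt (fun s => Real.exp (-(l * (t - s))))
      (l * Real.exp (-(l * (t - s)))) s := by
    intro s _
    have : HasDerivAt (fun s => -(l * (t - s))) l s :=
      ((((hasDerivAt_id' s).const_sub t).const_mul l).fun_neg).congr_deriv (by ring)
    simpa [mul_comm] using this.exp
  rw [intervalIntegral.integral_eq_sub_of_hasDerivAt hd
    (Continuous.intervalIntegrable (by fun_prop) _ _)]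
  simp

theorem integral_exp_growth {r t l : ℝ} :
    ∫ s in r..t, l * Real.exp (-(l * (s - r))) = 1 - Real.exp (-(l * (t - r))) := by
  have hd : ∀ s ∈ uIcc r t, HasDerivAt (fun s => -Real.exp (-(l * (s - r))))
      (l * Real.exp (-(l * (s - r)))) s := by
    intro s _
    have : HasDerivAt (fun s => -(l * (s - r))) (-l) s :=
      ((((hasDerivAt_id' s).sub_const r).const_mul l).fun_neg).congr_deriv (by ring)
    simpa [mul_comm] using this.exp.fun_neg
  rw [intervalIntegral.integral_eq_sub_of_hasDerivAt hd
    (Continuous.intervalIntegrable (by fun_prop) _ _)]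
  simp; ring

theorem integral_time_Icc {E : Type*} [NormedAddCommGroup E] [NormedSpace ℝ E] (f : ℝ → E)
    {r t : Time T} (h : r ≤ t) :
    ∫ s in Icc r t, f s = ∫ s in (r : ℝ)..t, f s := by
  rw [← integral_indicator measurableSet_Icc]
  have : (fun s : Time T => (Icc r t).indicator (fun s => f s) s) =
      fun s : Time T => (Icc (r : ℝ) t).indicator f s := by
    ext s
    simp [indicator, Subtype.coe_le_coe]
  rw [this, integral_time, intervalIntegral.integral_of_le h, ← integral_Icc_eq_integral_Ioc,
    restrict_Ioo_eq_restrict_Icc, setIntegral_indicator measurableSet_Icc]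
  congr 2
  rw [inter_eq_right]
  exact Icc_subset_Icc r.2.1 t.2.2

/-- Fubini's theorem on the triangle `r ≤ s ≤ t`. -/
theorem integral_triangle {c : Time T → Time T → ℂ} (hc : Measurable (Function.uncurry c))
    {M : ℝ} {t : Time T} (hM : ∀ r s, r ≤ s → s ≤ t → ‖c s r‖ ≤ M) {q : Time T → ℂ}
    (hq : Integrable q) :
    ∫ s in Iic t, ∫ r in Iic s, c s r * q r =
      ∫ r in Iic t, (∫ s in Icc r t, c s r) * q r := by
  set S : Set (Time T × Time T) := {p | p.2 ≤ p.1 ∧ p.1 ≤ t}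
  have hS : MeasurableSet S :=
    (measurableSet_le (f := fun p : Time T × Time T => p.2) (g := fun p => p.1) measurable_snd
      measurable_fst).inter (measurableSet_le (f := fun p : Time T × Time T => p.1)
      (g := fun _ => t) measurable_fst measurable_const)
  set F : Time T × Time T → ℂ := S.indicator fun p => c p.1 p.2 * q p.2
  have hF : Integrable F := by
    have h2 : Integrable (fun p : Time T × Time T => q p.2) := by
      rw [Measure.volume_eq_prod]; exact hq.comp_snd _
    -- The kernel is controlled by `M` only on the triangle, so the indicator is attached to it
    -- before it is bounded.
    have h3 : F = fun p => (S.indicator (fun p => c p.1 p.2) p) * q p.2 := by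
      ext p; by_cases hp : p ∈ S <;> simp [F, hp]
    rw [h3]
    refine h2.bdd_mul (c := max M 0) (hc.indicator hS).aestronglyMeasurable ?_
    refine Eventually.of_forall fun p => ?_
    by_cases hp : p ∈ S
    · rw [indicator_of_mem hp]; exact (hM _ _ hp.1 hp.2).trans (le_max_left _ _)
    · rw [indicator_of_notMem hp]; simp
  have h := integral_integral_swap (f := fun s r => F (s, r)) (μ := volume) (ν := volume) hF
  have e1 : ∀ s : Time T, ∫ r, F (s, r) =
      (Iic t).indicator (fun s => ∫ r in Iic s, c s r * q r) s := by
    intro s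
    by_cases hs : s ≤ t
    · rw [indicator_of_mem (by exact hs), ← integral_indicator measurableSet_Iic]
      congr 1; ext r; simp [F, S, indicator, hs]
    · rw [indicator_of_notMem (by exact hs)]
      simp [F, S, hs]
  have e2 : ∀ r : Time T, ∫ s, F (s, r) =
      (Iic t).indicator (fun r => (∫ s in Icc r t, c s r) * q r) r := by
    intro r
    by_cases hr : r ≤ t
    · rw [indicator_of_mem (by exact hr), ← integral_indicator measurableSet_Icc,
        ← integral_mul_const]
      congr 1; ext s; simp [F, S, indicator]
    · rw [indicator_of_notMem (by exact hr)]
      have : ∀ s, F (s, r) = 0 := fun s => by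
        have : ¬ (r ≤ s ∧ s ≤ t) := fun h => hr (h.1.trans h.2)
        simp [F, S, this]
      simp [this]
  simp only [e1, e2] at h
  rwa [integral_indicator measurableSet_Iic, integral_indicator measurableSet_Iic] at h

/-- The Duhamel integral `∫_0^t e^{-l(t-s)} k(s) ds`. -/
def duhamelIntegral (l : ℝ) (k : Time T → ℂ) (t : Time T) : ℂ :=
  ∫ s in Iic t, (Real.exp (-(l * ((t : ℝ) - s))) : ℂ) * k s

theorem integrable_exp_mul {l : ℝ} (hl : 0 ≤ l) {k : Time T → ℂ} (hk : Integrable k)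
    (t : Time T) :
    IntegrableOn (fun s : Time T => (Real.exp (-(l * ((t : ℝ) - s))) : ℂ) * k s) (Iic t) := by
  refine hk.integrableOn.bdd_mul (c := 1) (by fun_prop) ?_
  filter_upwards [ae_restrict_mem measurableSet_Iic] with s hs
  rw [Complex.norm_real, Real.norm_eq_abs, Real.abs_exp, Real.exp_le_one_iff]
  have : (s : ℝ) ≤ t := hs
  nlinarith

/-- The Duhamel integral solves `A' = -l A + k`. -/
theorem duhamelIntegral_eq {l : ℝ} (hl : 0 ≤ l) {k : Time T → ℂ} (hk : Integrable k)
    (t : Time T) :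
    ∫ s in Iic t, (l : ℂ) * duhamelIntegral l k s =
      (∫ s in Iic t, k s) - duhamelIntegral l k t := by
  -- Fubini: integrating `l e^{-l(s-r)}` over `s ∈ [r,t]` leaves `1 - e^{-l(t-r)}` as the weight of
  -- `k r`.
  have h := integral_triangle (t := t) (M := l) (q := k)
    (c := fun s r => ((l * Real.exp (-(l * ((s : ℝ) - r))) : ℝ) : ℂ))
    (by unfold Function.uncurry; fun_prop) (fun r s hrs _ => by
      have : (r : ℝ) ≤ s := hrs
      rw [Complex.norm_real, Real.norm_eq_abs, abs_mul, abs_of_nonneg hl, Real.abs_exp]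
      refine mul_le_of_le_one_right hl (Real.exp_le_one_iff.2 ?_)
      nlinarith) hk
  have e1 : ∀ s : Time T, (l : ℂ) * duhamelIntegral l k s =
      ∫ r in Iic s, ((l * Real.exp (-(l * ((s : ℝ) - r))) : ℝ) : ℂ) * k r := fun s => by
    rw [duhamelIntegral, ← integral_const_mul]
    congr 1; ext r; push_cast; ring
  simp only [e1]
  rw [h, duhamelIntegral, ← integral_sub hk.integrableOn (integrable_exp_mul hl hk t)]
  refine setIntegral_congr_fun measurableSet_Iic fun r hr => ?_
  have : ∫ s : Time T in Icc r t, ((l * Real.exp (-(l * ((s : ℝ) - r))) : ℝ) : ℂ) =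
      ((1 - Real.exp (-(l * ((t : ℝ) - r))) : ℝ) : ℂ) := by
    rw [integral_complex_ofReal, integral_time_Icc (fun s => l * Real.exp (-(l * (s - r)))) hr,
      integral_exp_growth]
  simp only [this]
  push_cast; ring

/-- If `q = -l A + k` almost everywhere with `A(t) = ∫_0^t q`, then `A` is the Duhamel integral. -/
theorem eq_duhamelIntegral {l : ℝ} (hl : 0 ≤ l) {q k : Time T → ℂ} (hq : Integrable q)
    (hk : Integrable k)
    (h : ∀ᵐ s, q s = -(l * ∫ r in Iic s, q r) + k s) (t : Time T) :
    ∫ r in Iic t, q r = duhamelIntegral l k t := by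
  -- The equation is multiplied by the integrating factor `e^{-l(t-s)}` and integrated over `s ≤ t`.
  -- Fubini turns the double integral into `∫ q` minus the Duhamel integral of `q`, and the latter
  -- cancels.
  have h1 := integral_triangle (t := t) (M := l) (q := q)
    (c := fun s r => ((l * Real.exp (-(l * ((t : ℝ) - s))) : ℝ) : ℂ))
    (by unfold Function.uncurry; fun_prop) (fun r s _ hst => by
      have : (s : ℝ) ≤ t := hst
      rw [Complex.norm_real, Real.norm_eq_abs, abs_mul, abs_of_nonneg hl, Real.abs_exp]
      refine mul_le_of_le_one_right hl (Real.exp_le_one_iff.2 ?_)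
      nlinarith) hq
  have h2 : ∫ r in Iic t,
      (∫ s : Time T in Icc r t, ((l * Real.exp (-(l * ((t : ℝ) - s))) : ℝ) : ℂ)) * q r
      = (∫ r in Iic t, q r) - duhamelIntegral l q t := by
    rw [duhamelIntegral, ← integral_sub hq.integrableOn (integrable_exp_mul hl hq t)]
    refine setIntegral_congr_fun measurableSet_Iic fun r hr => ?_
    have : ∫ s : Time T in Icc r t, ((l * Real.exp (-(l * ((t : ℝ) - s))) : ℝ) : ℂ) =
        ((1 - Real.exp (-(l * ((t : ℝ) - r))) : ℝ) : ℂ) := by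
      rw [integral_complex_ofReal, integral_time_Icc (fun s => l * Real.exp (-(l * (t - s)))) hr,
        integral_exp_decay]
    simp only [this]
    push_cast; ring
  have h3 : duhamelIntegral l k t - duhamelIntegral l q t =
      ∫ s in Iic t, ∫ r in Iic s, ((l * Real.exp (-(l * ((t : ℝ) - s))) : ℝ) : ℂ) * q r := by
    rw [duhamelIntegral, duhamelIntegral,
      ← integral_sub (integrable_exp_mul hl hk t) (integrable_exp_mul hl hq t)]
    refine integral_congr_ae (ae_restrict_of_ae ?_)
    filter_upwards [h] with s hs
    rw [integral_const_mul]
    push_cast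
    linear_combination -(Complex.exp (-(l * ((t : ℂ) - s)))) * hs
  rw [h1, h2] at h3
  linear_combination -h3

end TimeIntegral

/-! ### Distributions whose Fourier transform is a function -/

section FourierFun

variable {d : ℕ}

/-- The function `k` is integrable against all Schwartz functions. -/
def SchwartzIntegrable (k : Space d → ℂ) : Prop :=
  ∀ ψ : 𝓢(Space d, ℂ), Integrable fun ξ => k ξ * ψ ξ

theorem SchwartzIntegrable.of_memLp {k : Space d → ℂ} (hk : MemLp k 2) :
    SchwartzIntegrable k := fun ψ => hk.integrable_mul (ψ.memLp 2)

theorem SchwartzIntegrable.sub {k l : Space d → ℂ} (hk : SchwartzIntegrable k)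
    (hl : SchwartzIntegrable l) : SchwartzIntegrable fun ξ => k ξ - l ξ := fun ψ => by
  simp only [sub_mul]
  exact (hk ψ).sub (hl ψ)

theorem SchwartzIntegrable.mul {k g : Space d → ℂ} (hk : SchwartzIntegrable k)
    (hg : g.HasTemperateGrowth) : SchwartzIntegrable fun ξ => g ξ * k ξ := fun ψ => by
  refine (hk (SchwartzMap.smulLeftCLM ℂ g ψ)).congr (Eventually.of_forall fun ξ => ?_)
  simp only [SchwartzMap.smulLeftCLM_apply_apply hg, smul_eq_mul]
  ring

/-- A bump function equal to 1 near the point is itself a Schwartz function. -/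
theorem SchwartzIntegrable.locallyIntegrable {k : Space d → ℂ} (hk : SchwartzIntegrable k) :
    LocallyIntegrable k := by
  intro x
  let f : ContDiffBump x := ⟨1, 2, one_pos, one_lt_two⟩
  have hc : HasCompactSupport (Complex.ofRealCLM ∘ f) := f.hasCompactSupport.comp_left rfl
  have hd : ContDiff ℝ (⊤ : ℕ∞) (Complex.ofRealCLM ∘ f) :=
    Complex.ofRealCLM.contDiff.comp f.contDiff
  refine ⟨Metric.ball x 1, Metric.ball_mem_nhds x one_pos, ?_⟩
  refine (hk (hc.toSchwartzMap hd)).integrableOn.congr_fun (fun ξ hξ => ?_) measurableSet_ball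
  have : f ξ = 1 := f.one_of_mem_closedBall (Metric.ball_subset_closedBall hξ)
  simp [this]

theorem SchwartzIntegrable.ae_eq_zero {k : Space d → ℂ} (hk : SchwartzIntegrable k)
    (h : ∀ ψ : 𝓢(Space d, ℂ), ∫ ξ, k ξ * ψ ξ = 0) : k =ᵐ[volume] 0 := by
  refine ae_eq_zero_of_integral_contDiff_smul_eq_zero hk.locallyIntegrable fun g hg hgc => ?_
  have hc : HasCompactSupport (Complex.ofRealCLM ∘ g) := hgc.comp_left rfl
  have hd : ContDiff ℝ (⊤ : ℕ∞) (Complex.ofRealCLM ∘ g) := Complex.ofRealCLM.contDiff.comp hg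
  simpa [mul_comm] using h (hc.toSchwartzMap hd)

theorem HasFourierFun.apply_eq {φ : 𝓢'(Space d, ℂ)} {k : Space d → ℂ} (h : HasFourierFun φ k)
    (ψ : 𝓢(Space d, ℂ)) : φ ψ = ∫ ξ, k ξ * 𝓕⁻ ψ ξ := by
  rw [← h (𝓕⁻ ψ), TemperedDistribution.fourier_apply, FourierTransform.fourier_fourierInv_eq]

theorem HasFourierFun.congr {φ : 𝓢'(Space d, ℂ)} {k l : Space d → ℂ} (h : HasFourierFun φ k)
    (hkl : k =ᵐ[volume] l) : HasFourierFun φ l := fun ψ => by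
  rw [h ψ]
  exact integral_congr_ae (hkl.mono fun ξ h => by simp only [h])

/-- The integrability hypotheses matter: the Bochner integral of a nonintegrable function is 0, so
`HasFourierFun` alone does not determine the function. -/
theorem HasFourierFun.ae_eq {φ : 𝓢'(Space d, ℂ)} {k l : Space d → ℂ} (hk : HasFourierFun φ k)
    (hl : HasFourierFun φ l) (hki : SchwartzIntegrable k) (hli : SchwartzIntegrable l) :
    k =ᵐ[volume] l := by
  have := (hki.sub hli).ae_eq_zero fun ψ => by
    simp only [sub_mul]
    rw [integral_sub (hki ψ) (hli ψ), ← hk ψ, ← hl ψ, sub_self]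
  exact this.mono fun ξ h => sub_eq_zero.1 h

theorem HasFourierFun.lineDeriv {φ : 𝓢'(Space d, ℂ)} {k : Space d → ℂ} (h : HasFourierFun φ k)
    (m : Space d) :
    HasFourierFun (∂_{m} φ) fun ξ => 2 * Real.pi * Complex.I * (inner ℝ ξ m : ℝ) * k ξ := by
  intro ψ
  have hm : (fun ξ : Space d => (inner ℝ ξ m : ℝ)).HasTemperateGrowth := by fun_prop
  have := TemperedDistribution.fourier_lineDerivOp_eq φ m
  rw [this]
  have h2 : (((2 * Real.pi * Complex.I) • TemperedDistribution.smulLeftCLM ℂ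
      (fun ξ : Space d => ((inner ℝ ξ m : ℝ) : ℂ)) (𝓕 φ)) : 𝓢'(Space d, ℂ)) ψ =
      (2 * Real.pi * Complex.I) • (TemperedDistribution.smulLeftCLM ℂ
      (fun ξ : Space d => ((inner ℝ ξ m : ℝ) : ℂ)) (𝓕 φ)) ψ := rfl
  rw [h2, TemperedDistribution.smulLeftCLM_apply_apply, h, smul_eq_mul, ← integral_const_mul]
  congr 1; ext ξ
  rw [SchwartzMap.smulLeftCLM_apply_apply (by fun_prop), smul_eq_mul]
  ring

/-- The Fourier symbol of `∂ᵢ∂ⱼ`. -/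
def hessianSymbol (i j : Fin d) (ξ : Space d) : ℂ := -(2 * Real.pi) ^ 2 * ξ i * ξ j

theorem hessianSymbol_hasTemperateGrowth (i j : Fin d) :
    (hessianSymbol (d := d) i j).HasTemperateGrowth := by
  have h : ∀ i : Fin d, (fun ξ : Space d => ((ξ i : ℝ) : ℂ)).HasTemperateGrowth := fun i =>
    (Complex.ofRealCLM ∘L EuclideanSpace.proj (𝕜 := ℝ) i).hasTemperateGrowth
  unfold hessianSymbol
  exact ((Function.HasTemperateGrowth.const _).mul (h i)).mul (h j)

theorem HasFourierFun.secondDeriv {φ : 𝓢'(Space d, ℂ)} {k : Space d → ℂ}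
    (h : HasFourierFun φ k) (i j : Fin d) :
    HasFourierFun (∂_{EuclideanSpace.basisFun (Fin d) ℝ i}
      (∂_{EuclideanSpace.basisFun (Fin d) ℝ j} φ)) fun ξ => hessianSymbol i j ξ * k ξ := by
  convert (h.lineDeriv (EuclideanSpace.basisFun (Fin d) ℝ j)).lineDeriv
    (EuclideanSpace.basisFun (Fin d) ℝ i) using 2 with ξ
  simp only [hessianSymbol, EuclideanSpace.basisFun_apply, EuclideanSpace.inner_single_right]
  simp
  ring_nf
  simp

/-- The inverse Fourier transform of an `L²` function, as a tempered distribution. -/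
def ofFourier (b : Space d → ℂ) : 𝓢'(Space d, ℂ) :=
  open Classical in
  if h : MemLp b 2 then 𝓕⁻ (Lp.toTemperedDistribution (h.toLp b)) else 0

theorem hasFourierFun_ofFourier {b : Space d → ℂ} (h : MemLp b 2) :
    HasFourierFun (ofFourier b) b := by
  intro ψ
  rw [ofFourier, dif_pos h, FourierTransform.fourier_fourierInv_eq,
    Lp.toTemperedDistribution_apply]
  refine integral_congr_ae (h.coeFn_toLp.mono fun ξ hξ => ?_)
  simp only [hξ, smul_eq_mul, mul_comm]

theorem memSobolev_ofFourier (b : Space d → ℂ) :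
    TemperedDistribution.MemSobolev 0 2 (ofFourier b) := by
  rw [ofFourier]
  split_ifs with h
  · exact TemperedDistribution.memSobolev_zero_iff_exists_fourier.2
      ⟨h.toLp b, FourierTransform.fourier_fourierInv_eq _⟩
  · exact TemperedDistribution.memSobolev_fun_zero _ _ 0 2

/-- The Fourier transform is an `L²` function times the inverse Sobolev weight, and this weight has
temperate growth. -/
theorem exists_hasFourierFun_of_memSobolev {β : ℝ} {φ : 𝓢'(Space d, ℂ)}
    (h : TemperedDistribution.MemSobolev β 2 φ) :
    ∃ k, SchwartzIntegrable k ∧ HasFourierFun φ k := by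
  obtain ⟨f, hf⟩ := TemperedDistribution.memSobolev_iff_exists_smulLeftCLM_fourier.1 h
  have hg : ∀ s : ℝ, (fun x : Space d => (((1 + ‖x‖ ^ 2) ^ (s / 2) : ℝ) : ℂ)).HasTemperateGrowth :=
    fun s => by fun_prop
  refine ⟨fun ξ => (((1 + ‖ξ‖ ^ 2) ^ (-β / 2) : ℝ) : ℂ) * f ξ,
    (SchwartzIntegrable.of_memLp (Lp.memLp f)).mul (hg _), fun ψ => ?_⟩
  have h1 : ψ = SchwartzMap.smulLeftCLM ℂ (fun x : Space d => (((1 + ‖x‖ ^ 2) ^ (β / 2) : ℝ) : ℂ))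
      (SchwartzMap.smulLeftCLM ℂ (fun x : Space d => (((1 + ‖x‖ ^ 2) ^ (-β / 2) : ℝ) : ℂ)) ψ) := by
    ext x
    rw [SchwartzMap.smulLeftCLM_apply_apply (hg _), SchwartzMap.smulLeftCLM_apply_apply (hg _),
      smul_smul, ← Complex.ofReal_mul, ← Real.rpow_add (by positivity)]
    simp [neg_div]
  rw [h1, ← TemperedDistribution.smulLeftCLM_apply_apply, hf, Lp.toTemperedDistribution_apply,
    ← h1]
  congr 1; ext ξ
  rw [SchwartzMap.smulLeftCLM_apply_apply (hg _)]
  simp only [smul_eq_mul]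
  ring

/-- The inverse Fourier transform is self-adjoint. -/
theorem integral_mul_fourierInv {f g : Space d → ℂ} (hf : Integrable f) (hg : Integrable g) :
    ∫ ξ, f ξ * 𝓕⁻ g ξ = ∫ x, 𝓕⁻ f x * g x := by
  have h := VectorFourier.integral_fourierIntegral_smul_eq_flip (L := -innerₗ (Space d))
    (μ := volume) (ν := volume) Real.continuous_fourierChar
    (by simp only [LinearMap.neg_apply, innerₗ_apply_apply]; fun_prop) hf hg
  have e1 : ∀ g : Space d → ℂ, VectorFourier.fourierIntegral Real.fourierChar volume
      (-innerₗ (Space d)) g = 𝓕⁻ g := fun g => rfl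
  have e2 : (-innerₗ (Space d)).flip = -innerₗ (Space d) := by
    ext x y; simp [real_inner_comm]
  rw [e2, e1, e1] at h
  simpa only [smul_eq_mul] using h.symm

theorem fourierInv_continuous {f : Space d → ℂ} (hf : Integrable f) : Continuous (𝓕⁻ f) :=
  VectorFourier.fourierIntegral_continuous Real.continuous_fourierChar
    (L := -innerₗ (Space d)) (by simp only [LinearMap.neg_apply, innerₗ_apply_apply]; fun_prop) hf

/-- An integrable function with vanishing inverse Fourier transform vanishes. -/
theorem ae_eq_zero_of_fourierInv_eq_zero {f : Space d → ℂ} (hf : Integrable f)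
    (h : ∀ x, 𝓕⁻ f x = 0) : f =ᵐ[volume] 0 := by
  have hfi : SchwartzIntegrable f := fun ψ =>
    hf.mul_bdd (c := ‖ψ.toBoundedContinuousFunction‖) ψ.continuous.aestronglyMeasurable
      (Eventually.of_forall fun x => ψ.toBoundedContinuousFunction.norm_coe_le_norm x)
  refine hfi.ae_eq_zero fun ψ => ?_
  have h1 : (ψ : Space d → ℂ) = 𝓕⁻ ((𝓕 ψ : 𝓢(Space d, ℂ)) : Space d → ℂ) := by
    rw [← SchwartzMap.fourierInv_coe, FourierTransform.fourierInv_fourier_eq]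
  rw [h1, integral_mul_fourierInv hf (SchwartzMap.integrable _)]
  simp [h]

/-- A function that pairs to zero with the inverse Fourier transforms of all test functions
vanishes. -/
theorem SchwartzIntegrable.ae_eq_zero_of_compact {b : Space d → ℂ} (hb : SchwartzIntegrable b)
    (h : ∀ ψ : 𝓢(Space d, ℂ), HasCompactSupport ψ → ∫ ξ, b ξ * 𝓕⁻ ψ ξ = 0) :
    b =ᵐ[volume] 0 := by
  -- The functions `𝓕⁻ ψ` with `ψ` of compact support are not arbitrary Schwartz functions. But
  -- translating `ψ` by `c` multiplies `𝓕⁻ ψ` by a character, so the hypothesis says that the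
  -- inverse Fourier transform of `b · 𝓕⁻ ψ` vanishes at every `c`.
  have h1 : ∀ ψ : 𝓢(Space d, ℂ), HasCompactSupport ψ → (fun ξ => b ξ * 𝓕⁻ ψ ξ) =ᵐ[volume] 0 := by
    intro ψ hψ
    refine ae_eq_zero_of_fourierInv_eq_zero (hb (𝓕⁻ ψ)) fun c => ?_
    have hc : HasCompactSupport (SchwartzMap.compSubConstCLM ℂ c ψ) := by
      have := hψ.comp_homeomorph (Homeomorph.subRight c)
      exact this
    rw [Real.fourierInv_eq', ← h _ hc]
    congr 1; ext ξ
    rw [SchwartzMap.fourierInv_coe, SchwartzMap.fourierInv_coe, Real.fourierInv_eq',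
      Real.fourierInv_eq', smul_eq_mul, ← mul_assoc, mul_comm _ (b ξ), mul_assoc]
    congr 1
    rw [← integral_sub_right_eq_self _ c, ← integral_const_mul]
    congr 1; ext x
    rw [SchwartzMap.compSubConstCLM_apply, smul_eq_mul, smul_eq_mul, ← mul_assoc, ← Complex.exp_add]
    congr 2
    rw [inner_sub_left, real_inner_comm c ξ]
    push_cast; ring
  -- Near any frequency some `𝓕⁻ ψ` is nonzero: for a bump function modulated by `e^{-2πi x·ξ₀}` its
  -- value at `ξ₀` is the integral of the bump.
  have h2 : ∀ ξ₀ : Space d, ∃ u ∈ 𝓝 ξ₀, ∀ᵐ ξ, ξ ∈ u → b ξ = 0 := by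
    intro ξ₀
    let f : ContDiffBump (0 : Space d) := ⟨1, 2, one_pos, one_lt_two⟩
    have hc : HasCompactSupport fun x =>
        Complex.exp (-((2 * Real.pi * inner ℝ x ξ₀ : ℝ) * Complex.I)) * (f x : ℂ) :=
      (f.hasCompactSupport.comp_left (g := Complex.ofReal) rfl).mul_left
    have hd : ContDiff ℝ (⊤ : ℕ∞) fun x : Space d =>
        Complex.exp (-((2 * Real.pi * inner ℝ x ξ₀ : ℝ) * Complex.I)) * (f x : ℂ) := by
      refine ContDiff.mul ?_ (Complex.ofRealCLM.contDiff.comp f.contDiff)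
      have : ContDiff ℝ (⊤ : ℕ∞) fun x : Space d => ((2 * Real.pi * inner ℝ x ξ₀ : ℝ) : ℂ) :=
        Complex.ofRealCLM.contDiff.comp
          (contDiff_const.mul (contDiff_id.inner ℝ contDiff_const))
      fun_prop
    set ψ := hc.toSchwartzMap hd
    have hψ : 𝓕⁻ ψ ξ₀ ≠ 0 := by
      rw [SchwartzMap.fourierInv_coe, Real.fourierInv_eq']
      have : ∀ x, Complex.exp ((2 * Real.pi * inner ℝ x ξ₀ : ℝ) * Complex.I) • ψ x =
          ((f x : ℝ) : ℂ) := by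
        intro x
        have hx : ψ x = Complex.exp (-((2 * Real.pi * inner ℝ x ξ₀ : ℝ) * Complex.I)) * (f x : ℂ) :=
          rfl
        rw [hx, smul_eq_mul, ← mul_assoc, ← Complex.exp_add]
        simp
      simp only [this]
      rw [integral_complex_ofReal]
      exact_mod_cast (f.integral_pos (μ := volume)).ne'
    have hψc : HasCompactSupport ψ := hc
    refine ⟨{ξ | 𝓕⁻ ψ ξ ≠ 0}, (isOpen_ne_fun (𝓕⁻ ψ).continuous continuous_const).mem_nhds hψ, ?_⟩
    filter_upwards [h1 ψ hψc] with ξ hξ hne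
    exact (mul_eq_zero.1 hξ).resolve_right hne
  choose u hu hub using h2
  -- The Lindelöf property leaves countably many neighbourhoods, so the exceptional null sets can be
  -- united.
  obtain ⟨s, hs, hsu⟩ := TopologicalSpace.countable_cover_nhds hu
  have h3 : ∀ᵐ ξ, ∀ x ∈ s, ξ ∈ u x → b ξ = 0 := (ae_ball_iff hs).2 fun x _ => hub x
  filter_upwards [h3] with ξ hξ
  obtain ⟨x, hx, hxu⟩ := mem_iUnion₂.1 (hsu ▸ mem_univ ξ : ξ ∈ ⋃ x ∈ s, u x)
  exact hξ x hx hxu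

end FourierFun

/-! ### Duhamel's formula on the Fourier side -/

section Duhamel

variable {d : ℕ} {T : ℝ}

/-- The symbol of `-Δ`. -/
def laplaceSymbol (ξ : Space d) : ℝ := (2 * Real.pi * ‖ξ‖) ^ 2

theorem laplaceSymbol_nonneg (ξ : Space d) : 0 ≤ laplaceSymbol ξ := sq_nonneg _

@[fun_prop]
theorem continuous_laplaceSymbol : Continuous (laplaceSymbol (d := d)) := by
  unfold laplaceSymbol; fun_prop

@[fun_prop]
theorem measurable_laplaceSymbol : Measurable (laplaceSymbol (d := d)) :=
  continuous_laplaceSymbol.measurable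

/-- The square of the norm of `L₂((0,T), H₂^γ)` on the Fourier side. -/
def fourierNormSq (γ : ℝ) (k : Time T × Space d → ℂ) : ℝ≥0∞ :=
  ∫⁻ t : Time T, ∫⁻ ξ : Space d, ‖k (t, ξ)‖ₑ ^ 2 * ENNReal.ofReal ((1 + laplaceSymbol ξ) ^ γ)

theorem measurable_fourierNormSq_integrand (γ : ℝ) {k : Time T × Space d → ℂ}
    (hk : Measurable k) : Measurable fun z : Time T × Space d =>
      ‖k z‖ₑ ^ 2 * ENNReal.ofReal ((1 + laplaceSymbol z.2) ^ γ) := by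
  fun_prop

theorem fourierNormSq_eq_prod (γ : ℝ) {k : Time T × Space d → ℂ} (hk : Measurable k) :
    fourierNormSq γ k = ∫⁻ z : Time T × Space d,
      ‖k z‖ₑ ^ 2 * ENNReal.ofReal ((1 + laplaceSymbol z.2) ^ γ) := by
  rw [Measure.volume_eq_prod,
    lintegral_prod _ (measurable_fourierNormSq_integrand γ hk).aemeasurable]
  rfl

theorem one_le_weight {γ : ℝ} (hγ : 0 ≤ γ) (ξ : Space d) :
    1 ≤ ENNReal.ofReal ((1 + laplaceSymbol ξ) ^ γ) := by
  rw [← ENNReal.ofReal_one]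
  exact ENNReal.ofReal_le_ofReal (Real.one_le_rpow (by linarith [laplaceSymbol_nonneg ξ]) hγ)

theorem lintegral_sq_le_fourierNormSq {γ : ℝ} (hγ : 0 ≤ γ) {k : Time T × Space d → ℂ}
    (hk : Measurable k) : ∫⁻ z, ‖k z‖ₑ ^ 2 ≤ fourierNormSq γ k := by
  rw [fourierNormSq_eq_prod γ hk]
  exact lintegral_mono fun z => le_mul_of_one_le_right' (one_le_weight hγ z.2)

theorem memLp_two_of_lintegral_sq {X : Type*} [MeasurableSpace X] {μ : Measure X} {k : X → ℂ}
    (hk : AEStronglyMeasurable k μ) (h : ∫⁻ z, ‖k z‖ₑ ^ 2 ∂μ < ∞) : MemLp k 2 μ := by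
  refine ⟨hk, ?_⟩
  rw [eLpNorm_lt_top_iff_lintegral_rpow_enorm_lt_top two_ne_zero ENNReal.ofNat_ne_top]
  simpa using h

theorem lintegral_sq_lt_top_of_memLp {X : Type*} [MeasurableSpace X] {μ : Measure X} {k : X → ℂ}
    (h : MemLp k 2 μ) : ∫⁻ z, ‖k z‖ₑ ^ 2 ∂μ < ∞ := by
  have := (eLpNorm_lt_top_iff_lintegral_rpow_enorm_lt_top two_ne_zero ENNReal.ofNat_ne_top).1 h.2
  simpa using this

theorem memLp_of_fourierNormSq {γ : ℝ} (hγ : 0 ≤ γ) {k : Time T × Space d → ℂ}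
    (hk : Measurable k) (h : fourierNormSq γ k < ∞) : MemLp k 2 :=
  memLp_two_of_lintegral_sq hk.aestronglyMeasurable
    ((lintegral_sq_le_fourierNormSq hγ hk).trans_lt h)

theorem ae_memLp_space {k : Time T × Space d → ℂ} (hm : Measurable k) (hk : MemLp k 2) :
    ∀ᵐ t, MemLp (fun ξ => k (t, ξ)) 2 := by
  have h := lintegral_sq_lt_top_of_memLp hk
  rw [Measure.volume_eq_prod, lintegral_prod _ (by fun_prop)] at h
  have h2 := ae_lt_top (Measurable.lintegral_prod_right (by fun_prop)) h.ne
  filter_upwards [h2] with t ht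
  exact memLp_two_of_lintegral_sq (Measurable.aestronglyMeasurable (by fun_prop)) ht

theorem ae_memLp_time {k : Time T × Space d → ℂ} (hm : Measurable k) (hk : MemLp k 2) :
    ∀ᵐ ξ, MemLp (fun t => k (t, ξ)) 2 := by
  have h := lintegral_sq_lt_top_of_memLp hk
  rw [Measure.volume_eq_prod, lintegral_prod_symm _ (by fun_prop)] at h
  have h2 := ae_lt_top (Measurable.lintegral_prod_left (by fun_prop)) h.ne
  filter_upwards [h2] with t ht
  exact memLp_two_of_lintegral_sq (Measurable.aestronglyMeasurable (by fun_prop)) ht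

theorem ae_integrable_time {k : Time T × Space d → ℂ} (hm : Measurable k) (hk : MemLp k 2) :
    ∀ᵐ ξ, Integrable fun t => k (t, ξ) :=
  (ae_memLp_time hm hk).mono fun _ h => h.integrable one_le_two

theorem lintegral_mul_sq_le {X : Type*} [MeasurableSpace X] {μ : Measure X} {f g : X → ℝ≥0∞}
    (hf : AEMeasurable f μ) (hg : AEMeasurable g μ) :
    (∫⁻ x, f x * g x ∂μ) ^ 2 ≤ (∫⁻ x, f x ^ 2 ∂μ) * ∫⁻ x, g x ^ 2 ∂μ := by
  have h := ENNReal.lintegral_mul_le_Lp_mul_Lq μ (Real.HolderConjugate.two_two) hf hg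
  calc (∫⁻ x, f x * g x ∂μ) ^ 2 ≤ _ := pow_le_pow_left' h 2
    _ = _ := by
      rw [mul_pow, ← ENNReal.rpow_natCast, ← ENNReal.rpow_natCast, ← ENNReal.rpow_mul,
        ← ENNReal.rpow_mul]
      simp

/-- The Fourier transform of the solution with source `k` on the Fourier side. -/
def duhamel (k : Time T × Space d → ℂ) (z : Time T × Space d) : ℂ :=
  duhamelIntegral (laplaceSymbol z.2) (fun s => k (s, z.2)) z.1

theorem measurable_primitive {q : Time T × Space d → ℂ} (hq : Measurable q) :
    Measurable fun z : Time T × Space d => ∫ r in Iic z.1, q (r, z.2) := by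
  have : (fun z : Time T × Space d => ∫ r in Iic z.1, q (r, z.2)) = fun z => ∫ r : Time T,
      ({p : (Time T × Space d) × Time T | p.2 ≤ p.1.1}.indicator
        (fun p => q (p.2, p.1.2))) (z, r) := by
    ext z
    rw [← integral_indicator measurableSet_Iic]
    rfl
  rw [this]
  refine (StronglyMeasurable.integral_prod_right
    (Measurable.stronglyMeasurable ?_)).measurable
  refine Measurable.indicator (by fun_prop) ?_
  exact measurableSet_le (f := fun p : (Time T × Space d) × Time T => p.2)
    (g := fun p => p.1.1) measurable_snd (by fun_prop)

/-- Factoring `e^{-l(t-s)} = e^{-lt} e^{ls}` frees the integrand from `t` and leaves a primitive. -/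
theorem measurable_duhamel {k : Time T × Space d → ℂ} (hk : Measurable k) :
    Measurable (duhamel k) := by
  have : duhamel k = fun z : Time T × Space d =>
      (Real.exp (-(laplaceSymbol z.2 * z.1)) : ℂ) * ∫ r in Iic z.1,
        (Real.exp (laplaceSymbol z.2 * r) : ℂ) * k (r, z.2) := by
    ext z
    rw [← integral_const_mul]
    unfold duhamel duhamelIntegral
    congr 1; ext r
    rw [← mul_assoc, ← Complex.ofReal_mul, ← Real.exp_add]
    congr 4; ring
  rw [this]
  refine Measurable.mul (by fun_prop) ?_
  exact measurable_primitive (q := fun z => (Real.exp (laplaceSymbol z.2 * z.1) : ℂ) * k z)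
    (by fun_prop)

theorem lintegral_Iic_exp_le {l : ℝ} (hl : 0 ≤ l) (t : Time T) {M : ℝ}
    (hM : ∫ s in (0 : ℝ)..t, Real.exp (-(l * (t - s))) ≤ M) :
    ∫⁻ s in Iic t, ENNReal.ofReal (Real.exp (-(l * ((t : ℝ) - s)))) ≤ ENNReal.ofReal M := by
  have h0 : (0 : ℝ) ≤ T := t.2.1.trans t.2.2
  have hI : Iic t = Icc (⟨0, le_rfl, h0⟩ : Time T) t := by
    ext s; simp only [mem_Iic, mem_Icc, iff_and_self]; exact fun _ => s.2.1
  rw [← ofReal_integral_eq_lintegral_ofReal]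
  · refine ENNReal.ofReal_le_ofReal (le_trans (le_of_eq ?_) hM)
    rw [hI]
    exact integral_time_Icc (fun s => Real.exp (-(l * (t - s)))) t.2.1
  · refine Integrable.of_bound (C := 1) (by fun_prop) ?_
    filter_upwards [ae_restrict_mem measurableSet_Iic] with s hs
    rw [Real.norm_eq_abs, Real.abs_exp, Real.exp_le_one_iff]
    have : (s : ℝ) ≤ t := hs
    nlinarith
  · exact Eventually.of_forall fun s => (Real.exp_pos _).le

/-- The sum of the bounds `l ∫ ≤ 1` and `∫ ≤ T`. The decay `1/(1+l)` is the smoothing that lowers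
the threshold on `α` from `d` to `d - 2`. -/
theorem intervalIntegral_exp_le {l : ℝ} (hl : 0 ≤ l) {t : ℝ} (ht : 0 ≤ t) (htT : t ≤ T) :
    ∫ s in (0 : ℝ)..t, Real.exp (-(l * (t - s))) ≤ (T + 1) / (1 + l) := by
  have h1 : l * ∫ s in (0 : ℝ)..t, Real.exp (-(l * (t - s))) ≤ 1 := by
    rw [← intervalIntegral.integral_const_mul, integral_exp_decay]
    linarith [Real.exp_pos (-(l * (t - 0)))]
  have h2 : ∫ s in (0 : ℝ)..t, Real.exp (-(l * (t - s))) ≤ T := by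
    calc ∫ s in (0 : ℝ)..t, Real.exp (-(l * (t - s))) ≤ ∫ s in (0 : ℝ)..t, 1 := by
          refine intervalIntegral.integral_mono_on ht
            (Continuous.intervalIntegrable (by fun_prop) _ _) (by simp) fun s hs => ?_
          rw [Real.exp_le_one_iff]
          nlinarith [hs.2]
      _ ≤ T := by simpa using htT
  rw [le_div_iff₀ (by linarith)]
  linarith

theorem lintegral_Iic_exp_le_div {l : ℝ} (hl : 0 ≤ l) (t : Time T) :
    ∫⁻ s in Iic t, ENNReal.ofReal (Real.exp (-(l * ((t : ℝ) - s)))) ≤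
      ENNReal.ofReal ((T + 1) / (1 + l)) :=
  lintegral_Iic_exp_le hl t (intervalIntegral_exp_le hl t.2.1 t.2.2)

/-- Together with `mul_lintegral_Ici_exp_le`, these are the two marginal bounds of Schur's test for
the kernel `l e^{-l(t-s)}` on `s ≤ t`. -/
theorem mul_lintegral_Iic_exp_le {l : ℝ} (hl : 0 ≤ l) (t : Time T) :
    ENNReal.ofReal l * ∫⁻ s in Iic t, ENNReal.ofReal (Real.exp (-(l * ((t : ℝ) - s)))) ≤ 1 := by
  rcases hl.eq_or_lt with rfl | hl'
  · simp
  · calc _ ≤ ENNReal.ofReal l * ENNReal.ofReal (1 / l) := by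
          gcongr
          refine lintegral_Iic_exp_le hl t ?_
          rw [le_div_iff₀ hl', mul_comm, ← intervalIntegral.integral_const_mul, integral_exp_decay]
          linarith [Real.exp_pos (-(l * ((t : ℝ) - 0)))]
      _ = 1 := by rw [← ENNReal.ofReal_mul hl]; field_simp; simp

theorem mul_lintegral_Ici_exp_le {l : ℝ} (hl : 0 ≤ l) (s : Time T) :
    ENNReal.ofReal l * ∫⁻ t in Ici s, ENNReal.ofReal (Real.exp (-(l * ((t : ℝ) - s)))) ≤ 1 := by
  have h0 : (0 : ℝ) ≤ T := s.2.1.trans s.2.2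
  have hI : Ici s = Icc s (⟨T, h0, le_rfl⟩ : Time T) := by
    ext s; simp only [mem_Ici, mem_Icc, iff_self_and]; exact fun _ => s.2.2
  rw [← ofReal_integral_eq_lintegral_ofReal]
  · rw [← ENNReal.ofReal_mul hl, ← ENNReal.ofReal_one]
    refine ENNReal.ofReal_le_ofReal ?_
    rw [hI, integral_time_Icc (fun t => Real.exp (-(l * (t - s)))) s.2.2,
      ← intervalIntegral.integral_const_mul, integral_exp_growth]
    linarith [Real.exp_pos (-(l * (T - s)))]
  · refine Integrable.of_bound (C := 1) (by fun_prop) ?_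
    filter_upwards [ae_restrict_mem measurableSet_Ici] with t ht
    rw [Real.norm_eq_abs, Real.abs_exp, Real.exp_le_one_iff]
    have : (s : ℝ) ≤ t := ht
    nlinarith
  · exact Eventually.of_forall fun s => (Real.exp_pos _).le

theorem enorm_duhamelIntegral_le (l : ℝ) (k : Time T → ℂ) (t : Time T) :
    ‖duhamelIntegral l k t‖ₑ ≤
      ∫⁻ s in Iic t, ENNReal.ofReal (Real.exp (-(l * ((t : ℝ) - s)))) * ‖k s‖ₑ := by
  refine (enorm_integral_le_lintegral_enorm _).trans (le_of_eq ?_)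
  congr 1; ext s
  rw [enorm_mul, ← ofReal_norm (Complex.ofReal _), Complex.norm_real, Real.norm_eq_abs,
    Real.abs_exp]

/-- Cauchy–Schwarz with the exponential split into two square roots, one of them kept with `k`. -/
theorem enorm_duhamelIntegral_sq_le (l : ℝ) {k : Time T → ℂ} (hk : Measurable k) (t : Time T) :
    ‖duhamelIntegral l k t‖ₑ ^ 2 ≤
      (∫⁻ s in Iic t, ENNReal.ofReal (Real.exp (-(l * ((t : ℝ) - s))))) *
      ∫⁻ s in Iic t, ENNReal.ofReal (Real.exp (-(l * ((t : ℝ) - s)))) * ‖k s‖ₑ ^ 2 := by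
  have h1 : ∀ s : Time T, ENNReal.ofReal (Real.exp (-(l * ((t : ℝ) - s)))) =
      ENNReal.ofReal (Real.exp (-(l * ((t : ℝ) - s)) / 2)) ^ 2 := fun s => by
    rw [← ENNReal.ofReal_pow (Real.exp_pos _).le, ← Real.exp_nat_mul]
    congr 2; push_cast; ring
  refine (pow_le_pow_left' (enorm_duhamelIntegral_le l k t) 2).trans ?_
  have := lintegral_mul_sq_le (μ := volume.restrict (Iic t))
    (f := fun s : Time T => ENNReal.ofReal (Real.exp (-(l * ((t : ℝ) - s)) / 2)))
    (g := fun s : Time T => ENNReal.ofReal (Real.exp (-(l * ((t : ℝ) - s)) / 2)) * ‖k s‖ₑ)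
    (by fun_prop) (by fun_prop)
  simpa only [h1, mul_pow, ← mul_assoc, ← sq] using this

theorem enorm_duhamelIntegral_sq_le_div {l : ℝ} (hl : 0 ≤ l) {k : Time T → ℂ}
    (hk : Measurable k) (t : Time T) :
    ‖duhamelIntegral l k t‖ₑ ^ 2 ≤ ENNReal.ofReal ((T + 1) / (1 + l)) * ∫⁻ s, ‖k s‖ₑ ^ 2 := by
  refine (enorm_duhamelIntegral_sq_le l hk t).trans ?_
  refine mul_le_mul' (lintegral_Iic_exp_le_div hl t) ?_
  · refine le_trans ?_ (setLIntegral_le_lintegral (Iic t) fun s => ‖k s‖ₑ ^ 2)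
    refine setLIntegral_mono (by fun_prop) fun s hs => ?_
    refine mul_le_of_le_one_left' ?_
    rw [← ENNReal.ofReal_one]
    refine ENNReal.ofReal_le_ofReal (Real.exp_le_one_iff.2 ?_)
    have : (s : ℝ) ≤ t := hs
    nlinarith

/-- Maximal regularity for the scalar equation `A' = -l A + k`. -/
theorem lintegral_mul_duhamelIntegral_sq_le {l : ℝ} (hl : 0 ≤ l) {k : Time T → ℂ}
    (hk : Measurable k) :
    ∫⁻ t, ENNReal.ofReal l ^ 2 * ‖duhamelIntegral l k t‖ₑ ^ 2 ≤ ∫⁻ s, ‖k s‖ₑ ^ 2 := by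
  -- Schur's test: Cauchy–Schwarz at fixed `t` uses up one factor `l` with the mass over `s ≤ t`,
  -- and after Tonelli the factor `l` kept in `F` meets the mass over `t ≥ s`.
  set F : Time T × Time T → ℝ≥0∞ := {p | p.2 ≤ p.1}.indicator fun p =>
    ENNReal.ofReal l * (ENNReal.ofReal (Real.exp (-(l * ((p.1 : ℝ) - p.2)))) * ‖k p.2‖ₑ ^ 2)
  have hF : Measurable F := by
    refine Measurable.indicator (by fun_prop) ?_
    exact measurableSet_le (f := fun p : Time T × Time T => p.2) (g := fun p => p.1)
      measurable_snd measurable_fst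
  calc ∫⁻ t, ENNReal.ofReal l ^ 2 * ‖duhamelIntegral l k t‖ₑ ^ 2
      ≤ ∫⁻ t, ∫⁻ s, F (t, s) := by
        refine lintegral_mono fun t => ?_
        have e : ∫⁻ s, F (t, s) = ENNReal.ofReal l * ∫⁻ s in Iic t,
            ENNReal.ofReal (Real.exp (-(l * ((t : ℝ) - s)))) * ‖k s‖ₑ ^ 2 := by
          rw [← lintegral_const_mul _ (by fun_prop), ← lintegral_indicator measurableSet_Iic]
          rfl
        rw [e]
        calc _ ≤ ENNReal.ofReal l ^ 2 * _ :=
              mul_le_mul' le_rfl (enorm_duhamelIntegral_sq_le l hk t)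
          _ = (ENNReal.ofReal l *
                ∫⁻ s in Iic t, ENNReal.ofReal (Real.exp (-(l * ((t : ℝ) - s))))) *
              (ENNReal.ofReal l * ∫⁻ s in Iic t,
                ENNReal.ofReal (Real.exp (-(l * ((t : ℝ) - s)))) * ‖k s‖ₑ ^ 2) := by ring
          _ ≤ _ := mul_le_of_le_one_left' (mul_lintegral_Iic_exp_le hl t)
    _ = ∫⁻ s, ∫⁻ t, F (t, s) := lintegral_lintegral_swap (f := fun t s => F (t, s)) hF.aemeasurable
    _ ≤ ∫⁻ s, ‖k s‖ₑ ^ 2 := by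
        refine lintegral_mono fun s => ?_
        have e : ∫⁻ t, F (t, s) = (ENNReal.ofReal l * ∫⁻ t in Ici s,
            ENNReal.ofReal (Real.exp (-(l * ((t : ℝ) - s))))) * ‖k s‖ₑ ^ 2 := by
          rw [← lintegral_const_mul _ (by fun_prop), ← lintegral_mul_const _ (by fun_prop),
            ← lintegral_indicator measurableSet_Ici]
          congr 1; ext t
          by_cases h : s ≤ t <;> simp [F, h, mul_assoc]
        rw [e]
        exact mul_le_of_le_one_left' (mul_lintegral_Ici_exp_le hl s)

/-- The Sobolev weight does not depend on time, so scalar maximal regularity applies at each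
frequency. -/
theorem fourierNormSq_laplace_duhamel_le (γ : ℝ) {k : Time T × Space d → ℂ} (hk : Measurable k) :
    fourierNormSq γ (fun z => laplaceSymbol z.2 * duhamel k z) ≤ fourierNormSq γ k := by
  have hD := measurable_duhamel hk
  rw [fourierNormSq_eq_prod γ (by fun_prop), fourierNormSq_eq_prod γ hk, Measure.volume_eq_prod,
    lintegral_prod_symm _ (by fun_prop), lintegral_prod_symm _ (by fun_prop)]
  refine lintegral_mono fun ξ => ?_
  simp only
  rw [lintegral_mul_const _ (by fun_prop), lintegral_mul_const _ (by fun_prop)]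
  refine mul_le_mul' ?_ le_rfl
  refine le_trans (le_of_eq ?_) (lintegral_mul_duhamelIntegral_sq_le (laplaceSymbol_nonneg ξ)
    (k := fun s => k (s, ξ)) (by fun_prop))
  congr 1; ext t
  rw [enorm_mul, mul_pow, ← ofReal_norm (Complex.ofReal _), Complex.norm_real, Real.norm_eq_abs,
    abs_of_nonneg (laplaceSymbol_nonneg ξ)]
  rfl

theorem enorm_duhamel_sq_le {k : Time T × Space d → ℂ} (hk : Measurable k) (t : Time T)
    (ξ : Space d) : ‖duhamel k (t, ξ)‖ₑ ^ 2 ≤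
      ENNReal.ofReal ((T + 1) / (1 + laplaceSymbol ξ)) * ∫⁻ s, ‖k (s, ξ)‖ₑ ^ 2 :=
  enorm_duhamelIntegral_sq_le_div (laplaceSymbol_nonneg ξ) (by fun_prop) t

/-- Valid at every time and not only almost every one, since the bound on the Duhamel integral is
uniform in `t`. -/
theorem memLp_duhamel {k : Time T × Space d → ℂ} (hm : Measurable k) (hk : MemLp k 2)
    (t : Time T) : MemLp (fun ξ => duhamel k (t, ξ)) 2 := by
  have hD := measurable_duhamel hm
  refine memLp_two_of_lintegral_sq (Measurable.aestronglyMeasurable (by fun_prop)) ?_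
  have h := lintegral_sq_lt_top_of_memLp hk
  rw [Measure.volume_eq_prod, lintegral_prod_symm _ (by fun_prop)] at h
  have h0 : (0 : ℝ) ≤ T := t.2.1.trans t.2.2
  calc ∫⁻ ξ, ‖duhamel k (t, ξ)‖ₑ ^ 2
      ≤ ∫⁻ ξ, ENNReal.ofReal (T + 1) * ∫⁻ s, ‖k (s, ξ)‖ₑ ^ 2 := by
        refine lintegral_mono fun ξ => (enorm_duhamel_sq_le hm t ξ).trans ?_
        gcongr
        have := laplaceSymbol_nonneg ξ
        exact div_le_self (by linarith) (by linarith)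
    _ < ∞ := by
        rw [lintegral_const_mul _ (Measurable.lintegral_prod_left (by fun_prop))]
        exact ENNReal.mul_lt_top ENNReal.ofReal_lt_top h

theorem integrable_weight {r : ℝ} (hr : (d : ℝ) < 2 * r) :
    Integrable fun ξ : Space d => (1 + laplaceSymbol ξ) ^ (-r) := by
  have h := (integrable_rpow_neg_one_add_norm_sq (E := Space d) (μ := volume) (r := 2 * r)
    (by simpa using hr)).comp_smul (R := 2 * Real.pi) (by positivity)
  refine h.congr (Eventually.of_forall fun ξ => ?_)
  simp only [laplaceSymbol, norm_smul, Real.norm_eq_abs, abs_of_pos Real.two_pi_pos]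
  congr 1; ring

/-- The square of the modulus is at most `X * Y`, where `X = (T+1)(1+l)^{-1-α/2}` is integrable
because `α > d - 2` and `Y`, the weighted time integral of `‖k‖²`, is integrable by hypothesis. Then
the modulus is at most `X + Y`. -/
theorem integrable_duhamel {α : ℝ} (hα : max 0 ((d : ℝ) - 2) < α)
    {k : Time T × Space d → ℂ} (hm : Measurable k) (hk : fourierNormSq (α / 2) k < ∞)
    (t : Time T) : Integrable fun ξ => duhamel k (t, ξ) := by
  have hD := measurable_duhamel hm
  refine ⟨Measurable.aestronglyMeasurable (by fun_prop), ?_⟩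
  rw [fourierNormSq_eq_prod _ hm, Measure.volume_eq_prod,
    lintegral_prod_symm _ (by fun_prop)] at hk
  have h0 : (0 : ℝ) ≤ T := t.2.1.trans t.2.2
  have hw := (integrable_weight (d := d) (r := 1 + α / 2)
    (by linarith [(le_max_right _ _).trans_lt hα])).const_mul (T + 1)
  rw [HasFiniteIntegral]
  calc ∫⁻ ξ, ‖duhamel k (t, ξ)‖ₑ
      ≤ ∫⁻ ξ, (ENNReal.ofReal ((T + 1) * (1 + laplaceSymbol ξ) ^ (-(1 + α / 2))) +
          ∫⁻ s, ‖k (s, ξ)‖ₑ ^ 2 * ENNReal.ofReal ((1 + laplaceSymbol ξ) ^ (α / 2))) := by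
        refine lintegral_mono fun ξ => ?_
        have h1 := laplaceSymbol_nonneg ξ
        rw [lintegral_mul_const _ (by fun_prop)]
        set I := ∫⁻ s, ‖k (s, ξ)‖ₑ ^ 2
        set X := ENNReal.ofReal ((T + 1) * (1 + laplaceSymbol ξ) ^ (-(1 + α / 2)))
        set Y := I * ENNReal.ofReal ((1 + laplaceSymbol ξ) ^ (α / 2))
        have h2 : ‖duhamel k (t, ξ)‖ₑ ^ 2 ≤ X * Y := by
          refine (enorm_duhamel_sq_le hm t ξ).trans (le_of_eq ?_)
          simp only [X, Y]
          rw [mul_left_comm, ← ENNReal.ofReal_mul (by positivity), mul_assoc,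
            ← Real.rpow_add (by linarith), mul_comm I]
          congr 2
          rw [div_eq_mul_inv, ← Real.rpow_neg_one]
          congr 2; ring
        have h3 : X * Y ≤ (X + Y) ^ 2 := by
          rw [sq]; gcongr
          · exact le_self_add
          · exact le_add_self
        exact le_of_not_gt fun h => (ENNReal.pow_lt_pow_left two_ne_zero h).not_ge (h2.trans h3)
    _ < ∞ := by
        rw [lintegral_add_left (by fun_prop)]
        refine ENNReal.add_lt_top.2 ⟨?_, hk⟩
        exact hw.lintegral_lt_top

/-- Source of the initial condition: at time 0 the Duhamel integral runs over a null set. -/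
theorem volume_Iic_of_coe_eq_zero {t : Time T} (ht : (t : ℝ) = 0) :
    volume.restrict (Iic t) = (0 : Measure (Time T)) := by
  rw [Measure.restrict_eq_zero]
  have h := lintegral_time (T := T) ((Iic (0 : ℝ)).indicator fun _ => 1)
  have h1 : (fun s : Time T => (Iic (0 : ℝ)).indicator (fun _ => (1 : ℝ≥0∞)) (s : ℝ)) =
      (Iic t).indicator fun _ => 1 := by
    ext s
    have : s ∈ Iic t ↔ (s : ℝ) ∈ Iic (0 : ℝ) := by
      rw [mem_Iic, mem_Iic, ← Subtype.coe_le_coe, ht]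
    simp only [indicator, this]
  rw [h1, lintegral_indicator_const measurableSet_Iic, one_mul] at h
  rw [h, setLIntegral_congr_fun (g := fun _ => 0) measurableSet_Ioo]
  · simp
  · intro s hs
    simp [hs.1]

end Duhamel

/-! ### The parabolic space on the Fourier side -/

section ParabolicFourier

variable {d : ℕ} {T : ℝ}

theorem l2SobolevNorm_le {γ : ℝ} {g : Time T → 𝓢'(Space d, ℂ)} {k : Time T × Space d → ℂ}
    (hk : Measurable k) (h : ∀ᵐ t : Time T, HasFourierFun (g t) fun ξ => k (t, ξ)) :
    l2SobolevNorm γ g ≤ fourierNormSq γ k ^ (1 / 2 : ℝ) :=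
  iInf_le_of_le k (iInf_le_of_le hk (iInf_le_of_le h le_rfl))

theorem exists_of_l2SobolevNorm_lt {γ : ℝ} {g : Time T → 𝓢'(Space d, ℂ)} {a : ℝ≥0∞}
    (h : l2SobolevNorm γ g < a) : ∃ k : Time T × Space d → ℂ, Measurable k ∧
      (∀ᵐ t : Time T, HasFourierFun (g t) fun ξ => k (t, ξ)) ∧
      fourierNormSq γ k ^ (1 / 2 : ℝ) < a := by
  simp only [l2SobolevNorm, iInf_lt_iff] at h
  obtain ⟨k, hk, hg, h⟩ := h
  exact ⟨k, hk, hg, h⟩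

theorem fourierNormSq_lt_top_of_rpow {γ : ℝ} {k : Time T × Space d → ℂ} {a : ℝ≥0∞}
    (h : fourierNormSq γ k ^ (1 / 2 : ℝ) < a) : fourierNormSq γ k < ∞ := by
  by_contra hn
  rw [not_lt, top_le_iff] at hn
  rw [hn, ENNReal.top_rpow_of_pos (by norm_num)] at h
  exact not_top_lt h

theorem sum_hessianSymbol (ξ : Space d) : ∑ i, hessianSymbol i i ξ = -(laplaceSymbol ξ : ℂ) := by
  simp only [hessianSymbol, laplaceSymbol, mul_pow, EuclideanSpace.norm_sq_eq, Real.norm_eq_abs,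
    sq_abs, mul_assoc, ← Finset.mul_sum]
  push_cast
  simp only [sq]
  ring

/-- The symbol of the Hessian is the rank-one matrix `-(2π)² ξ ⊗ ξ`, whose Frobenius norm is
`laplaceSymbol ξ`. Thus bounding `v_xx` amounts to bounding `Δv`. -/
theorem sum_enorm_hessianSymbol (ξ : Space d) :
    ∑ i, ∑ j, ‖hessianSymbol i j ξ‖ₑ ^ 2 = ENNReal.ofReal (laplaceSymbol ξ) ^ 2 := by
  have h1 : ∀ i j, ‖hessianSymbol i j ξ‖ₑ ^ 2 =
      ENNReal.ofReal ((2 * Real.pi) ^ 4 * (ξ i ^ 2 * ξ j ^ 2)) := fun i j => by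
    rw [← ofReal_norm, ← ENNReal.ofReal_pow (norm_nonneg _)]
    congr 1
    simp only [hessianSymbol, norm_mul, norm_neg, norm_pow, Complex.norm_real, Real.norm_eq_abs,
      mul_pow, sq_abs, Complex.norm_ofNat, abs_of_pos Real.pi_pos]
    ring
  simp only [h1]
  rw [← ENNReal.ofReal_pow (laplaceSymbol_nonneg ξ)]
  have h2 : ∀ i j, 0 ≤ (2 * Real.pi) ^ 4 * (ξ i ^ 2 * ξ j ^ 2) := fun i j => by positivity
  simp only [← ENNReal.ofReal_sum_of_nonneg fun j _ => h2 _ j]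
  rw [← ENNReal.ofReal_sum_of_nonneg fun i _ => Finset.sum_nonneg fun j _ => h2 i j]
  congr 1
  simp only [← Finset.mul_sum, ← Finset.sum_mul, laplaceSymbol, mul_pow,
    EuclideanSpace.norm_sq_eq, Real.norm_eq_abs, sq_abs]
  ring

theorem integrable_mul_schwartz {K : Time T × Space d → ℂ} (hK : MemLp K 2)
    (ψ : 𝓢(Space d, ℂ)) : Integrable fun z : Time T × Space d => K z * ψ z.2 := by
  have : MemLp (fun z : Time T × Space d => ψ z.2) 2 := by
    rw [Measure.volume_eq_prod]
    exact (ψ.memLp 2 volume).comp_snd (volume : Measure (Time T))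
  exact hK.integrable_mul this

/-- Fubini's theorem for the pairing of a time-dependent function with a Schwartz function. -/
theorem integral_Iic_pairing {K : Time T × Space d → ℂ} (hK : MemLp K 2)
    (ψ : 𝓢(Space d, ℂ)) (t : Time T) :
    ∫ s in Iic t, ∫ ξ, K (s, ξ) * ψ ξ = ∫ ξ, (∫ s in Iic t, K (s, ξ)) * ψ ξ := by
  have h := integrable_mul_schwartz hK ψ
  have h2 : Integrable (fun z : Time T × Space d => K z * ψ z.2)
      ((volume.restrict (Iic t)).prod volume) := by
    rw [Measure.volume_eq_prod] at h
    refine h.mono_measure ?_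
    exact Measure.prod_mono Measure.restrict_le_self le_rfl
  rw [integral_integral_swap (f := fun s ξ => K (s, ξ) * ψ ξ) h2]
  simp only [integral_mul_const]

theorem integrable_pairing {K : Time T × Space d → ℂ} (hK : MemLp K 2)
    (ψ : 𝓢(Space d, ℂ)) : Integrable fun s : Time T => ∫ ξ, K (s, ξ) * ψ ξ := by
  have h := integrable_mul_schwartz hK ψ
  rw [Measure.volume_eq_prod] at h
  exact h.integral_prod_left

theorem schwartzIntegrable_primitive {K : Time T × Space d → ℂ} (hK : MemLp K 2) (t : Time T) :
    SchwartzIntegrable fun ξ => ∫ s in Iic t, K (s, ξ) := by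
  intro ψ
  have h := integrable_mul_schwartz hK ψ
  have h2 : Integrable (fun z : Time T × Space d => K z * ψ z.2)
      ((volume.restrict (Iic t)).prod volume) := by
    rw [Measure.volume_eq_prod] at h
    refine h.mono_measure ?_
    exact Measure.prod_mono Measure.restrict_le_self le_rfl
  have h3 := h2.integral_prod_right
  simpa only [integral_mul_const] using h3

/-- `SolvesHeat` puts the Laplacian on the test function, while the available bound is on the second
derivatives of `v`; this links the two. -/
theorem laplacian_eq_sum_secondDeriv (v : Time T → 𝓢'(Space d, ℂ)) (s : Time T)
    (ψ : 𝓢(Space d, ℂ)) : v s (Δ ψ) = ∑ i, secondDeriv v i i s ψ := by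
  rw [← TemperedDistribution.laplacian_apply_apply,
    TemperedDistribution.laplacian_eq_sum (EuclideanSpace.basisFun (Fin d) ℝ)]
  have : ∀ (s' : Finset (Fin d)) (f : Fin d → 𝓢'(Space d, ℂ)),
      (∑ i ∈ s', f i) ψ = ∑ i ∈ s', f i ψ := fun s' f => by
    classical
    induction s' using Finset.induction_on with
    | empty => rfl
    | insert a s' ha ih => rw [Finset.sum_insert ha, Finset.sum_insert ha, ← ih]; rfl
  exact this _ _

/-- After the pairings are moved to frequency and the time integrals inside, the equation is
`duhamelIntegral_eq` at almost every frequency. -/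
theorem solvesHeat_ofFourier {k : Time T × Space d → ℂ} (hm : Measurable k) (hk : MemLp k 2)
    {γ : ℝ} (hγ : 0 ≤ γ) (hkγ : fourierNormSq γ k < ∞) :
    SolvesHeat (fun t => ofFourier fun ξ => duhamel k (t, ξ))
      (fun t => ofFourier fun ξ => k (t, ξ)) := by
  intro t ψ _
  have hD := measurable_duhamel hm
  set L : Time T × Space d → ℂ := fun z => laplaceSymbol z.2 * duhamel k z
  have hL : MemLp L 2 := memLp_of_fourierNormSq hγ (by fun_prop)
    ((fourierNormSq_laplace_duhamel_le γ hm).trans_lt hkγ)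
  have e1 : ∀ s : Time T, (ofFourier fun ξ => duhamel k (s, ξ)) (Δ ψ) =
      -∫ ξ, L (s, ξ) * 𝓕⁻ ψ ξ := by
    intro s
    have h := hasFourierFun_ofFourier (memLp_duhamel hm hk s)
    have hi := SchwartzIntegrable.of_memLp (memLp_duhamel hm hk s)
    rw [laplacian_eq_sum_secondDeriv (fun s => ofFourier fun ξ => duhamel k (s, ξ))]
    have h2 : ∀ i, secondDeriv (fun s => ofFourier fun ξ => duhamel k (s, ξ)) i i s ψ =
        ∫ ξ, hessianSymbol i i ξ * duhamel k (s, ξ) * 𝓕⁻ ψ ξ := fun i =>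
      (h.secondDeriv i i).apply_eq ψ
    simp only [h2]
    rw [← integral_finsetSum _ fun i _ => (hi.mul (hessianSymbol_hasTemperateGrowth i i)) (𝓕⁻ ψ),
      ← integral_neg]
    congr 1; ext ξ
    rw [← Finset.sum_mul, ← Finset.sum_mul, sum_hessianSymbol]
    simp only [L]; ring
  -- Only almost every slice of `k` is in `L²`; at the other times `ofFourier` has its default value
  -- 0.
  have e2 : ∀ᵐ s : Time T, (ofFourier fun ξ => k (s, ξ)) ψ = ∫ ξ, k (s, ξ) * 𝓕⁻ ψ ξ := by
    filter_upwards [ae_memLp_space hm hk] with s hs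
    exact (hasFourierFun_ofFourier hs).apply_eq ψ
  simp only [e1]
  rw [(hasFourierFun_ofFourier (memLp_duhamel hm hk t)).apply_eq,
    integral_congr_ae (ae_restrict_of_ae e2), integral_neg, integral_Iic_pairing hL,
    integral_Iic_pairing hk, neg_add_eq_sub,
    ← integral_sub (schwartzIntegrable_primitive hk t _) (schwartzIntegrable_primitive hL t _)]
  refine integral_congr_ae ?_
  filter_upwards [ae_integrable_time hm hk] with ξ hξ
  rw [← sub_mul]
  congr 1
  have := duhamelIntegral_eq (laplaceSymbol_nonneg ξ) hξ t
  simp only [L]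
  rw [show (∫ s in Iic t, (laplaceSymbol ξ : ℂ) * duhamel k (s, ξ)) = _ from this]
  rw [sub_sub_cancel]
  rfl

/-- Summing over `i, j` under the integral replaces the Hessian symbol by `laplaceSymbol`, and
maximal regularity applies. -/
theorem hessianNorm_ofFourier_le (γ : ℝ) {k : Time T × Space d → ℂ} (hm : Measurable k)
    (hk : MemLp k 2) : hessianNorm γ (fun t : Time T => ofFourier fun ξ => duhamel k (t, ξ)) ≤
      fourierNormSq γ k ^ (1 / 2 : ℝ) := by
  have hD := measurable_duhamel hm
  have hH : ∀ i j, Measurable (hessianSymbol (d := d) i j) := fun i j =>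
    (hessianSymbol_hasTemperateGrowth i j).1.continuous.measurable
  refine ENNReal.rpow_le_rpow ?_ (by norm_num)
  have h1 : ∀ i j, l2SobolevNorm γ
      (secondDeriv (fun t : Time T => ofFourier fun ξ => duhamel k (t, ξ)) i j) ^ 2 ≤
      fourierNormSq γ fun z => hessianSymbol i j z.2 * duhamel k z := fun i j => by
    calc _ ≤ ((fourierNormSq γ fun z => hessianSymbol i j z.2 * duhamel k z) ^ (1 / 2 : ℝ)) ^ 2 :=
          pow_le_pow_left' (l2SobolevNorm_le (by fun_prop) (Eventually.of_forall fun t =>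
            (hasFourierFun_ofFourier (memLp_duhamel hm hk t)).secondDeriv i j)) 2
      _ = _ := by
          rw [← ENNReal.rpow_natCast, ← ENNReal.rpow_mul]
          simp
  refine (Finset.sum_le_sum fun i _ => Finset.sum_le_sum fun j _ => h1 i j).trans
    (le_trans (le_of_eq ?_) (fourierNormSq_laplace_duhamel_le γ hm))
  have h2 : ∀ i j, Measurable fun z : Time T × Space d => hessianSymbol i j z.2 * duhamel k z :=
    fun i j => by fun_prop
  simp only [fun i j => fourierNormSq_eq_prod γ (h2 i j)]
  rw [fourierNormSq_eq_prod γ (by fun_prop)]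
  simp only [← lintegral_finsetSum _ fun j _ => measurable_fourierNormSq_integrand γ (h2 _ j)]
  rw [← lintegral_finsetSum _ fun i _ => Finset.measurable_fun_sum _ fun j _ =>
    measurable_fourierNormSq_integrand γ (h2 i j)]
  congr 1; ext z
  simp only [enorm_mul, mul_pow, ← Finset.sum_mul, sum_enorm_hessianSymbol]
  rw [← ofReal_norm (Complex.ofReal _), Complex.norm_real, Real.norm_eq_abs,
    abs_of_nonneg (laplaceSymbol_nonneg _)]

/-- The elements of the parabolic space are given by Duhamel's formula. -/
theorem hasFourierFun_duhamel_of_solvesHeat {γ : ℝ} (hγ : 0 ≤ γ) {v g : Time T → 𝓢'(Space d, ℂ)}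
    (hv : ∀ t, ∃ k, SchwartzIntegrable k ∧ HasFourierFun (v t) k)
    (hhess : hessianNorm γ v < ∞) (hsolve : SolvesHeat v g)
    {k : Time T × Space d → ℂ} (hm : Measurable k) (hk : MemLp k 2)
    (hg : ∀ᵐ t : Time T, HasFourierFun (g t) fun ξ => k (t, ξ)) (t : Time T) :
    HasFourierFun (v t) fun ξ => duhamel k (t, ξ) := by
  choose a ha hva using hv
  have h1 : ∀ i, l2SobolevNorm γ (secondDeriv v i i) < ∞ := by
    intro i
    by_contra hn
    rw [not_lt, top_le_iff] at hn
    refine hhess.ne ?_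
    have : ∑ i, ∑ j, l2SobolevNorm γ (secondDeriv v i j) ^ 2 = ∞ := by
      refine ENNReal.sum_eq_top.2 ⟨i, Finset.mem_univ _, ENNReal.sum_eq_top.2
        ⟨i, Finset.mem_univ _, ?_⟩⟩
      rw [hn]; rfl
    rw [hessianNorm, this, ENNReal.top_rpow_of_pos (by norm_num)]
  choose κ hκm hκ hκn using fun i => exists_of_l2SobolevNorm_lt (h1 i)
  have hκ2 : ∀ i, MemLp (κ i) 2 := fun i =>
    memLp_of_fourierNormSq hγ (hκm i) (fourierNormSq_lt_top_of_rpow (hκn i))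
  -- `K` is a jointly measurable version of the Fourier transform of `Δv`, which the slices `a t`,
  -- chosen separately for each `t`, do not provide. Below, `q` is that of the time derivative `Δv +
  -- g`.
  set K : Time T × Space d → ℂ := fun z => ∑ i, κ i z
  have hKm : Measurable K := by fun_prop
  have hK2 : MemLp K 2 := memLp_finsetSum _ fun i _ => hκ2 i
  set q : Time T × Space d → ℂ := fun z => K z + k z
  have hqm : Measurable q := by fun_prop
  have hq2 : MemLp q 2 := hK2.add hk
  have hae : ∀ᵐ s : Time T, ∀ i, (HasFourierFun (secondDeriv v i i s) fun ξ => κ i (s, ξ)) ∧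
      MemLp (fun ξ => κ i (s, ξ)) 2 :=
    ae_all_iff.2 fun i => (hκ i).and (ae_memLp_space (hκm i) (hκ2 i))
  -- The integrated equation, tested against compactly supported functions, says that the Fourier
  -- transform of `v(t)` is the time primitive of `q`.
  have hA : ∀ t, a t =ᵐ[volume] fun ξ => ∫ s in Iic t, q (s, ξ) := by
    intro t
    have hi := schwartzIntegrable_primitive hq2 t
    have := ((ha t).sub hi).ae_eq_zero_of_compact fun ψ hψ => by
      simp only [sub_mul]
      rw [integral_sub (ha t _) (hi _), ← (hva t).apply_eq, hsolve t ψ hψ,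
        ← integral_Iic_pairing hq2]
      have e1 : ∀ᵐ s : Time T, v s (Δ ψ) = ∫ ξ, K (s, ξ) * 𝓕⁻ ψ ξ := by
        filter_upwards [hae] with s hs
        rw [laplacian_eq_sum_secondDeriv]
        simp only [fun i => (hs i).1.apply_eq ψ]
        rw [← integral_finsetSum _ fun i _ => SchwartzIntegrable.of_memLp (hs i).2 (𝓕⁻ ψ)]
        simp only [K, Finset.sum_mul]
      have e2 : ∀ᵐ s : Time T, g s ψ = ∫ ξ, k (s, ξ) * 𝓕⁻ ψ ξ :=
        hg.mono fun s hs => hs.apply_eq ψ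
      have e3 : ∀ᵐ s : Time T, ∫ ξ, q (s, ξ) * 𝓕⁻ ψ ξ =
          (∫ ξ, K (s, ξ) * 𝓕⁻ ψ ξ) + ∫ ξ, k (s, ξ) * 𝓕⁻ ψ ξ := by
        filter_upwards [ae_memLp_space hKm hK2, ae_memLp_space hm hk] with s h1 h2
        rw [← integral_add (SchwartzIntegrable.of_memLp h1 _) (SchwartzIntegrable.of_memLp h2 _)]
        simp only [q, add_mul]
      rw [integral_congr_ae (ae_restrict_of_ae e1), integral_congr_ae (ae_restrict_of_ae e2),
        integral_congr_ae (ae_restrict_of_ae e3),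
        integral_add (integrable_pairing hK2 _).integrableOn (integrable_pairing hk _).integrableOn,
        sub_self]
    exact this.mono fun ξ h => sub_eq_zero.1 h
  -- `K` is also `-l` times the Fourier transform of `v(s)`. Substituting the primitive of `q` for
  -- the latter closes the equation for `q`.
  have hq : ∀ᵐ s : Time T, ∀ᵐ ξ : Space d,
      q (s, ξ) = -(laplaceSymbol ξ * ∫ r in Iic s, q (r, ξ)) + k (s, ξ) := by
    filter_upwards [hae] with s hs
    have h2 : ∀ i, (fun ξ => κ i (s, ξ)) =ᵐ[volume] fun ξ => hessianSymbol i i ξ * a s ξ :=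
      fun i => (hs i).1.ae_eq ((hva s).secondDeriv i i) (SchwartzIntegrable.of_memLp (hs i).2)
        ((ha s).mul (hessianSymbol_hasTemperateGrowth i i))
    filter_upwards [ae_all_iff.2 h2, hA s] with ξ h3 h4
    simp only [q, K, h3]
    rw [← Finset.sum_mul, sum_hessianSymbol, h4]
    ring
  have hPm := measurable_primitive hqm
  -- Exchanging the two almost-everywhere quantifiers, which needs joint measurability, gives a
  -- scalar equation in time at almost every frequency.
  have hq' : ∀ᵐ ξ : Space d, ∀ᵐ s : Time T,
      q (s, ξ) = -(laplaceSymbol ξ * ∫ r in Iic s, q (r, ξ)) + k (s, ξ) := by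
    refine (Measure.ae_ae_comm ?_).1 hq
    exact measurableSet_eq_fun (f := fun z : Time T × Space d => q z)
      (g := fun z => -(laplaceSymbol z.2 * ∫ r in Iic z.1, q (r, z.2)) + k z) hqm (by fun_prop)
  refine (hva t).congr ?_
  filter_upwards [hA t, hq', ae_integrable_time hqm hq2, ae_integrable_time hm hk]
    with ξ h1 h2 h3 h4
  rw [h1]
  exact eq_duhamelIntegral (laplaceSymbol_nonneg ξ) h3 h4 h2 t

end ParabolicFourier

/-! ### The solution operator on real functions -/

section Field

variable {d : ℕ} {T : ℝ}

/-- The function with Fourier transform `duhamel k`, made real. -/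
def heatField (k : Time T × Space d → ℂ) (t : Time T) (x : Space d) : ℝ :=
  (𝓕⁻ (fun ξ => duhamel k (t, ξ)) x).re

theorem continuous_heatField {k : Time T × Space d → ℂ} {t : Time T}
    (h : Integrable fun ξ => duhamel k (t, ξ)) : Continuous (heatField k t) :=
  Complex.continuous_re.comp (fourierInv_continuous h)

theorem norm_fourierInv_le (f : Space d → ℂ) (x : Space d) : ‖𝓕⁻ f x‖ ≤ ∫ ξ, ‖f ξ‖ :=
  VectorFourier.norm_fourierIntegral_le_integral_norm _ _ _ _ _

theorem integrable_continuous_bounded_mul {f : Space d → ℂ} (hf : Continuous f) {C : ℝ}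
    (hC : ∀ x, ‖f x‖ ≤ C) (ψ : 𝓢(Space d, ℂ)) : Integrable fun x => f x * ψ x :=
  ψ.integrable.bdd_mul hf.aestronglyMeasurable (Eventually.of_forall hC)

theorem integrable_heatField_mul {k : Time T × Space d → ℂ} {t : Time T}
    (h : Integrable fun ξ => duhamel k (t, ξ)) (ψ : 𝓢(Space d, ℂ)) :
    Integrable fun x => (heatField k t x : ℂ) * ψ x := by
  refine integrable_continuous_bounded_mul (C := ∫ ξ, ‖duhamel k (t, ξ)‖)
    (Complex.continuous_ofReal.comp (continuous_heatField h)) (fun x => ?_) ψ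
  rw [Function.comp_apply, Complex.norm_real]
  exact (Complex.abs_re_le_norm _).trans (norm_fourierInv_le _ x)

/-- Two continuous functions representing the same distributions agree. -/
theorem Represents.eq {h h' : Time T → Space d → ℝ} {v : Time T → 𝓢'(Space d, ℂ)}
    (hv : Represents h v) (hv' : Represents h' v) (hc : ∀ t, Continuous (h t))
    (hc' : ∀ t, Continuous (h' t)) : h = h' := by
  funext t
  have hi : SchwartzIntegrable fun x => (h t x : ℂ) := fun ψ => (hv t ψ).1
  have hi' : SchwartzIntegrable fun x => (h' t x : ℂ) := fun ψ => (hv' t ψ).1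
  have h0 := (hi.sub hi').ae_eq_zero fun ψ => by
    simp only [sub_mul]
    rw [integral_sub (hi ψ) (hi' ψ), ← (hv t ψ).2, ← (hv' t ψ).2, sub_self]
  refine (Continuous.ae_eq_iff_eq volume (hc t) (hc' t)).1 ?_
  filter_upwards [h0] with x hx
  exact_mod_cast sub_eq_zero.1 hx

theorem Represents.distribution_eq {h : Time T → Space d → ℝ} {v v' : Time T → 𝓢'(Space d, ℂ)}
    (hv : Represents h v) (hv' : Represents h v') : v = v' := by
  funext t; ext ψ
  rw [(hv t ψ).2, (hv' t ψ).2]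

theorem Represents.isReal {h : Time T → Space d → ℝ} {v : Time T → 𝓢'(Space d, ℂ)}
    (hv : Represents h v) (t : Time T) : IsRealDistribution (v t) := by
  intro ψ hψ
  have e : ∀ x, (h t x : ℂ) * ψ x = ((h t x * (ψ x).re : ℝ) : ℂ) := fun x => by
    rw [Complex.ofReal_mul]
    congr 1
    exact Complex.ext rfl (by simp [hψ])
  rw [(hv t ψ).2]
  simp only [e]
  rw [integral_complex_ofReal, Complex.ofReal_im]

/-- The Hermitian part of a function on the Fourier side. -/
def hermitianPart (k : Time T × Space d → ℂ) (z : Time T × Space d) : ℂ :=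
  (k z + starRingEnd ℂ (k (z.1, -z.2))) / 2

theorem measurable_hermitianPart {k : Time T × Space d → ℂ} (hk : Measurable k) :
    Measurable (hermitianPart k) := by
  unfold hermitianPart
  exact (hk.add (Complex.continuous_conj.measurable.comp (by fun_prop))).div_const _

theorem measurePreserving_neg_snd :
    MeasurePreserving (fun z : Time T × Space d => (z.1, -z.2)) := by
  rw [Measure.volume_eq_prod]
  exact (MeasurePreserving.id _).prod (Measure.measurePreserving_neg _)

theorem laplaceSymbol_neg (ξ : Space d) : laplaceSymbol (-ξ) = laplaceSymbol ξ := by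
  simp [laplaceSymbol]

/-- Convexity of the square, with the weight and the measure invariant under `ξ ↦ -ξ`. -/
theorem fourierNormSq_hermitianPart_le (γ : ℝ) {k : Time T × Space d → ℂ} (hk : Measurable k) :
    fourierNormSq γ (hermitianPart k) ≤ fourierNormSq γ k := by
  rw [fourierNormSq_eq_prod γ (measurable_hermitianPart hk), fourierNormSq_eq_prod γ hk]
  set w : Time T × Space d → ℝ≥0∞ := fun z => ENNReal.ofReal ((1 + laplaceSymbol z.2) ^ γ)
  have h1 : ∀ z, ‖hermitianPart k z‖ₑ ^ 2 * w z ≤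
      2⁻¹ * (‖k z‖ₑ ^ 2 * w z + ‖k (z.1, -z.2)‖ₑ ^ 2 * w (z.1, -z.2)) := by
    intro z
    have e : w (z.1, -z.2) = w z := by simp only [w, laplaceSymbol_neg]
    rw [e, ← add_mul, ← mul_assoc]
    refine mul_le_mul' ?_ le_rfl
    have h2 : ‖hermitianPart k z‖ ^ 2 ≤ 2⁻¹ * (‖k z‖ ^ 2 + ‖k (z.1, -z.2)‖ ^ 2) := by
      have h3 : ‖hermitianPart k z‖ ≤ (‖k z‖ + ‖k (z.1, -z.2)‖) / 2 := by
        rw [hermitianPart, norm_div, Complex.norm_ofNat]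
        gcongr
        refine (norm_add_le _ _).trans (le_of_eq ?_)
        rw [RCLike.norm_conj]
      nlinarith [sq_nonneg (‖k z‖ - ‖k (z.1, -z.2)‖), norm_nonneg (hermitianPart k z)]
    have h4 := ENNReal.ofReal_le_ofReal h2
    rw [ENNReal.ofReal_mul (by norm_num), ENNReal.ofReal_add (by positivity) (by positivity),
      ENNReal.ofReal_pow (norm_nonneg _), ENNReal.ofReal_pow (norm_nonneg _),
      ENNReal.ofReal_pow (norm_nonneg _), ENNReal.ofReal_inv_of_pos two_pos,
      ENNReal.ofReal_ofNat] at h4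
    simpa only [ofReal_norm] using h4
  have hm := measurable_fourierNormSq_integrand γ hk
  calc ∫⁻ z, ‖hermitianPart k z‖ₑ ^ 2 * w z
      ≤ ∫⁻ z, 2⁻¹ * (‖k z‖ₑ ^ 2 * w z + ‖k (z.1, -z.2)‖ₑ ^ 2 * w (z.1, -z.2)) :=
        lintegral_mono h1
    _ = 2⁻¹ * ((∫⁻ z, ‖k z‖ₑ ^ 2 * w z) + ∫⁻ z, ‖k z‖ₑ ^ 2 * w z) := by
        have hm' := hm.comp measurePreserving_neg_snd.measurable
        rw [lintegral_const_mul _ (by exact hm.add hm'), lintegral_add_left hm]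
        congr 2
        exact measurePreserving_neg_snd.lintegral_comp hm
    _ = _ := by
        rw [← two_mul, ← mul_assoc, ENNReal.inv_mul_cancel two_ne_zero ENNReal.ofNat_ne_top,
          one_mul]

theorem duhamelIntegral_conj (l : ℝ) (k : Time T → ℂ) (t : Time T) :
    duhamelIntegral l (fun s => starRingEnd ℂ (k s)) t =
      starRingEnd ℂ (duhamelIntegral l k t) := by
  rw [duhamelIntegral, duhamelIntegral, ← integral_conj]
  simp only [map_mul, Complex.conj_ofReal]

/-- The factor `e^{-l(t-s)}` is real and even in `ξ`, so Duhamel's formula commutes with taking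
Hermitian parts. -/
theorem duhamel_hermitianPart {k : Time T × Space d → ℂ} (hm : Measurable k) (hk : MemLp k 2)
    (t : Time T) : ∀ᵐ ξ, duhamel (hermitianPart k) (t, ξ) =
      (duhamel k (t, ξ) + starRingEnd ℂ (duhamel k (t, -ξ))) / 2 := by
  have h1 := ae_integrable_time hm hk
  have h2 := (Measure.measurePreserving_neg (volume : Measure (Space d))).quasiMeasurePreserving.ae
    h1
  filter_upwards [h1, h2] with ξ h1 h2
  have hl := laplaceSymbol_nonneg ξ
  have h3 : Integrable fun s => starRingEnd ℂ (k (s, -ξ)) :=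
    h2.congr' (f := fun s => k (s, -ξ)) (Complex.continuous_conj.comp_aestronglyMeasurable h2.1)
      (Eventually.of_forall fun s => (RCLike.norm_conj _).symm)
  simp only [duhamel, laplaceSymbol_neg]
  rw [← duhamelIntegral_conj, duhamelIntegral, duhamelIntegral, duhamelIntegral,
    ← integral_add (integrable_exp_mul hl h1 t) (integrable_exp_mul hl h3 t), ← integral_div]
  congr 1; ext s
  simp only [hermitianPart]
  ring

theorem fourierInv_conj_neg (f : Space d → ℂ) (x : Space d) :
    𝓕⁻ (fun ξ => starRingEnd ℂ (f (-ξ))) x = starRingEnd ℂ (𝓕⁻ f x) := by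
  rw [Real.fourierInv_eq', Real.fourierInv_eq', ← integral_conj, ← integral_neg_eq_self]
  congr 1; ext ξ
  simp only [smul_eq_mul, map_mul, ← Complex.exp_conj, neg_neg, inner_neg_left, Complex.conj_ofReal,
    Complex.conj_I]
  congr 2
  push_cast; ring

/-- Real part in space is Hermitian part in frequency: the real part in `heatField` is the solution
for another source, whose norm is no larger. -/
theorem fourierInv_duhamel_hermitianPart {k : Time T × Space d → ℂ} (hm : Measurable k)
    (hk : MemLp k 2) {t : Time T} (hi : Integrable fun ξ => duhamel k (t, ξ)) (x : Space d) :
    𝓕⁻ (fun ξ => duhamel (hermitianPart k) (t, ξ)) x = heatField k t x := by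
  have hi' : Integrable fun ξ => starRingEnd ℂ (duhamel k (t, -ξ)) := by
    have h := hi.comp_neg
    exact h.congr' (f := fun ξ => duhamel k (t, -ξ))
      (Complex.continuous_conj.comp_aestronglyMeasurable h.1)
      (Eventually.of_forall fun s => (RCLike.norm_conj _).symm)
  have e : 𝓕⁻ (fun ξ => duhamel (hermitianPart k) (t, ξ)) x =
      (𝓕⁻ (fun ξ => duhamel k (t, ξ)) x +
        𝓕⁻ (fun ξ => starRingEnd ℂ (duhamel k (t, -ξ))) x) / 2 := by
    rw [Real.fourierInv_congr_ae (duhamel_hermitianPart hm hk t)]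
    have hexp : ∀ f : Space d → ℂ, Integrable f → Integrable fun ξ =>
        Complex.exp ((2 * Real.pi * inner ℝ ξ x : ℝ) * Complex.I) • f ξ := fun f hf =>
      hf.bdd_mul (c := 1) (by fun_prop) (Eventually.of_forall fun ξ => by
        rw [Complex.norm_exp_ofReal_mul_I])
    rw [Real.fourierInv_eq', Real.fourierInv_eq', Real.fourierInv_eq',
      ← integral_add (hexp _ hi) (hexp _ hi'), ← integral_div]
    congr 1; ext ξ
    simp only [smul_eq_mul]
    ring
  rw [e, fourierInv_conj_neg fun ξ => duhamel k (t, ξ), Complex.add_conj, heatField]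
  push_cast; ring

/-- The function `heatField k` belongs to the parabolic space. -/
theorem exists_represents_heatField {α : ℝ} (hα : max 0 ((d : ℝ) - 2) < α)
    {k : Time T × Space d → ℂ} (hm : Measurable k) (hk : fourierNormSq (α / 2) k < ∞) :
    ∃ v : Time T → 𝓢'(Space d, ℂ), MemParabolic (α / 2 + 2) v ∧ Represents (heatField k) v ∧
      parabolicNorm (α / 2 + 2) v ≤ 2 * fourierNormSq (α / 2) k ^ (1 / 2 : ℝ) := by
  have hα0 : 0 ≤ α / 2 := by linarith [(le_max_left 0 ((d : ℝ) - 2)).trans_lt hα]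
  have hk2 := memLp_of_fourierNormSq hα0 hm hk
  set l := hermitianPart k
  have hlm : Measurable l := measurable_hermitianPart hm
  have hle := fourierNormSq_hermitianPart_le (α / 2) hm
  have hlN : fourierNormSq (α / 2) l < ∞ := hle.trans_lt hk
  have hl2 := memLp_of_fourierNormSq hα0 hlm hlN
  set v : Time T → 𝓢'(Space d, ℂ) := fun t => ofFourier fun ξ => duhamel l (t, ξ)
  set g : Time T → 𝓢'(Space d, ℂ) := fun t => ofFourier fun ξ => l (t, ξ)
  have hv : ∀ t, HasFourierFun (v t) fun ξ => duhamel l (t, ξ) := fun t =>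
    hasFourierFun_ofFourier (memLp_duhamel hlm hl2 t)
  have hsolve : SolvesHeat v g := solvesHeat_ofFourier hlm hl2 hα0 hlN
  have hg : l2SobolevNorm (α / 2) g ≤ fourierNormSq (α / 2) l ^ (1 / 2 : ℝ) :=
    l2SobolevNorm_le hlm ((ae_memLp_space hlm hl2).mono fun t ht => hasFourierFun_ofFourier ht)
  have hh : hessianNorm (α / 2) v ≤ fourierNormSq (α / 2) l ^ (1 / 2 : ℝ) :=
    hessianNorm_ofFourier_le _ hlm hl2
  have hrep : Represents (heatField k) v := by
    intro t ψ
    have hi := integrable_duhamel hα hm hk t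
    refine ⟨integrable_heatField_mul hi ψ, ?_⟩
    rw [(hv t).apply_eq, SchwartzMap.fourierInv_coe,
      integral_mul_fourierInv (integrable_duhamel hα hlm hlN t) ψ.integrable]
    congr 1; ext x
    rw [fourierInv_duhamel_hermitianPart hm hk2 hi]
  have hlt : fourierNormSq (α / 2) l ^ (1 / 2 : ℝ) < ∞ :=
    ENNReal.rpow_lt_top_of_nonneg (by norm_num) hlN.ne
  have e : α / 2 + 2 - 2 = α / 2 := by ring
  -- All slices are inverse Fourier transforms of `L²` functions, so `β = 0` serves.
  refine ⟨v, ⟨⟨0, fun t => memSobolev_ofFourier _⟩, hrep.isReal, fun t ht => ?_, ?_,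
    g, ?_, hsolve⟩, hrep, ?_⟩
  · ext ψ
    rw [(hv t).apply_eq]
    simp [duhamel, duhamelIntegral, volume_Iic_of_coe_eq_zero ht]
  · rw [e]; exact hh.trans_lt hlt
  · rw [e]; exact hg.trans_lt hlt
  · rw [parabolicNorm, e, two_mul]
    refine add_le_add (hh.trans (ENNReal.rpow_le_rpow hle (by norm_num))) ?_
    exact (iInf₂_le g hsolve).trans (hg.trans (ENNReal.rpow_le_rpow hle (by norm_num)))

/-- The elements of the parabolic space are the functions `heatField k`. -/
theorem represents_heatField_of_memParabolic {α : ℝ} (hα : max 0 ((d : ℝ) - 2) < α)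
    {v : Time T → 𝓢'(Space d, ℂ)} (hv : MemParabolic (α / 2 + 2) v)
    {g : Time T → 𝓢'(Space d, ℂ)} (hsolve : SolvesHeat v g)
    {k : Time T × Space d → ℂ} (hm : Measurable k) (hk : fourierNormSq (α / 2) k < ∞)
    (hg : ∀ᵐ t : Time T, HasFourierFun (g t) fun ξ => k (t, ξ)) :
    Represents (heatField k) v := by
  have hα0 : 0 ≤ α / 2 := by linarith [(le_max_left 0 ((d : ℝ) - 2)).trans_lt hα]
  obtain ⟨β, hβ⟩ := hv.sobolev
  have e : α / 2 + 2 - 2 = α / 2 := by ring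
  have hess := hv.hessian
  rw [e] at hess
  intro t ψ
  have hi := integrable_duhamel hα hm hk t
  refine ⟨integrable_heatField_mul hi ψ, ?_⟩
  have hf := hasFourierFun_duhamel_of_solvesHeat hα0
    (fun t => exists_hasFourierFun_of_memSobolev (hβ t)) hess hsolve hm
    (memLp_of_fourierNormSq hα0 hm hk) hg t
  set H : Space d → ℂ := 𝓕⁻ fun ξ => duhamel k (t, ξ)
  have hHc : Continuous H := fourierInv_continuous hi
  have hvH : ∀ ψ : 𝓢(Space d, ℂ), v t ψ = ∫ x, H x * ψ x := fun ψ => by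
    rw [hf.apply_eq, SchwartzMap.fourierInv_coe, integral_mul_fourierInv hi ψ.integrable]
  -- A real distribution given by the continuous function `H` forces `H` to be real at every point;
  -- thus the real part in `heatField` loses nothing.
  have him : (fun x => (H x).im) = fun _ => 0 := by
    refine (Continuous.ae_eq_iff_eq volume (by fun_prop) continuous_const).1 ?_
    refine ae_eq_zero_of_integral_contDiff_smul_eq_zero
      (Continuous.locallyIntegrable (by fun_prop)) fun φ hφ hφc => ?_
    have hc : HasCompactSupport (Complex.ofRealCLM ∘ φ) := hφc.comp_left rfl
    have hd : ContDiff ℝ (⊤ : ℕ∞) (Complex.ofRealCLM ∘ φ) := Complex.ofRealCLM.contDiff.comp hφ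
    have h1 := hv.real t (hc.toSchwartzMap hd) fun x => by simp
    have h2 : Integrable fun x => H x * (hc.toSchwartzMap hd) x :=
      integrable_continuous_bounded_mul hHc (norm_fourierInv_le _) _
    rw [hvH] at h1
    have h3 := integral_im h2
    simp only [RCLike.im_eq_complex_im] at h3
    rw [h1] at h3
    rw [← h3]
    congr 1; ext x
    simp [mul_comm]
  rw [hvH]
  congr 1; ext x
  congr 1
  exact Complex.ext (by simp [heatField, H]) (by simpa using congrFun him x)

end Field

/-! ### The heat kernel and the Bessel kernel -/

section Kernels

variable {d : ℕ}

theorem heatKernel_nonneg (t : ℝ) (x : Space d) : 0 ≤ heatKernel t x := by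
  unfold heatKernel; split_ifs <;> positivity

theorem heatKernel_of_pos {t : ℝ} (ht : 0 < t) (x : Space d) :
    heatKernel t x = (4 * Real.pi * t) ^ (-(d : ℝ) / 2) * Real.exp (-‖x‖ ^ 2 / (4 * t)) :=
  if_pos ht

theorem heatKernel_neg (t : ℝ) (x : Space d) : heatKernel t (-x) = heatKernel t x := by
  simp [heatKernel]

theorem heatKernel_sub_comm (t : ℝ) (x y : Space d) :
    heatKernel t (x - y) = heatKernel t (y - x) := by
  rw [← heatKernel_neg, neg_sub]

theorem measurable_heatKernel : Measurable fun p : ℝ × Space d => heatKernel p.1 p.2 := by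
  unfold heatKernel
  exact Measurable.ite (measurableSet_lt measurable_const measurable_fst) (by fun_prop)
    measurable_const

@[fun_prop]
theorem measurable_heatKernel_comp {X : Type*} [MeasurableSpace X] {f : X → ℝ} {g : X → Space d}
    (hf : Measurable f) (hg : Measurable g) : Measurable fun z => heatKernel (f z) (g z) :=
  measurable_heatKernel.comp (hf.prodMk hg)

theorem integral_exp_neg_mul_norm_sub_sq {b : ℝ} (hb : 0 < b) (c : Space d) :
    ∫ z : Space d, Real.exp (-b * ‖z - c‖ ^ 2) = (Real.pi / b) ^ ((d : ℝ) / 2) := by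
  rw [integral_sub_right_eq_self (fun z : Space d => Real.exp (-b * ‖z‖ ^ 2)),
    GaussianFourier.integral_rexp_neg_mul_sq_norm hb]
  simp

theorem integrable_exp_neg_mul_norm_sq {b : ℝ} (hb : 0 < b) :
    Integrable fun z : Space d => Real.exp (-b * ‖z‖ ^ 2) := by
  have h := (GaussianFourier.integrable_cexp_neg_mul_sq_norm_add (V := Space d) (b := b)
    (by simpa using hb) 0 0).norm
  refine h.congr (Eventually.of_forall fun z => ?_)
  simp only [Complex.norm_exp]
  congr 1
  simp [← Complex.ofReal_pow, ← Complex.ofReal_mul, ← Complex.ofReal_neg]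

/-- Completing the square in `z`: the product is a Gaussian centred at the weighted mean of `x` and
`y`, times a factor free of `z`. -/
theorem heatKernel_mul_heatKernel {a b : ℝ} (ha : 0 < a) (hb : 0 < b) (x y z : Space d) :
    heatKernel a (x - z) * heatKernel b (z - y) =
      (4 * Real.pi * a) ^ (-(d : ℝ) / 2) * (4 * Real.pi * b) ^ (-(d : ℝ) / 2) *
        Real.exp (-‖x - y‖ ^ 2 / (4 * (a + b))) *
        Real.exp (-((a + b) / (4 * a * b)) *
          ‖z - ((b / (a + b)) • x + (a / (a + b)) • y)‖ ^ 2) := by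
  have hab : a + b ≠ 0 := by positivity
  have e1 : z - ((b / (a + b)) • x + (a / (a + b)) • y) =
      (a + b)⁻¹ • (a • (z - y) - b • (x - z)) := by
    have : z = (a + b)⁻¹ • (a + b) • z := by rw [smul_smul, inv_mul_cancel₀ hab, one_smul]
    conv_lhs => rw [this]
    rw [div_eq_inv_mul, div_eq_inv_mul]
    module
  have e2 : x - y = (x - z) + (z - y) := by abel
  rw [heatKernel_of_pos ha, heatKernel_of_pos hb, e1, e2]
  set p := x - z
  set q := z - y
  rw [mul_mul_mul_comm, ← Real.exp_add, mul_assoc ((4 * Real.pi * a) ^ (-(d : ℝ) / 2) * _),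
    ← Real.exp_add]
  congr 2
  rw [norm_smul (a + b)⁻¹, mul_pow, norm_sub_sq_real (a • q), norm_add_sq_real p q, norm_smul a,
    norm_smul b, inner_smul_left, inner_smul_right, real_inner_comm p q]
  simp only [Real.norm_eq_abs, mul_pow, sq_abs, conj_trivial]
  field_simp
  ring

theorem integrable_heatKernel_mul {a b : ℝ} (ha : 0 < a) (hb : 0 < b) (x y : Space d) :
    Integrable fun z => heatKernel a (x - z) * heatKernel b (z - y) := by
  simp only [heatKernel_mul_heatKernel ha hb]
  exact ((integrable_exp_neg_mul_norm_sq (by positivity)).comp_sub_right _).const_mul _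

theorem integral_heatKernel_mul {a b : ℝ} (ha : 0 < a) (hb : 0 < b) (x y : Space d) :
    ∫ z, heatKernel a (x - z) * heatKernel b (z - y) = heatKernel (a + b) (x - y) := by
  simp only [heatKernel_mul_heatKernel ha hb]
  rw [integral_const_mul, integral_exp_neg_mul_norm_sub_sq (by positivity),
    heatKernel_of_pos (by positivity), mul_right_comm]
  congr 1
  rw [neg_div, Real.rpow_neg (by positivity), Real.rpow_neg (by positivity),
    Real.rpow_neg (by positivity), ← Real.inv_rpow (by positivity), ← Real.inv_rpow (by positivity),
    ← Real.inv_rpow (by positivity), ← Real.mul_rpow (by positivity) (by positivity),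
    ← Real.mul_rpow (by positivity) (by positivity)]
  congr 1
  field_simp

/-- The semigroup property of the heat kernel. -/
theorem lintegral_heatKernel_mul {a b : ℝ} (ha : 0 < a) (hb : 0 < b) (x y : Space d) :
    ∫⁻ z, ENNReal.ofReal (heatKernel a (x - z)) * ENNReal.ofReal (heatKernel b (z - y)) =
      ENNReal.ofReal (heatKernel (a + b) (x - y)) := by
  simp only [← ENNReal.ofReal_mul (heatKernel_nonneg _ _)]
  rw [← integral_heatKernel_mul ha hb, ofReal_integral_eq_lintegral_ofReal
    (integrable_heatKernel_mul ha hb x y)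
    (Eventually.of_forall fun z => mul_nonneg (heatKernel_nonneg _ _) (heatKernel_nonneg _ _))]

theorem lintegral_heatKernel {a : ℝ} (ha : 0 < a) :
    ∫⁻ x : Space d, ENNReal.ofReal (heatKernel a x) = 1 := by
  have hb : (0 : ℝ) < 1 / (4 * a) := by positivity
  have e : ∀ x : Space d, heatKernel a x = (4 * Real.pi * a) ^ (-(d : ℝ) / 2) *
      Real.exp (-(1 / (4 * a)) * ‖x - 0‖ ^ 2) := fun x => by
    rw [heatKernel_of_pos ha, sub_zero]; congr 2; ring
  rw [← ofReal_integral_eq_lintegral_ofReal _ (Eventually.of_forall (heatKernel_nonneg a))]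
  · simp only [e]
    rw [integral_const_mul, integral_exp_neg_mul_norm_sub_sq hb, neg_div,
      Real.rpow_neg (by positivity), ← ENNReal.ofReal_one]
    congr 1
    rw [show Real.pi / (1 / (4 * a)) = 4 * Real.pi * a by field_simp]
    exact inv_mul_cancel₀ (by positivity)
  · rw [show heatKernel a = fun x : Space d => _ from funext e]
    simp only [sub_zero]
    exact (integrable_exp_neg_mul_norm_sq hb).const_mul _

theorem integrable_exp_neg_laplaceSymbol {a : ℝ} (ha : 0 < a) :
    Integrable fun ξ : Space d => Real.exp (-(a * laplaceSymbol ξ)) := by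
  refine (integrable_exp_neg_mul_norm_sq (d := d) (b := a * (2 * Real.pi) ^ 2)
    (by positivity)).congr (Eventually.of_forall fun ξ => ?_)
  simp only [laplaceSymbol]
  congr 1; ring

/-- The heat kernel as an inverse Fourier transform. -/
theorem heatKernel_eq_integral {a : ℝ} (ha : 0 < a) (x : Space d) :
    heatKernel a x =
      ∫ ξ, Real.exp (-(a * laplaceSymbol ξ)) * Real.cos (2 * Real.pi * inner ℝ ξ x) := by
  have hb : (0 : ℝ) < a * (2 * Real.pi) ^ 2 := by positivity
  have h := fourier_gaussian_innerProductSpace (V := Space d)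
    (b := ((a * (2 * Real.pi) ^ 2 : ℝ) : ℂ)) (by rw [Complex.ofReal_re]; exact hb) x
  rw [Real.fourier_eq'] at h
  have hi : Integrable fun v : Space d => Complex.exp ((-2 * Real.pi * inner ℝ v x : ℝ) * Complex.I)
      • Complex.exp (-((a * (2 * Real.pi) ^ 2 : ℝ) : ℂ) * ‖v‖ ^ 2) := by
    refine Integrable.bdd_mul (c := 1) ?_ (by fun_prop) (Eventually.of_forall fun ξ => by
      rw [Complex.norm_exp_ofReal_mul_I])
    refine (integrable_exp_neg_mul_norm_sq (d := d) hb).ofReal.congr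
      (Eventually.of_forall fun v => ?_)
    simp
  have h2 := congrArg Complex.re h
  rw [← RCLike.re_eq_complex_re, ← integral_re hi] at h2
  have e1 : ∀ v : Space d, RCLike.re (Complex.exp ((-2 * Real.pi * inner ℝ v x : ℝ) * Complex.I)
      • Complex.exp (-((a * (2 * Real.pi) ^ 2 : ℝ) : ℂ) * ‖v‖ ^ 2)) =
      Real.exp (-(a * laplaceSymbol v)) * Real.cos (2 * Real.pi * inner ℝ v x) := by
    intro v
    have : Complex.exp (-((a * (2 * Real.pi) ^ 2 : ℝ) : ℂ) * ‖v‖ ^ 2) =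
        ((Real.exp (-(a * laplaceSymbol v)) : ℝ) : ℂ) := by
      simp only [laplaceSymbol]
      push_cast
      congr 1; ring
    rw [this, smul_eq_mul, mul_comm, RCLike.re_eq_complex_re, Complex.re_ofReal_mul,
      Complex.exp_ofReal_mul_I_re, neg_mul, neg_mul, Real.cos_neg]
  simp only [e1] at h2
  rw [h2, heatKernel_of_pos ha]
  have e2 : ((Real.pi : ℂ) / ((a * (2 * Real.pi) ^ 2 : ℝ) : ℂ)) ^
      ((Module.finrank ℝ (Space d) : ℂ) / 2) * Complex.exp (-(Real.pi : ℂ) ^ 2 * ‖x‖ ^ 2 /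
        ((a * (2 * Real.pi) ^ 2 : ℝ) : ℂ)) =
      (((Real.pi / (a * (2 * Real.pi) ^ 2)) ^ ((d : ℝ) / 2) *
        Real.exp (-Real.pi ^ 2 * ‖x‖ ^ 2 / (a * (2 * Real.pi) ^ 2)) : ℝ) : ℂ) := by
    rw [Complex.ofReal_mul ((Real.pi / (a * (2 * Real.pi) ^ 2)) ^ ((d : ℝ) / 2)),
      Complex.ofReal_cpow (by positivity)]
    push_cast
    simp
  rw [e2, RCLike.re_eq_complex_re, Complex.ofReal_re, neg_div, Real.rpow_neg (by positivity),
    ← Real.inv_rpow (by positivity)]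
  have hp := Real.pi_pos
  congr 2 <;> (field_simp; try ring)

/-- The density of the Gamma distribution that mixes heat kernels to a Bessel kernel. -/
def gammaWeight (α τ : ℝ) : ℝ := (Real.Gamma (α / 2))⁻¹ * (τ ^ (α / 2 - 1) * Real.exp (-τ))

theorem gammaWeight_nonneg {α : ℝ} (hα : 0 < α) {τ : ℝ} (hτ : 0 < τ) : 0 ≤ gammaWeight α τ := by
  have := Real.Gamma_pos_of_pos (half_pos hα)
  unfold gammaWeight; positivity

@[fun_prop]
theorem measurable_gammaWeight (α : ℝ) : Measurable (gammaWeight α) := by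
  unfold gammaWeight; fun_prop

/-- The Laplace transform of the Gamma density; this is where the symbol of `(1-Δ)^{-α/2}` arises.
-/
theorem integral_gammaWeight_mul_exp {α : ℝ} (hα : 0 < α) {l : ℝ} (hl : 0 ≤ l) :
    ∫ τ in Ioi (0 : ℝ), gammaWeight α τ * Real.exp (-(τ * l)) = (1 + l) ^ (-(α / 2)) := by
  have h := Real.integral_rpow_mul_exp_neg_mul_Ioi (half_pos hα) (r := 1 + l) (by linarith)
  have e : ∀ τ : ℝ, gammaWeight α τ * Real.exp (-(τ * l)) =
      (Real.Gamma (α / 2))⁻¹ * (τ ^ (α / 2 - 1) * Real.exp (-((1 + l) * τ))) := fun τ => by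
    rw [gammaWeight, mul_assoc, mul_assoc, ← Real.exp_add]
    congr 3; ring
  simp only [e]
  rw [integral_const_mul, h, Real.rpow_neg (by linarith), one_div, Real.inv_rpow (by linarith)]
  have := Real.Gamma_pos_of_pos (half_pos hα)
  field_simp

theorem integrable_gammaWeight {α : ℝ} (hα : 0 < α) :
    IntegrableOn (gammaWeight α) (Ioi 0) := by
  have := (Real.GammaIntegral_convergent (half_pos hα)).const_mul (Real.Gamma (α / 2))⁻¹
  refine this.congr (Eventually.of_forall fun τ => ?_)
  simp only [gammaWeight]; ring

theorem lintegral_gammaWeight_mul_exp {α : ℝ} (hα : 0 < α) {l : ℝ} (hl : 0 ≤ l) :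
    ∫⁻ τ in Ioi (0 : ℝ), ENNReal.ofReal (gammaWeight α τ) * ENNReal.ofReal (Real.exp (-(τ * l))) =
      ENNReal.ofReal ((1 + l) ^ (-(α / 2))) := by
  rw [← integral_gammaWeight_mul_exp hα hl, ofReal_integral_eq_lintegral_ofReal]
  · refine setLIntegral_congr_fun measurableSet_Ioi fun τ hτ => ?_
    rw [ENNReal.ofReal_mul (gammaWeight_nonneg hα hτ)]
  · refine (integrable_gammaWeight hα).mul_bdd (c := 1) (by fun_prop) ?_
    filter_upwards [ae_restrict_mem measurableSet_Ioi] with τ hτ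
    rw [Real.norm_eq_abs, Real.abs_exp, Real.exp_le_one_iff]
    have : 0 < τ := hτ
    nlinarith
  · filter_upwards [ae_restrict_mem measurableSet_Ioi] with τ hτ
    exact mul_nonneg (gammaWeight_nonneg hα hτ) (Real.exp_pos _).le

theorem lintegral_gammaWeight {α : ℝ} (hα : 0 < α) :
    ∫⁻ τ in Ioi (0 : ℝ), ENNReal.ofReal (gammaWeight α τ) = 1 := by
  simpa using lintegral_gammaWeight_mul_exp hα le_rfl

theorem besselKernel_eq_integral {α : ℝ} (x : Space d) :
    besselKernel d α x = ∫ τ in Ioi (0 : ℝ), gammaWeight α τ * heatKernel τ x := by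
  rw [besselKernel, ← integral_const_mul]
  refine setIntegral_congr_fun measurableSet_Ioi fun τ hτ => ?_
  have hτ : 0 < τ := hτ
  simp only [gammaWeight]
  rw [heatKernel_of_pos hτ, mul_inv, sub_eq_add_neg (-τ), Real.exp_add, neg_div, neg_div,
    Real.mul_rpow (by positivity) hτ.le, Real.rpow_neg (by positivity) ((d : ℝ) / 2),
    show (α - d) / 2 - 1 = (α / 2 - 1) + -((d : ℝ) / 2) by ring, Real.rpow_add hτ]
  ring

theorem besselKernel_nonneg {α : ℝ} (hα : 0 < α) (x : Space d) : 0 ≤ besselKernel d α x := by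
  rw [besselKernel_eq_integral]
  exact setIntegral_nonneg measurableSet_Ioi fun τ hτ =>
    mul_nonneg (gammaWeight_nonneg hα hτ) (heatKernel_nonneg _ _)

@[fun_prop]
theorem measurable_besselKernel (α : ℝ) : Measurable (besselKernel d α) := by
  have : besselKernel d α = fun x => ∫ τ in Ioi (0 : ℝ), gammaWeight α τ * heatKernel τ x :=
    funext fun x => besselKernel_eq_integral x
  rw [this]
  exact (StronglyMeasurable.integral_prod_right (f := fun (x : Space d) τ =>
    gammaWeight α τ * heatKernel τ x) (Measurable.stronglyMeasurable (by fun_prop))).measurable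

/-- The Bessel kernel is a mixture of heat kernels. -/
theorem ae_besselKernel_eq {α : ℝ} (hα : 0 < α) :
    ∀ᵐ x : Space d, ENNReal.ofReal (besselKernel d α x) =
      ∫⁻ τ in Ioi (0 : ℝ), ENNReal.ofReal (gammaWeight α τ) * ENNReal.ofReal (heatKernel τ x) := by
  have hm : Measurable fun p : Space d × ℝ =>
      ENNReal.ofReal (gammaWeight α p.2) * ENNReal.ofReal (heatKernel p.2 p.1) := by fun_prop
  -- The mixture has total mass 1, hence is finite almost everywhere. Where it diverges, as at the
  -- origin for `α ≤ d`, the Bochner integral in `besselKernel` is 0 and the identity fails.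
  have h1 : ∫⁻ x : Space d, ∫⁻ τ in Ioi (0 : ℝ),
      ENNReal.ofReal (gammaWeight α τ) * ENNReal.ofReal (heatKernel τ x) = 1 := by
    rw [lintegral_lintegral_swap hm.aemeasurable, ← lintegral_gammaWeight hα]
    refine setLIntegral_congr_fun measurableSet_Ioi fun τ hτ => ?_
    rw [lintegral_const_mul _ (by fun_prop), lintegral_heatKernel hτ, mul_one]
  have h2 := ae_lt_top (Measurable.lintegral_prod_right hm) (h1.trans_lt ENNReal.one_lt_top).ne
  filter_upwards [h2] with x hx
  have e : ∀ᵐ τ ∂(volume.restrict (Ioi (0 : ℝ))), ENNReal.ofReal (gammaWeight α τ) *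
      ENNReal.ofReal (heatKernel τ x) = ENNReal.ofReal (gammaWeight α τ * heatKernel τ x) := by
    filter_upwards [ae_restrict_mem measurableSet_Ioi] with τ hτ
    rw [ENNReal.ofReal_mul (gammaWeight_nonneg hα hτ)]
  have hnn : 0 ≤ᵐ[volume.restrict (Ioi (0 : ℝ))] fun τ => gammaWeight α τ * heatKernel τ x := by
    filter_upwards [ae_restrict_mem measurableSet_Ioi] with τ hτ
    exact mul_nonneg (gammaWeight_nonneg hα hτ) (heatKernel_nonneg _ _)
  rw [lintegral_congr_ae e] at hx ⊢
  rw [besselKernel_eq_integral, ofReal_integral_eq_lintegral_ofReal _ hnn]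
  exact ⟨Measurable.aestronglyMeasurable (by fun_prop),
    (hasFiniteIntegral_iff_ofReal hnn).2 hx⟩

theorem ae_besselKernel_sub_eq {α : ℝ} (hα : 0 < α) (x : Space d) :
    ∀ᵐ y : Space d, ENNReal.ofReal (besselKernel d α (x - y)) =
      ∫⁻ τ in Ioi (0 : ℝ), ENNReal.ofReal (gammaWeight α τ) *
        ENNReal.ofReal (heatKernel τ (x - y)) :=
  (Measure.measurePreserving_sub_left volume x).quasiMeasurePreserving.ae (ae_besselKernel_eq hα)

end Kernels

/-! ### The energy of the Bessel kernel -/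

section Energy

variable {d : ℕ}

theorem lintegral_lintegral_lintegral_lintegral_swap {X Y W Z : Type*} [MeasurableSpace X]
    [MeasurableSpace Y] [MeasurableSpace W] [MeasurableSpace Z] {μ : Measure X} {ν : Measure Y}
    {κ : Measure W} {ρ : Measure Z} [SFinite μ] [SFinite ν] [SFinite κ] [SFinite ρ]
    {F : (X × Y) × (W × Z) → ℝ≥0∞} (hF : Measurable F) :
    ∫⁻ x, ∫⁻ y, ∫⁻ w, ∫⁻ z, F ((x, y), (w, z)) ∂ρ ∂κ ∂ν ∂μ =
      ∫⁻ w, ∫⁻ z, ∫⁻ x, ∫⁻ y, F ((x, y), (w, z)) ∂ν ∂μ ∂ρ ∂κ := by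
  have h1 : ∀ p : X × Y, ∫⁻ w, ∫⁻ z, F (p, (w, z)) ∂ρ ∂κ = ∫⁻ q, F (p, q) ∂(κ.prod ρ) :=
    fun p => (lintegral_prod (fun q => F (p, q)) (by fun_prop)).symm
  have h2 : ∀ q : W × Z, ∫⁻ x, ∫⁻ y, F ((x, y), q) ∂ν ∂μ = ∫⁻ p, F (p, q) ∂(μ.prod ν) :=
    fun q => (lintegral_prod (fun p => F (p, q)) (by fun_prop)).symm
  simp only [h1, h2]
  rw [← lintegral_prod (fun p => ∫⁻ q, F (p, q) ∂(κ.prod ρ))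
      (Measurable.lintegral_prod_right' hF).aemeasurable,
    ← lintegral_prod (fun q => ∫⁻ p, F (p, q) ∂(μ.prod ν))
      (Measurable.lintegral_prod_left' hF).aemeasurable,
    lintegral_lintegral_swap (f := fun p q => F (p, q)) hF.aemeasurable]

/-- The mutual energy `∫∫ A(x) B_α(x-y) B(y) dy dx` of two nonnegative functions. -/
def energy (α : ℝ) (A B : Space d → ℝ≥0∞) : ℝ≥0∞ :=
  ∫⁻ x, ∫⁻ y, A x * ENNReal.ofReal (besselKernel d α (x - y)) * B y

/-- The heat flow at time `τ` of a nonnegative function. -/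
def heatFlow (τ : ℝ) (A : Space d → ℝ≥0∞) (z : Space d) : ℝ≥0∞ :=
  ∫⁻ x, A x * ENNReal.ofReal (heatKernel τ (x - z))

theorem measurable_heatFlow {A : Space d → ℝ≥0∞} (hA : Measurable A) :
    Measurable fun p : ℝ × Space d => heatFlow p.1 A p.2 :=
  Measurable.lintegral_prod_right' (f := fun p : (ℝ × Space d) × Space d =>
    A p.2 * ENNReal.ofReal (heatKernel p.1.1 (p.2 - p.1.2))) (by fun_prop)

@[fun_prop]
theorem measurable_heatFlow_comp {A : Space d → ℝ≥0∞} (hA : Measurable A) {X : Type*}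
    [MeasurableSpace X] {f : X → ℝ} {g : X → Space d} (hf : Measurable f) (hg : Measurable g) :
    Measurable fun z => heatFlow (f z) A (g z) :=
  (measurable_heatFlow hA).comp (hf.prodMk hg)

/-- The energy is a mixture of inner products of heat flows. -/
theorem energy_eq {α : ℝ} (hα : 0 < α) {A B : Space d → ℝ≥0∞} (hA : Measurable A)
    (hB : Measurable B) : energy α A B = ∫⁻ τ in Ioi (0 : ℝ), ENNReal.ofReal (gammaWeight α τ) *
      ∫⁻ z, heatFlow (τ / 2) A z * heatFlow (τ / 2) B z := by
  -- The semigroup property splits the heat kernel at time `τ` through an intermediate point `z`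
  -- into two at time `τ/2`; Tonelli then gathers one heat flow for each function.
  set F : (Space d × Space d) × (ℝ × Space d) → ℝ≥0∞ := fun p =>
    A p.1.1 * (ENNReal.ofReal (gammaWeight α p.2.1) *
      (ENNReal.ofReal (heatKernel (p.2.1 / 2) (p.1.1 - p.2.2)) *
        ENNReal.ofReal (heatKernel (p.2.1 / 2) (p.2.2 - p.1.2)))) * B p.1.2
  have hF : Measurable F := by fun_prop
  have e1 : energy α A B = ∫⁻ x, ∫⁻ y, ∫⁻ τ in Ioi (0 : ℝ), ∫⁻ z, F ((x, y), (τ, z)) := by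
    refine lintegral_congr fun x => lintegral_congr_ae ?_
    filter_upwards [ae_besselKernel_sub_eq hα x] with y hy
    rw [hy, ← lintegral_const_mul _ (by fun_prop), ← lintegral_mul_const _ (by fun_prop)]
    refine setLIntegral_congr_fun measurableSet_Ioi fun τ hτ => ?_
    have hτ : 0 < τ / 2 := half_pos hτ
    simp only [F]
    rw [lintegral_mul_const _ (by fun_prop), lintegral_const_mul _ (by fun_prop),
      lintegral_const_mul _ (by fun_prop), lintegral_heatKernel_mul hτ hτ, add_halves]
  rw [e1, lintegral_lintegral_lintegral_lintegral_swap hF]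
  refine lintegral_congr fun τ => ?_
  rw [← lintegral_const_mul _ (by fun_prop)]
  refine lintegral_congr fun z => ?_
  simp only [F, heatFlow]
  rw [← lintegral_mul_const _ (by fun_prop), ← lintegral_const_mul _ (by fun_prop)]
  refine lintegral_congr fun x => ?_
  rw [← mul_assoc, mul_comm, ← lintegral_mul_const _ (by fun_prop)]
  refine lintegral_congr fun y => ?_
  rw [heatKernel_sub_comm _ z y]
  ring

/-- Without subtraction, the larger number is written as the smaller one plus `c`; the difference of
the two sides is then `c * c`. -/
theorem ennreal_mul_add_mul_le (X Y : ℝ≥0∞) : X * Y + Y * X ≤ X * X + Y * Y := by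
  rcases le_total X Y with h | h <;> obtain ⟨c, rfl⟩ := exists_add_of_le h
  · calc X * (X + c) + (X + c) * X = X * X + X * X + X * c + c * X := by ring
      _ ≤ X * X + X * X + X * c + c * X + c * c := le_self_add
      _ = _ := by ring
  · calc (Y + c) * Y + Y * (Y + c) = Y * Y + Y * Y + Y * c + c * Y := by ring
      _ ≤ Y * Y + Y * Y + Y * c + c * Y + c * c := le_self_add
      _ = _ := by ring

/-- Positive definiteness of the Bessel kernel, in a form that allows infinite energies: `energy_eq`
reduces it to `2XY ≤ X² + Y²` at each point. It stands in for Cauchy–Schwarz below. -/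
theorem energy_add_energy_le {α : ℝ} (hα : 0 < α) {A B : Space d → ℝ≥0∞} (hA : Measurable A)
    (hB : Measurable B) : energy α A B + energy α B A ≤ energy α A A + energy α B B := by
  simp only [energy_eq hα hA hB, energy_eq hα hB hA, energy_eq hα hA hA, energy_eq hα hB hB]
  have hm : ∀ {A B : Space d → ℝ≥0∞}, Measurable A → Measurable B → Measurable fun τ : ℝ =>
      ENNReal.ofReal (gammaWeight α τ) * ∫⁻ z, heatFlow (τ / 2) A z * heatFlow (τ / 2) B z :=
    fun hA hB => Measurable.mul (by fun_prop)
      (Measurable.lintegral_prod_right (by fun_prop))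
  rw [← lintegral_add_left (hm hA hB), ← lintegral_add_left (hm hA hA)]
  refine lintegral_mono fun τ => ?_
  rw [← mul_add, ← mul_add, ← lintegral_add_left (by fun_prop), ← lintegral_add_left (by fun_prop)]
  refine mul_le_mul' le_rfl (lintegral_mono fun z => ?_)
  exact ennreal_mul_add_mul_le _ _

theorem measurable_energy_integrand (α : ℝ) {A B : Space d → ℝ≥0∞} (hA : Measurable A)
    (hB : Measurable B) : Measurable fun p : Space d × Space d =>
      A p.1 * ENNReal.ofReal (besselKernel d α (p.1 - p.2)) * B p.2 := by fun_prop

theorem energy_eq_prod (α : ℝ) {A B : Space d → ℝ≥0∞} (hA : Measurable A) (hB : Measurable B) :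
    energy α A B = ∫⁻ p : Space d × Space d,
      A p.1 * ENNReal.ofReal (besselKernel d α (p.1 - p.2)) * B p.2 := by
  rw [Measure.volume_eq_prod, lintegral_prod _ (measurable_energy_integrand α hA hB).aemeasurable]
  rfl

theorem energy_mono (α : ℝ) {A A' B B' : Space d → ℝ≥0∞} (hA : A ≤ A') (hB : B ≤ B') :
    energy α A B ≤ energy α A' B' :=
  lintegral_mono fun x => lintegral_mono fun y =>
    mul_le_mul' (mul_le_mul' (hA x) le_rfl) (hB y)

theorem energy_add_self_le {α : ℝ} (hα : 0 < α) {A B : Space d → ℝ≥0∞} (hA : Measurable A)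
    (hB : Measurable B) :
    energy α (A + B) (A + B) ≤ 2 * energy α A A + 2 * energy α B B := by
  have e : energy α (A + B) (A + B) =
      energy α A A + energy α A B + (energy α B A + energy α B B) := by
    rw [energy_eq_prod α (hA.add hB) (hA.add hB), energy_eq_prod α hA hA, energy_eq_prod α hA hB,
      energy_eq_prod α hB hA, energy_eq_prod α hB hB,
      ← lintegral_add_left (measurable_energy_integrand α hA hA),
      ← lintegral_add_left (measurable_energy_integrand α hB hA),
      ← lintegral_add_left (by fun_prop)]
    refine lintegral_congr fun p => ?_
    simp only [Pi.add_apply]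
    ring
  rw [e]
  calc energy α A A + energy α A B + (energy α B A + energy α B B)
      = (energy α A B + energy α B A) + (energy α A A + energy α B B) := by ring
    _ ≤ (energy α A A + energy α B B) + (energy α A A + energy α B B) := by
        exact add_le_add (energy_add_energy_le hα hA hB) le_rfl
    _ = _ := by ring

/-- The mutual energy of two heat kernels, on the Fourier side. -/
def heatEnergy (α c : ℝ) (w : Space d) : ℝ :=
  ∫ ξ, Real.exp (-(c * laplaceSymbol ξ)) * (1 + laplaceSymbol ξ) ^ (-(α / 2)) *
    Real.cos (2 * Real.pi * inner ℝ ξ w)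

/-- Fubini in `τ` and `ξ`. Since `c > 0`, the factor `e^{-c l}` makes the double integral absolutely
convergent for every `α > 0`. -/
theorem integrable_gammaWeight_mul_heatKernel {α : ℝ} (hα : 0 < α) {c : ℝ} (hc : 0 < c)
    (w : Space d) :
    IntegrableOn (fun τ => gammaWeight α τ * heatKernel (c + τ) w) (Ioi 0) ∧
      ∫ τ in Ioi (0 : ℝ), gammaWeight α τ * heatKernel (c + τ) w = heatEnergy α c w := by
  set F : ℝ × Space d → ℝ := fun p => gammaWeight α p.1 * Real.exp (-(c * laplaceSymbol p.2)) *
    (Real.exp (-(p.1 * laplaceSymbol p.2)) * Real.cos (2 * Real.pi * inner ℝ p.2 w))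
  have hF : Integrable F ((volume.restrict (Ioi 0)).prod volume) := by
    have h1 : Integrable (fun p : ℝ × Space d =>
        gammaWeight α p.1 * Real.exp (-(c * laplaceSymbol p.2)))
        ((volume.restrict (Ioi 0)).prod volume) :=
      Integrable.mul_prod (integrable_gammaWeight hα) (integrable_exp_neg_laplaceSymbol hc)
    refine h1.mul_bdd (c := 1) (Measurable.aestronglyMeasurable (by fun_prop)) ?_
    have h2 : ∀ᵐ p ∂((volume.restrict (Ioi (0 : ℝ))).prod (volume : Measure (Space d))),
        p.1 ∈ Ioi (0 : ℝ) :=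
      Measure.quasiMeasurePreserving_fst.ae (ae_restrict_mem measurableSet_Ioi)
    filter_upwards [h2] with p hp
    rw [norm_mul, Real.norm_eq_abs, Real.norm_eq_abs, Real.abs_exp]
    refine mul_le_one₀ (Real.exp_le_one_iff.2 ?_) (abs_nonneg _) (Real.abs_cos_le_one _)
    have : 0 < p.1 := hp
    nlinarith [laplaceSymbol_nonneg p.2]
  have e : ∀ τ ∈ Ioi (0 : ℝ), ∫ ξ, F (τ, ξ) = gammaWeight α τ * heatKernel (c + τ) w := by
    intro τ hτ
    have hτ : 0 < τ := hτ
    rw [heatKernel_eq_integral (by positivity), ← integral_const_mul]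
    congr 1; ext ξ
    simp only [F]
    rw [add_mul, neg_add, Real.exp_add]
    ring
  have hi := hF.integral_prod_left
  refine ⟨hi.congr ((ae_restrict_mem measurableSet_Ioi).mono e), ?_⟩
  rw [← setIntegral_congr_fun measurableSet_Ioi e]
  rw [integral_integral_swap (f := fun τ ξ => F (τ, ξ)) hF, heatEnergy]
  congr 1; ext ξ
  rw [← integral_gammaWeight_mul_exp hα (laplaceSymbol_nonneg ξ), ← integral_const_mul,
    ← integral_mul_const]
  congr 1; ext τ
  simp only [F]
  ring

/-- Invisible on the Fourier side because of the cosine; it is read off from the mixture of heat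
kernels. -/
theorem heatEnergy_nonneg {α : ℝ} (hα : 0 < α) {c : ℝ} (hc : 0 < c) (w : Space d) :
    0 ≤ heatEnergy α c w := by
  rw [← (integrable_gammaWeight_mul_heatKernel hα hc w).2]
  exact setIntegral_nonneg measurableSet_Ioi fun τ hτ =>
    mul_nonneg (gammaWeight_nonneg hα hτ) (heatKernel_nonneg _ _)

theorem heatFlow_heatKernel {τ a : ℝ} (hτ : 0 < τ) (ha : 0 < a) (x z : Space d) :
    heatFlow τ (fun y => ENNReal.ofReal (heatKernel a (x - y))) z =
      ENNReal.ofReal (heatKernel (a + τ) (x - z)) :=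
  lintegral_heatKernel_mul ha hτ x z

/-- Heat flows of heat kernels are heat kernels at times `a + τ/2` and `b + τ/2`, and their inner
product is the heat kernel at time `a + b + τ`. -/
theorem energy_heatKernel {α : ℝ} (hα : 0 < α) {a b : ℝ} (ha : 0 < a) (hb : 0 < b)
    (x x' : Space d) :
    energy α (fun y => ENNReal.ofReal (heatKernel a (x - y)))
      (fun y => ENNReal.ofReal (heatKernel b (x' - y))) =
      ENNReal.ofReal (heatEnergy α (a + b) (x - x')) := by
  have hab : 0 < a + b := by positivity
  obtain ⟨h1, h2⟩ := integrable_gammaWeight_mul_heatKernel hα hab (x - x')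
  rw [energy_eq hα (by fun_prop) (by fun_prop), ← h2, ofReal_integral_eq_lintegral_ofReal h1]
  · refine setLIntegral_congr_fun measurableSet_Ioi fun τ hτ => ?_
    have hτ2 : 0 < τ / 2 := half_pos hτ
    have hτ : 0 < τ := hτ
    rw [ENNReal.ofReal_mul (gammaWeight_nonneg hα hτ)]
    congr 1
    simp only [heatFlow_heatKernel hτ2 ha, heatFlow_heatKernel hτ2 hb]
    simp only [heatKernel_sub_comm _ x']
    rw [lintegral_heatKernel_mul (by positivity) (by positivity)]
    congr 2; ring
  · filter_upwards [ae_restrict_mem measurableSet_Ioi] with τ hτ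
    exact mul_nonneg (gammaWeight_nonneg hα hτ) (heatKernel_nonneg _ _)

end Energy

/-! ### The solution on the Fourier side -/

section Frequency

variable {d : ℕ} {T : ℝ}

/-- The Fourier side version of the random variable `u(t,x)`. -/
def heatFreq (α : ℝ) (t : Time T) (x : Space d) (z : Time T × Space d) : ℂ :=
  if z.1 ≤ t then
    (Real.exp (-(laplaceSymbol z.2 * ((t : ℝ) - z.1))) *
      (1 + laplaceSymbol z.2) ^ (-(α / 4)) : ℝ) *
      Complex.exp ((-(2 * Real.pi * inner ℝ z.2 x) : ℝ) * Complex.I)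
  else 0

theorem measurable_heatFreq (α : ℝ) (t : Time T) (x : Space d) : Measurable (heatFreq α t x) := by
  unfold heatFreq
  exact Measurable.ite (measurableSet_le (f := fun z : Time T × Space d => z.1) (g := fun _ => t)
    measurable_fst measurable_const) (by fun_prop) measurable_const

theorem rpow_neg_quarter_sq {α : ℝ} {l : ℝ} (hl : 0 ≤ l) :
    (1 + l) ^ (-(α / 4)) * (1 + l) ^ (-(α / 4)) = (1 + l) ^ (-(α / 2)) := by
  rw [← Real.rpow_add (by linarith)]; congr 1; ring

/-- The real inner product on `ℂ` is the real part of the Hermitian one, so the phases combine to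
the cosine in `heatEnergy`. -/
theorem inner_heatFreq (α : ℝ) (t t' : Time T) (x x' : Space d) (s : Time T) (ξ : Space d) :
    inner ℝ (heatFreq α t x (s, ξ)) (heatFreq α t' x' (s, ξ)) =
      if s ≤ t ∧ s ≤ t' then
        Real.exp (-(((t : ℝ) - s + (t' - s)) * laplaceSymbol ξ)) *
          (1 + laplaceSymbol ξ) ^ (-(α / 2)) * Real.cos (2 * Real.pi * inner ℝ ξ (x - x'))
      else 0 := by
  by_cases h1 : s ≤ t
  · by_cases h2 : s ≤ t'
    · rw [if_pos ⟨h1, h2⟩, ← rpow_neg_quarter_sq (laplaceSymbol_nonneg ξ)]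
      simp only [heatFreq, if_pos h1, if_pos h2]
      rw [Complex.inner, map_mul, Complex.conj_ofReal, ← Complex.exp_conj, map_mul,
        Complex.conj_ofReal, Complex.conj_I, mul_mul_mul_comm, ← Complex.ofReal_mul,
        ← Complex.exp_add, Complex.re_ofReal_mul,
        show ((-(2 * Real.pi * inner ℝ ξ x') : ℝ) : ℂ) * Complex.I +
          ((-(2 * Real.pi * inner ℝ ξ x) : ℝ) : ℂ) * -Complex.I =
          ((2 * Real.pi * inner ℝ ξ (x - x') : ℝ) : ℂ) * Complex.I by
            rw [inner_sub_right]; push_cast; ring,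
        Complex.exp_ofReal_mul_I_re,
        show -(((t : ℝ) - s + (t' - s)) * laplaceSymbol ξ) =
          -(laplaceSymbol ξ * ((t : ℝ) - s)) + -(laplaceSymbol ξ * ((t' : ℝ) - s)) by ring,
        Real.exp_add]
      ring
    · rw [if_neg (fun h => h2 h.2)]
      simp [heatFreq, h2]
  · rw [if_neg (fun h => h1 h.1)]
    simp [heatFreq, h1]

theorem enorm_heatFreq_sq (α : ℝ) (t : Time T) (x : Space d) (s : Time T) (ξ : Space d) :
    ‖heatFreq α t x (s, ξ)‖ₑ ^ 2 = if s ≤ t then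
      ENNReal.ofReal (Real.exp (-(((t : ℝ) - s + (t - s)) * laplaceSymbol ξ)) *
          (1 + laplaceSymbol ξ) ^ (-(α / 2))) else 0 := by
  have h := inner_heatFreq α t t x x s ξ
  rw [real_inner_self_eq_norm_sq] at h
  rw [← ofReal_norm, ← ENNReal.ofReal_pow (norm_nonneg _), h]
  by_cases hs : s ≤ t <;> simp [hs]

/-- The time integral of the exponential gains `1/(1+l)`, leaving the weight `(1+l)^{-1-α/2}`,
integrable because `α > d - 2`. -/
theorem lintegral_heatFreq_lt_top {α : ℝ} (hα : max 0 ((d : ℝ) - 2) < α) (t : Time T)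
    (x : Space d) : ∫⁻ z, ‖heatFreq α t x z‖ₑ ^ 2 < ∞ := by
  have hm := measurable_heatFreq α t x
  rw [Measure.volume_eq_prod, lintegral_prod_symm _ (by fun_prop)]
  have h0 : (0 : ℝ) ≤ T := t.2.1.trans t.2.2
  have hw := (integrable_weight (d := d) (r := 1 + α / 2)
    (by linarith [(le_max_right _ _).trans_lt hα])).const_mul (T + 1)
  refine lt_of_le_of_lt ?_ hw.lintegral_lt_top
  refine lintegral_mono fun ξ => ?_
  have hl := laplaceSymbol_nonneg ξ
  calc ∫⁻ s, ‖heatFreq α t x (s, ξ)‖ₑ ^ 2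
      ≤ ∫⁻ s, (Iic t).indicator (fun s => ENNReal.ofReal
          (Real.exp (-(laplaceSymbol ξ * ((t : ℝ) - s))))) s *
          ENNReal.ofReal ((1 + laplaceSymbol ξ) ^ (-(α / 2))) := by
        refine lintegral_mono fun s => ?_
        rw [enorm_heatFreq_sq]
        by_cases hs : s ≤ t
        · rw [if_pos hs, indicator_of_mem (by exact hs), ENNReal.ofReal_mul (Real.exp_pos _).le]
          refine mul_le_mul' (ENNReal.ofReal_le_ofReal (Real.exp_le_exp.2 ?_)) le_rfl
          have : (s : ℝ) ≤ t := hs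
          nlinarith
        · rw [if_neg hs]; exact zero_le
    _ ≤ ENNReal.ofReal ((T + 1) / (1 + laplaceSymbol ξ)) *
          ENNReal.ofReal ((1 + laplaceSymbol ξ) ^ (-(α / 2))) := by
        rw [lintegral_mul_const _ (Measurable.indicator (by fun_prop) measurableSet_Iic),
          lintegral_indicator measurableSet_Iic]
        exact mul_le_mul' (lintegral_Iic_exp_le_div hl t) le_rfl
    _ = _ := by
        rw [← ENNReal.ofReal_mul (by positivity), div_eq_mul_inv, mul_assoc, neg_add,
          Real.rpow_add (by linarith), Real.rpow_neg_one]

theorem memLp_heatFreq {α : ℝ} (hα : max 0 ((d : ℝ) - 2) < α) (t : Time T) (x : Space d) :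
    MemLp (heatFreq α t x) 2 :=
  memLp_two_of_lintegral_sq (measurable_heatFreq α t x).aestronglyMeasurable
    (lintegral_heatFreq_lt_top hα t x)

/-- The Fourier side version of `u(t,x)` in `L²`. -/
def heatFreqL2 {α : ℝ} (hα : max 0 ((d : ℝ) - 2) < α) (z : Time T × Space d) :
    Lp ℂ 2 (volume : Measure (Time T × Space d)) :=
  (memLp_heatFreq hα z.1 z.2).toLp _

theorem inner_heatFreqL2 {α : ℝ} (hα : max 0 ((d : ℝ) - 2) < α) (t t' : Time T)
    (x x' : Space d) : inner ℝ (heatFreqL2 hα (t, x)) (heatFreqL2 hα (t', x')) =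
      ∫ s : Time T, if s ≤ t ∧ s ≤ t' then heatEnergy α ((t : ℝ) - s + (t' - s)) (x - x')
        else 0 := by
  have h1 := memLp_heatFreq hα t x
  have h2 := memLp_heatFreq hα t' x'
  have hi : Integrable fun z => inner ℝ (heatFreq α t x z) (heatFreq α t' x' z) := by
    have h := L2.integrable_inner (𝕜 := ℝ) (h1.toLp _) (h2.toLp _)
    refine h.congr ?_
    filter_upwards [h1.coeFn_toLp, h2.coeFn_toLp] with z e1 e2
    rw [e1, e2]
  rw [L2.inner_def]
  have e : ∫ z, inner ℝ (heatFreqL2 hα (t, x) z) (heatFreqL2 hα (t', x') z) =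
      ∫ z, inner ℝ (heatFreq α t x z) (heatFreq α t' x' z) := by
    refine integral_congr_ae ?_
    filter_upwards [h1.coeFn_toLp, h2.coeFn_toLp] with z e1 e2
    simp only [heatFreqL2]
    rw [e1, e2]
  rw [e, Measure.volume_eq_prod, integral_prod _ hi]
  congr 1; ext s
  simp only [inner_heatFreq]
  split_ifs with h
  · rfl
  · simp

/-- The source on the Fourier side given by an element of `L²`. -/
def freqSource (α : ℝ) (y : Time T × Space d → ℂ) (z : Time T × Space d) : ℂ :=
  ((1 + laplaceSymbol z.2) ^ (-(α / 4)) : ℝ) * y z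

theorem fourierNormSq_freqSource {α : ℝ} {y : Time T × Space d → ℂ} (hy : Measurable y) :
    fourierNormSq (α / 2) (freqSource α y) = ∫⁻ z, ‖y z‖ₑ ^ 2 := by
  rw [fourierNormSq_eq_prod _ (by unfold freqSource; fun_prop)]
  refine lintegral_congr fun z => ?_
  have hl := laplaceSymbol_nonneg z.2
  rw [freqSource, enorm_mul, mul_pow, ← ofReal_norm (Complex.ofReal _), Complex.norm_real,
    Real.norm_eq_abs, abs_of_nonneg (by positivity), ← ENNReal.ofReal_pow (by positivity), sq,
    rpow_neg_quarter_sq hl, mul_right_comm, ← ENNReal.ofReal_mul (by positivity),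
    ← Real.rpow_add (by linarith)]
  simp

/-- The cutoff and the exponential of `heatFreq` form the Duhamel kernel, its conjugated phase is
that of the inverse Fourier transform, and the real inner product yields the real part in
`heatField`. -/
theorem inner_heatFreqL2_eq {α : ℝ} (hα : max 0 ((d : ℝ) - 2) < α) (t : Time T) (x : Space d)
    (Y : Lp ℂ 2 (volume : Measure (Time T × Space d))) {y : Time T × Space d → ℂ}
    (hYy : Y =ᵐ[volume] y) :
    inner ℝ (heatFreqL2 hα (t, x)) Y = heatField (freqSource α y) t x := by
  have h1 := memLp_heatFreq hα t x
  have hy : MemLp y 2 := (memLp_congr_ae hYy).1 (Lp.memLp Y)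
  have hc : MemLp (fun z => starRingEnd ℂ (heatFreq α t x z)) 2 :=
    h1.congr_norm (Complex.continuous_conj.comp_aestronglyMeasurable h1.1)
      (Eventually.of_forall fun z => (RCLike.norm_conj _).symm)
  have hi : Integrable fun z => y z * starRingEnd ℂ (heatFreq α t x z) := hy.integrable_mul hc
  rw [L2.inner_def]
  have e : ∫ z, inner ℝ (heatFreqL2 hα (t, x) z) (Y z) =
      (∫ z, y z * starRingEnd ℂ (heatFreq α t x z)).re := by
    rw [← RCLike.re_eq_complex_re, ← integral_re hi]
    refine integral_congr_ae ?_
    filter_upwards [h1.coeFn_toLp, hYy] with z e1 e2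
    simp only [heatFreqL2]
    rw [e1, e2, Complex.inner, mul_comm]
    rfl
  rw [e, heatField, Measure.volume_eq_prod, integral_prod_symm _ hi, Real.fourierInv_eq']
  congr 2; ext ξ
  rw [duhamel, duhamelIntegral, smul_eq_mul, ← integral_indicator measurableSet_Iic,
    ← integral_const_mul]
  congr 1; ext s
  by_cases hs : s ≤ t
  · rw [indicator_of_mem (by exact hs)]
    simp only [heatFreq, if_pos hs, freqSource, map_mul, Complex.conj_ofReal, ← Complex.exp_conj,
      Complex.conj_I]
    push_cast
    ring_nf
  · rw [indicator_of_notMem (by exact hs)]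
    simp [heatFreq, hs]

end Frequency

/-! ### The covariance form -/

section Covariance

variable {d : ℕ} {T α : ℝ}

/-- The measure `dt dx dy` on `(0,T) × ℝᵈ × ℝᵈ`. -/
def covMeasure (d : ℕ) (T : ℝ) : Measure (ℝ × (Space d × Space d)) :=
  (volume.restrict (Ioo 0 T)).prod volume

/-- The integrand of the covariance form. -/
def covIntegrand (α : ℝ) (φ ψ : ℝ × Space d → ℝ) (p : ℝ × (Space d × Space d)) : ℝ :=
  φ (p.1, p.2.1) * besselKernel d α (p.2.1 - p.2.2) * ψ (p.1, p.2.2)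

theorem measurable_covIntegrand {φ ψ : ℝ × Space d → ℝ} (hφ : Measurable φ) (hψ : Measurable ψ) :
    Measurable (covIntegrand α φ ψ) := by
  unfold covIntegrand; fun_prop

theorem enorm_covIntegrand (hα : 0 < α) (φ ψ : ℝ × Space d → ℝ) (p : ℝ × (Space d × Space d)) :
    ‖covIntegrand α φ ψ p‖ₑ =
      ‖φ (p.1, p.2.1)‖ₑ * ENNReal.ofReal (besselKernel d α (p.2.1 - p.2.2)) *
        ‖ψ (p.1, p.2.2)‖ₑ := by
  rw [covIntegrand, enorm_mul, enorm_mul, Real.enorm_of_nonneg (besselKernel_nonneg hα _)]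

theorem lintegral_covIntegrand (hα : 0 < α) {φ ψ : ℝ × Space d → ℝ} (hφ : Measurable φ)
    (hψ : Measurable ψ) : ∫⁻ p, ‖covIntegrand α φ ψ p‖ₑ ∂(covMeasure d T) =
      ∫⁻ t in Ioo (0 : ℝ) T, energy α (fun x => ‖φ (t, x)‖ₑ) (fun x => ‖ψ (t, x)‖ₑ) := by
  have hm := measurable_covIntegrand (α := α) hφ hψ
  rw [covMeasure, lintegral_prod _ (by fun_prop)]
  refine lintegral_congr fun t => ?_
  rw [energy_eq_prod α (by fun_prop) (by fun_prop)]
  exact lintegral_congr fun p => enorm_covIntegrand hα φ ψ (t, p)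

theorem plusNormSq_eq (hα : 0 < α) {φ : ℝ × Space d → ℝ} (hφ : Measurable φ) :
    plusNormSq T (besselKernel d α) φ = ∫⁻ p, ‖covIntegrand α φ φ p‖ₑ ∂(covMeasure d T) :=
  (lintegral_covIntegrand hα hφ hφ).symm

theorem plusNormSq_eq_lintegral_energy (φ : ℝ × Space d → ℝ) :
    plusNormSq T (besselKernel d α) φ =
      ∫⁻ t in Ioo (0 : ℝ) T, energy α (fun x => ‖φ (t, x)‖ₑ) (fun x => ‖φ (t, x)‖ₑ) := rfl

theorem measurable_energy_slice (hα : 0 < α) {φ ψ : ℝ × Space d → ℝ} (hφ : Measurable φ)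
    (hψ : Measurable ψ) : Measurable fun t : ℝ =>
      energy α (fun x => ‖φ (t, x)‖ₑ) (fun x => ‖ψ (t, x)‖ₑ) := by
  have hm := measurable_covIntegrand (α := α) hφ hψ
  have e : (fun t : ℝ => energy α (fun x => ‖φ (t, x)‖ₑ) (fun x => ‖ψ (t, x)‖ₑ)) =
      fun t => ∫⁻ p : Space d × Space d, ‖covIntegrand α φ ψ (t, p)‖ₑ := by
    ext t
    rw [energy_eq_prod α (by fun_prop) (by fun_prop)]
    exact lintegral_congr fun p => (enorm_covIntegrand hα φ ψ (t, p)).symm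
  rw [e]
  exact Measurable.lintegral_prod_right' (f := fun q : ℝ × (Space d × Space d) =>
    ‖covIntegrand α φ ψ q‖ₑ) (by fun_prop)

/-- The mixed energy is bounded by the sum of the two pure ones, at each time. -/
theorem integrable_covIntegrand (hα : 0 < α) {φ ψ : ℝ × Space d → ℝ} (hφ : Measurable φ)
    (hψ : Measurable ψ) (hφ' : plusNormSq T (besselKernel d α) φ < ∞)
    (hψ' : plusNormSq T (besselKernel d α) ψ < ∞) :
    Integrable (covIntegrand α φ ψ) (covMeasure d T) := by
  refine ⟨(measurable_covIntegrand hφ hψ).aestronglyMeasurable, ?_⟩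
  rw [HasFiniteIntegral, lintegral_covIntegrand hα hφ hψ]
  refine lt_of_le_of_lt ?_ (ENNReal.add_lt_top.2 ⟨hφ', hψ'⟩)
  rw [plusNormSq_eq_lintegral_energy, plusNormSq_eq_lintegral_energy,
    ← lintegral_add_left (measurable_energy_slice hα hφ hφ)]
  exact lintegral_mono fun t => le_self_add.trans
    (energy_add_energy_le hα (by fun_prop) (by fun_prop))

theorem covForm_eq {φ ψ : ℝ × Space d → ℝ}
    (h : Integrable (covIntegrand α φ ψ) (covMeasure d T)) :
    covForm T (besselKernel d α) φ ψ = ∫ p, covIntegrand α φ ψ p ∂(covMeasure d T) := by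
  rw [covMeasure, integral_prod _ h, covForm]
  refine integral_congr_ae ?_
  filter_upwards [h.prod_right_ae] with t ht
  rw [Measure.volume_eq_prod] at ht ⊢
  rw [integral_prod _ ht]
  rfl

/-- A triangle inequality up to a factor, which is enough to show that the filter defining
`stochInt` is Cauchy. -/
theorem plusNormSq_sub_le (hα : 0 < α) {φ ψ χ : ℝ × Space d → ℝ} (hφ : Measurable φ)
    (hψ : Measurable ψ) (hχ : Measurable χ) :
    plusNormSq T (besselKernel d α) (fun z => ψ z - χ z) ≤
      2 * plusNormSq T (besselKernel d α) (fun z => φ z - ψ z) +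
        2 * plusNormSq T (besselKernel d α) (fun z => φ z - χ z) := by
  have hφψ : Measurable fun z => φ z - ψ z := hφ.sub hψ
  have hφχ : Measurable fun z => φ z - χ z := hφ.sub hχ
  have h1 := measurable_energy_slice hα hφψ hφψ
  have h2 := measurable_energy_slice hα hφχ hφχ
  rw [plusNormSq_eq_lintegral_energy, plusNormSq_eq_lintegral_energy,
    plusNormSq_eq_lintegral_energy, ← lintegral_const_mul _ h1, ← lintegral_const_mul _ h2,
    ← lintegral_add_left (h1.const_mul _)]
  refine lintegral_mono fun t => ?_
  have hA : Measurable fun x => ‖φ (t, x) - ψ (t, x)‖ₑ := by fun_prop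
  have hB : Measurable fun x => ‖φ (t, x) - χ (t, x)‖ₑ := by fun_prop
  refine le_trans (energy_mono α ?_ ?_) (energy_add_self_le hα hA hB) <;>
  · intro x
    simp only [Pi.add_apply]
    rw [← enorm_neg (φ (t, x) - ψ (t, x))]
    calc _ = ‖-(φ (t, x) - ψ (t, x)) + (φ (t, x) - χ (t, x))‖ₑ := by congr 1; ring
      _ ≤ _ := enorm_add_le _ _

theorem energy_const_mul (c : ℝ≥0∞) {A : Space d → ℝ≥0∞} (hA : Measurable A) :
    energy α (fun x => c * A x) (fun x => c * A x) = c * c * energy α A A := by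
  rw [energy_eq_prod α (by fun_prop) (by fun_prop), energy_eq_prod α hA hA,
    ← lintegral_const_mul _ (by fun_prop)]
  refine lintegral_congr fun p => ?_
  ring

theorem heatKernel_pos {t : ℝ} (ht : 0 < t) (x : Space d) : 0 < heatKernel t x := by
  rw [heatKernel_of_pos ht]; positivity

/-- A test function is dominated by a multiple of the heat kernel at time 1, whose energy is finite
by `energy_heatKernel`; no estimate of the Bessel kernel near its singularity is needed. -/
theorem plusNormSq_test_lt_top (hα : 0 < α) (φ : Test d T) :
    plusNormSq T (besselKernel d α) φ < ∞ := by
  have hk : Continuous fun z : ℝ × Space d => (heatKernel 1 (0 - z.2))⁻¹ := by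
    refine Continuous.inv₀ ?_ fun z => (heatKernel_pos one_pos _).ne'
    simp only [heatKernel_of_pos one_pos]
    fun_prop
  obtain ⟨C, hC⟩ := (φ.continuous.mul hk).bounded_above_of_compact_support
    (φ.hasCompactSupport.mul_right (f' := fun z : ℝ × Space d => (heatKernel 1 (0 - z.2))⁻¹))
  have h1 : ∀ t x, ‖φ (t, x)‖ₑ ≤ ENNReal.ofReal C * ENNReal.ofReal (heatKernel 1 (0 - x)) := by
    intro t x
    have h : ‖φ (t, x) * (heatKernel 1 (0 - x))⁻¹‖ ≤ C := hC (t, x)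
    have hp := heatKernel_pos one_pos (0 - x)
    have hC0 : 0 ≤ C := (norm_nonneg _).trans h
    rw [norm_mul, norm_inv, Real.norm_of_nonneg hp.le] at h
    rw [← ENNReal.ofReal_mul hC0, ← ofReal_norm]
    refine ENNReal.ofReal_le_ofReal ?_
    rwa [mul_inv_le_iff₀ hp] at h
  calc plusNormSq T (besselKernel d α) φ
      ≤ ∫⁻ _ in Ioo (0 : ℝ) T, ENNReal.ofReal C * ENNReal.ofReal C *
          ENNReal.ofReal (heatEnergy α (1 + 1) ((0 : Space d) - 0)) := by
        refine lintegral_mono fun t => ?_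
        rw [← energy_heatKernel hα one_pos one_pos, ← energy_const_mul _ (by fun_prop)]
        exact energy_mono α (h1 t) (h1 t)
    _ < ∞ := by
        rw [setLIntegral_const, Real.volume_Ioo]
        exact ENNReal.mul_lt_top (ENNReal.mul_lt_top (ENNReal.mul_lt_top ENNReal.ofReal_lt_top
          ENNReal.ofReal_lt_top) ENNReal.ofReal_lt_top) ENNReal.ofReal_lt_top

end Covariance

/-! ### The heat kernel as an integrand -/

section Integrand

variable {d : ℕ} {T α : ℝ}

/-- The integrand `G(t-·, x-·)`. -/
def heatIntegrand (t : ℝ) (x : Space d) (z : ℝ × Space d) : ℝ := heatKernel (t - z.1) (x - z.2)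

@[fun_prop]
theorem measurable_heatIntegrand (t : ℝ) (x : Space d) : Measurable (heatIntegrand t x) := by
  unfold heatIntegrand; fun_prop

theorem heatIntegrand_nonneg (t : ℝ) (x : Space d) (z : ℝ × Space d) :
    0 ≤ heatIntegrand t x z := heatKernel_nonneg _ _

theorem heatIntegrand_of_le {t s : ℝ} (h : t ≤ s) (x y : Space d) :
    heatIntegrand t x (s, y) = 0 := if_neg (by simpa using h)

theorem energy_heatIntegrand (hα : 0 < α) (t t' s : ℝ) (x x' : Space d) :
    energy α (fun y => ‖heatIntegrand t x (s, y)‖ₑ) (fun y => ‖heatIntegrand t' x' (s, y)‖ₑ) =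
      if s < t ∧ s < t' then ENNReal.ofReal (heatEnergy α (t - s + (t' - s)) (x - x')) else 0 := by
  split_ifs with h
  · rw [← energy_heatKernel hα (sub_pos.2 h.1) (sub_pos.2 h.2)]
    simp only [heatIntegrand, Real.enorm_of_nonneg (heatKernel_nonneg _ _)]
  · rcases not_and_or.1 h with h | h
    · simp [energy, heatIntegrand_of_le (not_lt.1 h)]
    · simp [energy, heatIntegrand_of_le (not_lt.1 h)]

theorem lintegral_exp_mul_weight {c : ℝ} (hα : 0 < α) (hc : 0 < c) :
    ∫⁻ ξ : Space d, ENNReal.ofReal (Real.exp (-(c * laplaceSymbol ξ)) *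
      (1 + laplaceSymbol ξ) ^ (-(α / 2))) = ENNReal.ofReal (heatEnergy α c (0 : Space d)) := by
  have h0 : ∀ ξ : Space d, 0 ≤ Real.exp (-(c * laplaceSymbol ξ)) *
      (1 + laplaceSymbol ξ) ^ (-(α / 2)) := fun ξ => by
    have := laplaceSymbol_nonneg ξ
    positivity
  rw [heatEnergy]
  simp only [inner_zero_right, mul_zero, Real.cos_zero, mul_one]
  rw [ofReal_integral_eq_lintegral_ofReal _ (Eventually.of_forall h0)]
  refine (integrable_exp_neg_laplaceSymbol hc).mul_bdd (c := 1)
    (Measurable.aestronglyMeasurable (by fun_prop)) (Eventually.of_forall fun ξ => ?_)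
  have := laplaceSymbol_nonneg ξ
  rw [Real.norm_of_nonneg (by positivity)]
  exact Real.rpow_le_one_of_one_le_of_nonpos (by linarith) (by linarith)

/-- For `s < t` the energy of the slice at time `s` equals the squared `L²` norm of the slice of
`heatFreq`. -/
theorem plusNormSq_heatIntegrand_lt_top (hα : max 0 ((d : ℝ) - 2) < α) (t : Time T)
    (x : Space d) : plusNormSq T (besselKernel d α) (heatIntegrand t x) < ∞ := by
  have hα0 : 0 < α := (le_max_left _ _).trans_lt hα
  refine lt_of_le_of_lt ?_ (lintegral_heatFreq_lt_top hα t x)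
  have hm := measurable_heatFreq α t x
  rw [Measure.volume_eq_prod, lintegral_prod _ (by fun_prop)]
  simp only [enorm_heatFreq_sq]
  rw [plusNormSq, ← lintegral_time]
  refine lintegral_mono fun s => ?_
  have h := energy_heatIntegrand hα0 t t s x x
  rw [energy] at h
  simp only at h ⊢
  rw [h]
  split_ifs with h1 h2
  · rw [lintegral_exp_mul_weight hα0 (by linarith [h1.1]), sub_self]
  · exact absurd h1.1.le h2
  · exact zero_le
  · simp

theorem contDiffAt_heatIntegrand (t : ℝ) (x : Space d) {z : ℝ × Space d} (hz : z.1 < t) :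
    ContDiffAt ℝ (⊤ : ℕ∞) (heatIntegrand t x) z := by
  have h1 : heatIntegrand t x =ᶠ[𝓝 z] fun z => (4 * Real.pi * (t - z.1)) ^ (-(d : ℝ) / 2) *
      Real.exp (-‖x - z.2‖ ^ 2 / (4 * (t - z.1))) := by
    filter_upwards [(isOpen_lt continuous_fst continuous_const).mem_nhds hz] with y hy
    exact heatKernel_of_pos (sub_pos.2 hy) _
  refine ContDiffAt.congr_of_eventuallyEq ?_ h1
  have h2 : 0 < t - z.1 := sub_pos.2 hz
  have hp := Real.pi_pos
  have h3 : ContDiffAt ℝ (⊤ : ℕ∞) (fun z : ℝ × Space d => t - z.1) z :=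
    contDiffAt_const.sub contDiffAt_fst
  refine ContDiffAt.mul ?_ (ContDiffAt.exp (ContDiffAt.div ?_ (contDiffAt_const.mul h3) ?_))
  · exact (contDiffAt_const.mul h3).rpow_const_of_ne (by positivity)
  · exact ((contDiffAt_const.sub contDiffAt_snd).norm_sq ℝ).neg
  · positivity

/-- Smooth cutoffs of the heat kernel are test functions. -/
theorem exists_test_heatIntegrand (t : Time T) (x : Space d) :
    ∃ ψ : ℕ → Test d T, (∀ n z, 0 ≤ ψ n z ∧ ψ n z ≤ heatIntegrand t x z) ∧
      ∀ s y, 0 < s → ∀ᶠ n in atTop, ψ n (s, y) = heatIntegrand t x (s, y) := by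
  have key : ∀ n : ℕ, ∃ ψ : Test d T, (∀ z, 0 ≤ ψ z ∧ ψ z ≤ heatIntegrand t x z) ∧
      ∀ s y, 1 / ((n : ℝ) + 1) ≤ s → s ≤ t - 1 / ((n : ℝ) + 1) → ‖y‖ ≤ n →
        ψ (s, y) = heatIntegrand t x (s, y) := by
    intro n
    have hn : 1 / ((n : ℝ) + 2) < 1 / ((n : ℝ) + 1) := by gcongr; norm_num
    have hn0 : 0 < 1 / ((n : ℝ) + 2) := by positivity
    -- The cutoff is 1 on `K` and supported in the compact set `S'`. The gaps `1/(n+2) < 1/(n+1)`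
    -- keep it away from time 0, the edge of the slab, and from time `t`, where the heat kernel is
    -- singular.
    set S : Set (ℝ × Space d) :=
      Ioo (1 / ((n : ℝ) + 2)) (t - 1 / ((n : ℝ) + 2)) ×ˢ Metric.ball 0 ((n : ℝ) + 1)
    set K : Set (ℝ × Space d) :=
      Icc (1 / ((n : ℝ) + 1)) (t - 1 / ((n : ℝ) + 1)) ×ˢ Metric.closedBall 0 (n : ℝ)
    set S' : Set (ℝ × Space d) :=
      Icc (1 / ((n : ℝ) + 2)) (t - 1 / ((n : ℝ) + 2)) ×ˢ Metric.closedBall 0 ((n : ℝ) + 1)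
    have hS : IsOpen S := isOpen_Ioo.prod Metric.isOpen_ball
    have hK : IsClosed K := isClosed_Icc.prod Metric.isClosed_closedBall
    have hS' : IsCompact S' := isCompact_Icc.prod (isCompact_closedBall _ _)
    have hKS : K ⊆ S := prod_mono (fun s hs => ⟨hn.trans_le hs.1, by linarith [hs.2]⟩)
      (Metric.closedBall_subset_ball (by linarith))
    have hSS' : S ⊆ S' := prod_mono Ioo_subset_Icc_self Metric.ball_subset_closedBall
    obtain ⟨χ, hχ, hχ1, hχS, hχK⟩ := exists_contMDiff_support_eq_eq_one_iff
      (modelWithCornersSelf ℝ (ℝ × Space d)) hS hK hKS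
    have hχ01 : ∀ z, 0 ≤ χ z ∧ χ z ≤ 1 := fun z => hχ1 (mem_range_self z)
    have hts : tsupport χ ⊆ S' := by
      rw [tsupport, hχS]; exact closure_minimal hSS' hS'.isClosed
    have hts2 : tsupport (fun z => χ z * heatIntegrand t x z) ⊆ S' :=
      (tsupport_mul_subset_left (f := χ) (g := heatIntegrand (t : ℝ) x)).trans hts
    have hd : ContDiff ℝ (⊤ : ℕ∞) fun z => χ z * heatIntegrand t x z := by
      refine contDiff_iff_contDiffAt.2 fun z => ?_
      by_cases hz : z ∈ tsupport χ
      · have h1 : z.1 ≤ t - 1 / ((n : ℝ) + 2) := (hts hz).1.2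
        exact (contMDiff_iff_contDiff.1 hχ).contDiffAt.mul
          (contDiffAt_heatIntegrand t x (by linarith))
      · refine (contDiffAt_const (c := (0 : ℝ))).congr_of_eventuallyEq ?_
        filter_upwards [notMem_tsupport_iff_eventuallyEq.1 hz] with y hy
        simp [hy]
    refine ⟨⟨fun z => χ z * heatIntegrand t x z, hd,
      hS'.of_isClosed_subset (isClosed_tsupport _) hts2, fun z hz => ?_⟩, fun z => ?_, ?_⟩
    · obtain ⟨⟨h1, h2⟩, -⟩ := hts2 hz
      exact ⟨⟨by linarith, by linarith [t.2.2]⟩, mem_univ _⟩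
    · exact ⟨mul_nonneg (hχ01 z).1 (heatIntegrand_nonneg _ _ _),
        mul_le_of_le_one_left (heatIntegrand_nonneg _ _ _) (hχ01 z).2⟩
    · intro s y h1 h2 h3
      have : χ (s, y) = 1 := (hχK _).1 ⟨⟨h1, h2⟩, by simpa using h3⟩
      change χ (s, y) * _ = _
      rw [this, one_mul]
  choose ψ h1 h2 using key
  refine ⟨ψ, h1, fun s y hs => ?_⟩
  rcases lt_or_ge s t with hst | hst
  · have hlim : Tendsto (fun n : ℕ => 1 / ((n : ℝ) + 1)) atTop (𝓝 0) :=
      tendsto_one_div_add_atTop_nhds_zero_nat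
    filter_upwards [hlim.eventually (gt_mem_nhds hs),
      hlim.eventually (gt_mem_nhds (sub_pos.2 hst)),
      tendsto_natCast_atTop_atTop.eventually (eventually_ge_atTop ‖y‖)] with n a b c
    exact h2 n s y a.le (by linarith) c
  -- At times `s ≥ t` the heat kernel is 0, and the squeeze makes the cutoff 0 as well.
  · refine Eventually.of_forall fun n => ?_
    have := h1 n (s, y)
    rw [heatIntegrand_of_le hst] at this ⊢
    exact le_antisymm this.2 this.1

end Integrand

/-! ### The process solution -/

section Solution

variable {d : ℕ} {T α : ℝ} {Ω : Type*} [MeasurableSpace Ω] {P : Measure Ω} {F : Test d T → Ω → ℝ}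

theorem measurable_test (φ : Test d T) : Measurable φ := φ.continuous.measurable

theorem integrable_covIntegrand_test (hα : 0 < α) (φ ψ : Test d T) :
    Integrable (covIntegrand α φ ψ) (covMeasure d T) :=
  integrable_covIntegrand hα (measurable_test φ) (measurable_test ψ)
    (plusNormSq_test_lt_top hα φ) (plusNormSq_test_lt_top hα ψ)

theorem IsNoise.inner_toL2 (hα : 0 < α) (hF : IsNoise T (besselKernel d α) P F)
    (φ ψ : Test d T) :
    inner ℝ (hF.toL2 φ) (hF.toL2 ψ) = ∫ p, covIntegrand α φ ψ p ∂(covMeasure d T) := by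
  rw [← covForm_eq (integrable_covIntegrand_test hα φ ψ), ← hF.covariance, L2.inner_def]
  refine integral_congr_ae ?_
  filter_upwards [MemLp.coeFn_toLp (hF.gaussian.hasGaussianLaw_eval φ).memLp_two,
    MemLp.coeFn_toLp (hF.gaussian.hasGaussianLaw_eval ψ).memLp_two] with ω h1 h2
  rw [IsNoise.toL2, IsNoise.toL2, h1, h2]
  simp [mul_comm]

/-- `F` is not assumed linear; expanding the square expresses the distance through covariances
alone, and their combination is the covariance form of `φ - ψ`. -/
theorem IsNoise.norm_sub_sq_toL2_le (hα : 0 < α) (hF : IsNoise T (besselKernel d α) P F)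
    (φ ψ : Test d T) :
    ‖hF.toL2 φ - hF.toL2 ψ‖ₑ ^ 2 ≤ plusNormSq T (besselKernel d α) (fun z => φ z - ψ z) := by
  have h1 := integrable_covIntegrand_test hα φ φ
  have h2 := integrable_covIntegrand_test hα φ ψ
  have h3 := integrable_covIntegrand_test hα ψ φ
  have h4 := integrable_covIntegrand_test hα ψ ψ
  have e : ‖hF.toL2 φ - hF.toL2 ψ‖ ^ 2 =
      ∫ p, covIntegrand α (fun z => φ z - ψ z) (fun z => φ z - ψ z) p ∂(covMeasure d T) := by
    rw [← real_inner_self_eq_norm_sq, inner_sub_left, inner_sub_right, inner_sub_right,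
      hF.inner_toL2 hα, hF.inner_toL2 hα, hF.inner_toL2 hα, hF.inner_toL2 hα,
      ← integral_sub h1 h2, ← integral_sub h3 h4]
    refine (integral_sub (h1.sub h2) (h3.sub h4)).symm.trans ?_
    refine integral_congr_ae (Eventually.of_forall fun p => ?_)
    simp only [covIntegrand, Pi.sub_apply]
    ring
  have hm : Measurable fun z => φ z - ψ z := (measurable_test φ).sub (measurable_test ψ)
  rw [plusNormSq_eq hα hm, ← ofReal_norm, ← ENNReal.ofReal_pow (norm_nonneg _), e]
  exact (Real.ofReal_le_enorm _).trans (enorm_integral_le_lintegral_enorm _)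

/-- If test functions approach `φ` in `‖·‖₊`, then the noise variables converge to the stochastic
integral of `φ`. -/
theorem IsNoise.tendsto_stochInt (hα : 0 < α) (hF : IsNoise T (besselKernel d α) P F)
    {φ : ℝ × Space d → ℝ} (hφ : Measurable φ) {ψ : ℕ → Test d T}
    (hψ : Tendsto (fun n => plusNormSq T (besselKernel d α) (fun z => φ z - ψ n z)) atTop (𝓝 0)) :
    Tendsto (fun n => hF.toL2 (ψ n)) atTop (𝓝 (hF.stochInt φ)) := by
  set l : Filter (Test d T) :=
    comap (fun ψ : Test d T => plusNormSq T (besselKernel d α) (fun z => φ z - ψ z)) (𝓝 0)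
  have hl : Tendsto ψ atTop l := tendsto_comap_iff.2 hψ
  -- The given sequence is what makes the filter proper. Its image is then Cauchy, so `limUnder` is
  -- a true limit and not a default value.
  have : l.NeBot := hl.neBot
  have hl0 : Tendsto (fun ψ : Test d T => plusNormSq T (besselKernel d α) (fun z => φ z - ψ z))
      l (𝓝 0) := tendsto_comap
  have hc : Cauchy (map hF.toL2 l) := by
    rw [cauchy_map_iff]
    refine ⟨this, ?_⟩
    rw [uniformity_basis_edist.tendsto_right_iff]
    intro ε hε
    have hε2 : 0 < ε ^ 2 := by positivity
    have h2 : Tendsto (fun p : Test d T × Test d T =>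
        2 * plusNormSq T (besselKernel d α) (fun z => φ z - p.1 z) +
          2 * plusNormSq T (besselKernel d α) (fun z => φ z - p.2 z)) (l ×ˢ l) (𝓝 0) := by
      have h3 : ∀ {f : Test d T × Test d T → ℝ≥0∞}, Tendsto f (l ×ˢ l) (𝓝 0) →
          Tendsto (fun p => 2 * f p) (l ×ˢ l) (𝓝 0) := fun h => by
        simpa using ENNReal.Tendsto.const_mul h (Or.inr (ENNReal.ofNat_ne_top (n := 2)))
      simpa using (h3 (hl0.comp tendsto_fst)).add (h3 (hl0.comp tendsto_snd))
    filter_upwards [h2.eventually (gt_mem_nhds hε2)] with p hp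
    change edist (hF.toL2 p.1) (hF.toL2 p.2) < ε
    rw [edist_eq_enorm_sub]
    have h5 := (hF.norm_sub_sq_toL2_le hα p.1 p.2).trans
      (plusNormSq_sub_le hα hφ (measurable_test p.1) (measurable_test p.2))
    exact lt_of_not_ge fun h6 => (pow_le_pow_left' h6 2).not_gt (h5.trans_lt hp)
  obtain ⟨Y, hY⟩ := CompleteSpace.complete hc
  exact (tendsto_nhds_limUnder ⟨Y, hY⟩).comp hl

theorem ae_covMeasure_pos : ∀ᵐ p ∂(covMeasure d T), 0 < p.1 := by
  have h : ∀ᵐ t ∂(volume.restrict (Ioo 0 T)), 0 < t :=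
    (ae_restrict_mem measurableSet_Ioo).mono fun t ht => ht.1
  exact Measure.quasiMeasurePreserving_fst.ae h

/-- Dominated convergence: since `0 ≤ ψ n ≤ G`, the difference `G - ψ n` lies between 0 and `G`,
which has finite norm. -/
theorem tendsto_plusNormSq_heatIntegrand (hα : max 0 ((d : ℝ) - 2) < α) (t : Time T)
    (x : Space d) {ψ : ℕ → Test d T} (h1 : ∀ n z, 0 ≤ ψ n z ∧ ψ n z ≤ heatIntegrand t x z)
    (h2 : ∀ s y, 0 < s → ∀ᶠ n in atTop, ψ n (s, y) = heatIntegrand t x (s, y)) :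
    Tendsto (fun n => plusNormSq T (besselKernel d α) (fun z => heatIntegrand t x z - ψ n z))
      atTop (𝓝 0) := by
  have hα0 : 0 < α := (le_max_left _ _).trans_lt hα
  have hm : ∀ n, Measurable fun z => heatIntegrand (t : ℝ) x z - ψ n z := fun n =>
    (measurable_heatIntegrand _ _).sub (measurable_test _)
  have hG := measurable_heatIntegrand (t : ℝ) x
  simp only [fun n => plusNormSq_eq (T := T) hα0 (hm n)]
  rw [show (0 : ℝ≥0∞) = ∫⁻ _, 0 ∂(covMeasure d T) by simp]
  refine tendsto_lintegral_of_dominated_convergence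
    (fun p => ‖covIntegrand α (heatIntegrand t x) (heatIntegrand t x) p‖ₑ)
    (fun n => (measurable_covIntegrand (hm n) (hm n)).enorm) (fun n => ?_) ?_ ?_
  · refine Eventually.of_forall fun p => ?_
    simp only [enorm_covIntegrand hα0]
    have h3 : ∀ z, ‖heatIntegrand (t : ℝ) x z - ψ n z‖ₑ ≤ ‖heatIntegrand (t : ℝ) x z‖ₑ := by
      intro z
      rw [Real.enorm_of_nonneg (sub_nonneg.2 (h1 n z).2),
        Real.enorm_of_nonneg (heatIntegrand_nonneg _ _ _)]
      exact ENNReal.ofReal_le_ofReal (sub_le_self _ (h1 n z).1)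
    exact mul_le_mul' (mul_le_mul' (h3 _) le_rfl) (h3 _)
  · rw [← plusNormSq_eq hα0 hG]
    exact (plusNormSq_heatIntegrand_lt_top hα t x).ne
  · filter_upwards [ae_covMeasure_pos] with p hp
    refine tendsto_const_nhds.congr' ?_
    filter_upwards [h2 p.1 p.2.1 hp] with n hn
    simp [covIntegrand, hn]

theorem IsNoise.inner_solution_eq_integral (hα : max 0 ((d : ℝ) - 2) < α)
    (hF : IsNoise T (besselKernel d α) P F) (t t' : Time T) (x x' : Space d) :
    inner ℝ (hF.solution t x) (hF.solution t' x') =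
      ∫ p, covIntegrand α (heatIntegrand t x) (heatIntegrand t' x') p ∂(covMeasure d T) := by
  have hα0 : 0 < α := (le_max_left _ _).trans_lt hα
  obtain ⟨ψ, h1, h2⟩ := exists_test_heatIntegrand t x
  obtain ⟨ψ', h1', h2'⟩ := exists_test_heatIntegrand t' x'
  have hG := measurable_heatIntegrand (t : ℝ) x
  have hG' := measurable_heatIntegrand (t' : ℝ) x'
  have hu := hF.tendsto_stochInt hα0 hG (tendsto_plusNormSq_heatIntegrand hα t x h1 h2)
  have hu' := hF.tendsto_stochInt hα0 hG' (tendsto_plusNormSq_heatIntegrand hα t' x' h1' h2')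
  refine tendsto_nhds_unique (hu.inner hu') ?_
  simp only [hF.inner_toL2 hα0]
  refine tendsto_integral_of_dominated_convergence
    (fun p => ‖covIntegrand α (heatIntegrand t x) (heatIntegrand t' x') p‖)
    (fun n => (measurable_covIntegrand (measurable_test _)
      (measurable_test _)).aestronglyMeasurable)
    (integrable_covIntegrand hα0 hG hG' (plusNormSq_heatIntegrand_lt_top hα t x)
      (plusNormSq_heatIntegrand_lt_top hα t' x')).norm (fun n => ?_) ?_
  · refine Eventually.of_forall fun p => ?_
    simp only [covIntegrand, norm_mul]
    have h3 : ∀ z, ‖ψ n z‖ ≤ ‖heatIntegrand (t : ℝ) x z‖ := fun z =>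
      norm_le_norm_of_abs_le_abs (abs_le_abs_of_nonneg (h1 n z).1 (h1 n z).2)
    have h3' : ∀ z, ‖ψ' n z‖ ≤ ‖heatIntegrand (t' : ℝ) x' z‖ := fun z =>
      norm_le_norm_of_abs_le_abs (abs_le_abs_of_nonneg (h1' n z).1 (h1' n z).2)
    gcongr
    · exact h3 _
    · exact h3' _
  · filter_upwards [ae_covMeasure_pos] with p hp
    refine tendsto_const_nhds.congr' ?_
    filter_upwards [h2 p.1 p.2.1 hp, h2' p.1 p.2.2 hp] with n hn hn'
    simp [covIntegrand, hn, hn']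

/-- The integrand is nonnegative, so the Bochner integral over space can be computed as an energy in
`ℝ≥0∞`. -/
theorem integral_covIntegrand_heatIntegrand (hα : max 0 ((d : ℝ) - 2) < α) (t t' : Time T)
    (x x' : Space d) :
    ∫ p, covIntegrand α (heatIntegrand t x) (heatIntegrand t' x') p ∂(covMeasure d T) =
      ∫ s in Ioo (0 : ℝ) T, if s < t ∧ s < t' then
        heatEnergy α (t - s + (t' - s)) (x - x') else 0 := by
  have hα0 : 0 < α := (le_max_left _ _).trans_lt hα
  have hG := measurable_heatIntegrand (t : ℝ) x
  have hG' := measurable_heatIntegrand (t' : ℝ) x'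
  have hnn : ∀ p, 0 ≤ covIntegrand α (heatIntegrand t x) (heatIntegrand t' x') p := fun p =>
    mul_nonneg (mul_nonneg (heatIntegrand_nonneg _ _ _) (besselKernel_nonneg hα0 _))
      (heatIntegrand_nonneg _ _ _)
  have hi := integrable_covIntegrand hα0 hG hG' (plusNormSq_heatIntegrand_lt_top hα t x)
    (plusNormSq_heatIntegrand_lt_top hα t' x')
  rw [covMeasure] at hi ⊢
  rw [integral_prod _ hi]
  refine integral_congr_ae ?_
  filter_upwards [hi.prod_right_ae] with s hs
  rw [integral_eq_lintegral_of_nonneg_ae (Eventually.of_forall fun q => hnn (s, q))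
    hs.aestronglyMeasurable]
  have h := energy_heatIntegrand hα0 t t' s x x'
  rw [energy_eq_prod α (by fun_prop) (by fun_prop)] at h
  have e : ∫⁻ q : Space d × Space d,
      ENNReal.ofReal (covIntegrand α (heatIntegrand t x) (heatIntegrand t' x') (s, q)) =
      if s < t ∧ s < t' then ENNReal.ofReal (heatEnergy α (t - s + (t' - s)) (x - x')) else 0 := by
    rw [← h]
    refine lintegral_congr fun q => ?_
    rw [← Real.enorm_of_nonneg (hnn _), enorm_covIntegrand hα0]
  rw [e]
  split_ifs with h1
  · exact ENNReal.toReal_ofReal (heatEnergy_nonneg hα0 (by linarith [h1.1, h1.2]) _)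
  · simp

/-- The covariance of the process solution. -/
theorem IsNoise.inner_solution (hα : max 0 ((d : ℝ) - 2) < α)
    (hF : IsNoise T (besselKernel d α) P F) (t t' : Time T) (x x' : Space d) :
    inner ℝ (hF.solution t x) (hF.solution t' x') =
      inner ℝ (heatFreqL2 hα (t, x)) (heatFreqL2 hα (t', x')) := by
  rw [hF.inner_solution_eq_integral hα, integral_covIntegrand_heatIntegrand hα,
    inner_heatFreqL2]
  have e := integral_time (T := T) fun s : ℝ => if s ≤ t ∧ s ≤ t' then
    heatEnergy α (t - s + (t' - s)) (x - x') else 0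
  simp only [Subtype.coe_le_coe] at e
  rw [e]
  refine setIntegral_congr_ae measurableSet_Ioo ?_
  -- The heat kernel vanishes at `s = t` while `heatFreq` includes it; the two conventions differ at
  -- two times only.
  have h1 : ∀ᵐ s : ℝ, s ≠ t := by simp [ae_iff]
  have h2 : ∀ᵐ s : ℝ, s ≠ t' := by simp [ae_iff]
  filter_upwards [h1, h2] with s hs hs' _
  simp only [lt_iff_le_and_ne, hs, hs', ne_eq, not_false_eq_true, and_true]

end Solution

/-! ### The reproducing kernel Hilbert space -/

section RKHS

variable {d : ℕ} {T α : ℝ} {Ω : Type*} [MeasurableSpace Ω] {P : Measure Ω} {F : Test d T → Ω → ℝ}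

theorem rkhsFun_eq_inner (u : Time T → Space d → Lp ℝ 2 P) (Y : Lp ℝ 2 P) (t : Time T)
    (x : Space d) : rkhsFun u Y t x = inner ℝ (u t x) Y := by
  rw [L2.inner_def]
  simp [rkhsFun]

theorem fourierNormSq_freqSource_eq (Y : Lp ℂ 2 (volume : Measure (Time T × Space d)))
    {y : Time T × Space d → ℂ} (hy : Measurable y) (hYy : Y =ᵐ[volume] y) :
    fourierNormSq (α / 2) (freqSource α y) ^ (1 / 2 : ℝ) = ENNReal.ofReal ‖Y‖ := by
  rw [fourierNormSq_freqSource hy, ofReal_norm, Lp.enorm_def, eLpNorm_congr_ae hYy,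
    eLpNorm_eq_lintegral_rpow_enorm_toReal two_ne_zero ENNReal.ofNat_ne_top]
  simp

/-- Every function in the reproducing kernel Hilbert space is the field of a source whose norm is
that of the function. -/
theorem IsNoise.exists_heatField_of_mem_gaussianSpace (hα : max 0 ((d : ℝ) - 2) < α)
    (hF : IsNoise T (besselKernel d α) P F) {Y : Lp ℝ 2 P} (hY : Y ∈ gaussianSpace hF.solution) :
    ∃ k : Time T × Space d → ℂ, Measurable k ∧ rkhsFun hF.solution Y = heatField k ∧
      fourierNormSq (α / 2) k ^ (1 / 2 : ℝ) = ENNReal.ofReal ‖Y‖ := by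
  obtain ⟨y, -, hn, hi⟩ := exists_inner_eq_of_gram_eq
    (u := fun z : Time T × Space d => hF.solution z.1 z.2) (e := heatFreqL2 hα)
    (fun z z' => hF.inner_solution hα z.1 z'.1 z.2 z'.2) hY
  have hym := (Lp.aestronglyMeasurable y).aemeasurable
  have hae := hym.ae_eq_mk
  have hm := hym.measurable_mk
  refine ⟨freqSource α (hym.mk y), by unfold freqSource; fun_prop, ?_, ?_⟩
  · funext t x
    rw [rkhsFun_eq_inner, ← inner_heatFreqL2_eq hα t x y hae]
    exact hi (t, x)
  · rw [fourierNormSq_freqSource_eq y hm hae, hn]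

/-- The field of every source of finite norm is in the reproducing kernel Hilbert space. -/
theorem IsNoise.exists_mem_gaussianSpace_of_source (hα : max 0 ((d : ℝ) - 2) < α)
    (hF : IsNoise T (besselKernel d α) P F) {k : Time T × Space d → ℂ} (hm : Measurable k)
    (hk : fourierNormSq (α / 2) k < ∞) :
    ∃ Y ∈ gaussianSpace hF.solution, rkhsFun hF.solution Y = heatField k ∧
      ENNReal.ofReal ‖Y‖ ≤ fourierNormSq (α / 2) k ^ (1 / 2 : ℝ) := by
  set w : Time T × Space d → ℂ := fun z => ((1 + laplaceSymbol z.2) ^ (α / 4) : ℝ) * k z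
  have hwm : Measurable w := by fun_prop
  have hwk : freqSource α w = k := by
    funext z
    have hl := laplaceSymbol_nonneg z.2
    rw [freqSource, ← mul_assoc, ← Complex.ofReal_mul, ← Real.rpow_add (by positivity)]
    simp
  have hw : MemLp w 2 := memLp_two_of_lintegral_sq hwm.aestronglyMeasurable (by
    rwa [← fourierNormSq_freqSource (α := α) hwm, hwk])
  have hae : hw.toLp w =ᵐ[volume] w := hw.coeFn_toLp
  -- `w` need not lie in the closed span of the `heatFreqL2` family. Its orthogonal projection there
  -- has the same inner products with the family and no larger norm, which is why only an inequality
  -- of norms is claimed.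
  set S := (Submodule.span ℝ (range (heatFreqL2 (T := T) hα))).topologicalClosure
  have hSc : IsClosed (S : Set (Lp ℂ 2 (volume : Measure (Time T × Space d)))) :=
    Submodule.isClosed_topologicalClosure _
  have : CompleteSpace S := hSc.completeSpace_coe
  obtain ⟨Y, hY, hn, hi⟩ := exists_inner_eq_of_gram_eq
    (u := heatFreqL2 hα) (e := fun z : Time T × Space d => hF.solution z.1 z.2)
    (fun z z' => (hF.inner_solution hα z.1 z'.1 z.2 z'.2).symm)
    (Submodule.starProjection_apply_mem S (hw.toLp w))
  refine ⟨Y, hY, ?_, ?_⟩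
  · funext t x
    rw [rkhsFun_eq_inner, ← hwk, ← inner_heatFreqL2_eq hα t x _ hae]
    refine (hi (t, x)).symm.trans ?_
    have hmem : heatFreqL2 hα (t, x) ∈ S :=
      Submodule.le_topologicalClosure _ (Submodule.subset_span (mem_range_self _))
    rw [← Submodule.inner_starProjection_left_eq_right,
      Submodule.starProjection_eq_self_iff.2 hmem]
  · rw [hn, ← hwk, fourierNormSq_freqSource_eq _ hwm hae]
    exact ENNReal.ofReal_le_ofReal (Submodule.norm_starProjection_apply_le S _)

/-- A distribution determines its representing function only almost everywhere; continuity selects a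
single one. -/
theorem IsNoise.continuous_of_mem_rkhs (hα : max 0 ((d : ℝ) - 2) < α)
    (hF : IsNoise T (besselKernel d α) P F) {h : Time T → Space d → ℝ}
    (hh : h ∈ rkhs hF.solution) (t : Time T) : Continuous (h t) := by
  obtain ⟨Y, hY, rfl⟩ := hh
  obtain ⟨k, hm, hk, hn⟩ := hF.exists_heatField_of_mem_gaussianSpace hα hY
  rw [hk]
  refine continuous_heatField (integrable_duhamel hα hm ?_ t)
  exact fourierNormSq_lt_top_of_rpow (hn.trans_lt ENNReal.ofReal_lt_top)

theorem IsNoise.exists_represents_of_mem_rkhs (hα : max 0 ((d : ℝ) - 2) < α)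
    (hF : IsNoise T (besselKernel d α) P F) {h : Time T → Space d → ℝ}
    (hh : h ∈ rkhs hF.solution) :
    ∃ v : Time T → 𝓢'(Space d, ℂ), MemParabolic (α / 2 + 2) v ∧ Represents h v ∧
      parabolicNorm (α / 2 + 2) v ≤ ENNReal.ofReal (2 * rkhsNorm hF.solution h) := by
  obtain ⟨Y, hY, rfl⟩ := hh
  obtain ⟨k, hm, hk, hn⟩ := hF.exists_heatField_of_mem_gaussianSpace hα hY
  obtain ⟨v, h1, h2, h3⟩ := exists_represents_heatField hα hm
    (fourierNormSq_lt_top_of_rpow (hn.trans_lt ENNReal.ofReal_lt_top))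
  refine ⟨v, h1, hk ▸ h2, h3.trans_eq ?_⟩
  rw [hn, rkhsNorm_rkhsFun _ hY, ENNReal.ofReal_mul zero_le_two, ENNReal.ofReal_ofNat]

/-- An element of the parabolic space with source `g` is in the reproducing kernel Hilbert space,
with norm at most that of `g`. -/
theorem IsNoise.exists_mem_gaussianSpace_of_memParabolic (hα : max 0 ((d : ℝ) - 2) < α)
    (hF : IsNoise T (besselKernel d α) P F) {v g : Time T → 𝓢'(Space d, ℂ)}
    (hv : MemParabolic (α / 2 + 2) v) (hg : SolvesHeat v g) {a : ℝ≥0∞}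
    (ha : l2SobolevNorm (α / 2) g < a) :
    ∃ Y ∈ gaussianSpace hF.solution, Represents (rkhsFun hF.solution Y) v ∧
      ENNReal.ofReal ‖Y‖ ≤ a := by
  obtain ⟨k, hm, hgk, hka⟩ := exists_of_l2SobolevNorm_lt ha
  have hk := fourierNormSq_lt_top_of_rpow hka
  obtain ⟨Y, hY, h1, h2⟩ := hF.exists_mem_gaussianSpace_of_source hα hm hk
  exact ⟨Y, hY, h1 ▸ represents_heatField_of_memParabolic hα hv hg hm hk hgk, h2.trans hka.le⟩

/-- The source term of the norm suffices: each source `g` of `v` yields some `Y` of norm at most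
that of `g`, and `h = h_Y` by continuity. -/
theorem IsNoise.rkhsNorm_le_parabolicNorm (hα : max 0 ((d : ℝ) - 2) < α)
    (hF : IsNoise T (besselKernel d α) P F) {h : Time T → Space d → ℝ}
    (hh : h ∈ rkhs hF.solution) {v : Time T → 𝓢'(Space d, ℂ)} (hv : MemParabolic (α / 2 + 2) v)
    (hhv : Represents h v) :
    ENNReal.ofReal (rkhsNorm hF.solution h) ≤ parabolicNorm (α / 2 + 2) v := by
  refine le_trans (le_iInf₂ fun g hg => ?_) le_add_self
  rw [add_sub_cancel_right]
  -- The norm of `g` is an infimum over Fourier representatives, so a representative is available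
  -- only for strict upper bounds.
  refine le_of_forall_gt fun a ha => ?_
  obtain ⟨b, hb, hba⟩ := exists_between ha
  obtain ⟨Y, hY, h1, h2⟩ := hF.exists_mem_gaussianSpace_of_memParabolic hα hv hg hb
  have e : h = rkhsFun hF.solution Y := hhv.eq h1 (hF.continuous_of_mem_rkhs hα hh)
    (hF.continuous_of_mem_rkhs hα ⟨Y, hY, rfl⟩)
  rw [e, rkhsNorm_rkhsFun _ hY]
  exact h2.trans_lt hba

end RKHS

end HeatRKHS

end

open HeatRKHS

theorem corollary4p5 (d : ℕ) (hd : 1 ≤ d) (α : ℝ) (hα : max 0 ((d : ℝ) - 2) < α)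
    (T : ℝ) (hT : 0 < T) :
    ∃ c C : ℝ, 0 < c ∧ 0 < C ∧
      ∀ (Ω : Type*) [MeasurableSpace Ω] (P : Measure Ω) [IsProbabilityMeasure P]
        (F : Test d T → Ω → ℝ) (hF : IsNoise T (besselKernel d α) P F),
        (∀ h ∈ rkhs hF.solution, ∃ v : Time T → 𝓢'(Space d, ℂ),
          MemParabolic (α / 2 + 2) v ∧ Represents h v) ∧
        (∀ v : Time T → 𝓢'(Space d, ℂ), MemParabolic (α / 2 + 2) v →
          ∃! h : Time T → Space d → ℝ, h ∈ rkhs hF.solution ∧ Represents h v) ∧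
        (∀ h ∈ rkhs hF.solution, ∀ v : Time T → 𝓢'(Space d, ℂ), Represents h v →
          ENNReal.ofReal (c * rkhsNorm hF.solution h) ≤ parabolicNorm (α / 2 + 2) v ∧
          parabolicNorm (α / 2 + 2) v ≤ ENNReal.ofReal (C * rkhsNorm hF.solution h)) := by
  -- `c = 1` because the source term alone dominates the norm of `h`; `C = 2` because the Hessian
  -- and the source are each bounded by it.
  refine ⟨1, 2, one_pos, two_pos, fun Ω _ P _ F hF => ⟨fun h hh => ?_, fun v hv => ?_,
    fun h hh v hhv => ?_⟩⟩
  · obtain ⟨v, h1, h2, -⟩ := hF.exists_represents_of_mem_rkhs hα hh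
    exact ⟨v, h1, h2⟩
  · obtain ⟨g, hg, hs⟩ := hv.source
    rw [add_sub_cancel_right] at hg
    obtain ⟨Y, hY, h1, -⟩ := hF.exists_mem_gaussianSpace_of_memParabolic hα hv hs hg
    exact ⟨_, ⟨⟨Y, hY, rfl⟩, h1⟩, fun h ⟨hh, hhv⟩ => hhv.eq h1 (hF.continuous_of_mem_rkhs hα hh)
      (hF.continuous_of_mem_rkhs hα ⟨Y, hY, rfl⟩)⟩
  · obtain ⟨v', h1, h2, h3⟩ := hF.exists_represents_of_mem_rkhs hα hh
    -- The function `h` determines the distributions, so an arbitrary `v` represented by `h` is the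
    -- one constructed and lies in the parabolic space.
    obtain rfl := hhv.distribution_eq h2
    exact ⟨by simpa using hF.rkhsNorm_le_parabolicNorm hα hh h1 hhv, h3⟩
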